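/- **Theorem (composition).** Let $N\ge 1$ and let $\mathcal D$ be a distribution of tangent hyperplanes (codimension $1$) on $\mathbb R^N$ admitting a global frame $X_i=\sum_{j=1}^N A_i^j(x)\,\partial/\partial x^j$, $i=1,\dots,N$, such that $X_1,\dots,X_{N-1}$ span $\mathcal D_x$ at every $x$, the coefficients $A_i^j$ are $C^\infty$ with $\|\partial_x^I A_i^j\|_{L^\infty}<\infty$ for all multiindices $I$, and $|\det(A_i^j(x))|\ge c>0$ uniformly in $x$. Fix such a frame, let $(B_j^k(x))$ be the inverse matrix, $\sum_j A_i^jB_j^k=\delta_i^k$, and put $$\rho_x(\xi)=\Big(\sum_{i=1}^{N-1}\Big|\sum_{j=1}^N A_i^j(x)\xi_j\Big|^2\Big)^{1/2},\qquad D_\xi=\sum_{j=1}^N B_j^N(x)\frac{\partial}{\partial\xi_j},$$ $$D_i=\frac{\partial}{\partial x^i}+\sum_{k,p,l=1}^N\frac{\partial B_k^p}{\partial x^i}(x)\,A_p^l(x)\,\xi_l\,\frac{\partial}{\partial\xi_k}\quad(1\le i\le N),\qquad D^I=D_{i_1}\cdots D_{i_k}\ \text{ for } I=(i_1,\dots,i_k).$$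 For $m,n\in\mathbb R$ let $S^{m,n}$ be the set of all complex-valued $a\in C^\infty(\mathbb R^N\times\mathbb R^N)$ such that for all $\alpha,\beta,I$ there is a constant $C_{\alpha,\beta,I}$ with $$|\partial_\xi^\alpha D_\xi^\beta D^I a(x,\xi)|\le C_{\alpha,\beta,I}\,(1+|\xi|)^{m-\beta}\,(1+\rho_x(\xi)+|\xi|^{1/2})^{n-|\alpha|}\qquad\text{for all }x,\xi\in\mathbb R^N ,$$ where $\alpha$ is a multiindex and $\beta\ge 0$ an integer. For $f\in\mathcal S(\mathbb R^N)$ let $$T_af(x)=\int_{\mathbb R^N}a(x,\xi)\,\widehat f(\xi)\,e^{2\pi i x\cdot\xi}\,d\xi,\qquad \widehat f(\xi)=\int_{\mathbb R^N}f(y)e^{-2\pi i y\cdot\xi}\,dy .$$ If $a_1\in S^{m_1,n_1}$ and $a_2\in S^{m_2,n_2}$, then $T_{a_1}$ and $T_{a_2}$ map $\mathcal S(\mathbb R^N)$ linearly into itself, and there is a symbol $a\in S^{m_1+m_2,\,n_1+n_2}$ with $$T_{a_1}\circ T_{a_2}=T_a\quad\text{on }\mathcal S(\mathbb R^N).$$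 Consequently, writing $\Psi^{m,n}=\{T_a: a\in S^{m,n}\}$, both $\bigcup_{m,n\in\mathbb R}\Psi^{m,n}$ and $\Psi^{0,0}$ are (unital) subalgebras of the algebra of linear operators on $\mathcal S(\mathbb R^N)$. -/

import Mathlib

open scoped FourierTransform SchwartzMap ContDiff

noncomputable section

namespace MixedSymbol

/-- `ℝ^N` with `N = d + 1`. Tangent and cotangent spaces are identified with `ℝ^N` through the
standard coordinates; the distinguished last index `N` is `Fin.last d`. -/
abbrev Space (d : ℕ) : Type := EuclideanSpace ℝ (Fin (d + 1))

/-- A global frame `X_i = ∑ j, A_i^j(x) ∂/∂x^j`, `i = 1, …, N`, adapted to the distribution `D` of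
tangent hyperplanes: the first `N - 1` fields span `D` at every point, all derivatives of the
coefficients are bounded (in particular the coefficients themselves), and `|det A|` is bounded
from below. Here `A x i j` is `A_i^j(x)`. -/
structure AdaptedFrame {d : ℕ} (D : Space d → Submodule ℝ (Space d)) where
  A : Space d → Matrix (Fin (d + 1)) (Fin (d + 1)) ℝ
  smooth : ∀ i j, ContDiff ℝ ∞ (fun x => A x i j)
  bounded : ∀ (i j : Fin (d + 1)) (k : ℕ), ∃ C : ℝ, ∀ x : Space d,
    ‖iteratedFDeriv ℝ k (fun y => A y i j) x‖ ≤ C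
  det_bound : ∃ c : ℝ, 0 < c ∧ ∀ x, c ≤ |(A x).det|
  spans : ∀ x, D x =
    Submodule.span ℝ (Set.range fun i : Fin d => (WithLp.toLp 2 (A x i.castSucc) : Space d))

variable {d : ℕ} {D : Space d → Submodule ℝ (Space d)}

/-- The inverse matrix: `B x j k` is `B_j^k(x)`, with `∑ j, A_i^j B_j^k = δ_i^k`. -/
def AdaptedFrame.B (X : AdaptedFrame D) (x : Space d) :
    Matrix (Fin (d + 1)) (Fin (d + 1)) ℝ := (X.A x)⁻¹

/-- The `i`-th component `∑ j, A_i^j(x) ξ_j` of `M_x ξ`. -/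
def AdaptedFrame.M (X : AdaptedFrame D) (x ξ : Space d) (i : Fin (d + 1)) : ℝ :=
  ∑ j, X.A x i j * ξ j

/-- The variable seminorm `ρ_x(ξ)`: the Euclidean length of the first `N - 1` components of
`M_x ξ`. -/
def AdaptedFrame.rho (X : AdaptedFrame D) (x ξ : Space d) : ℝ :=
  Real.sqrt (∑ i : Fin d, (X.M x ξ i.castSucc) ^ 2)

/-- The coordinate derivative `∂/∂x^i` of a function of `(x, ξ)`. -/
def partialX (i : Fin (d + 1)) (a : Space d × Space d → ℂ) : Space d × Space d → ℂ :=
  fun p => fderiv ℝ a p (EuclideanSpace.single i 1, 0)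

/-- The coordinate derivative `∂/∂ξ_j` of a function of `(x, ξ)`. -/
def partialXi (j : Fin (d + 1)) (a : Space d × Space d → ℂ) : Space d × Space d → ℂ :=
  fun p => fderiv ℝ a p (0, EuclideanSpace.single j 1)

/-- `D_ξ = ∑ j, B_j^N(x) ∂/∂ξ_j`. -/
def AdaptedFrame.Dxi (X : AdaptedFrame D) (a : Space d × Space d → ℂ) :
    Space d × Space d → ℂ :=
  fun p => ∑ j, X.B p.1 j (Fin.last d) • partialXi j a p

/-- `D_i = ∂/∂x^i + ∑ k q l, (∂B_k^q/∂x^i)(x) A_q^l(x) ξ_l ∂/∂ξ_k`. -/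
def AdaptedFrame.Dx (X : AdaptedFrame D) (i : Fin (d + 1)) (a : Space d × Space d → ℂ) :
    Space d × Space d → ℂ :=
  fun p => partialX i a p + ∑ k, ∑ q, ∑ l,
    (fderiv ℝ (fun y => X.B y k q) p.1 (EuclideanSpace.single i 1) * X.A p.1 q l * p.2 l) •
      partialXi k a p

/-- `∂_ξ^α D_ξ^β D^I a`, where `I = (i_1, …, i_k)` stands for `D_{i_1} ⋯ D_{i_k}`, and the
multi-index `α` is given as the list of the directions of differentiation, with `|α|` its
length. -/
def AdaptedFrame.deriv (X : AdaptedFrame D) (α : List (Fin (d + 1))) (β : ℕ)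
    (I : List (Fin (d + 1))) (a : Space d × Space d → ℂ) : Space d × Space d → ℂ :=
  α.foldr partialXi (X.Dxi^[β] (I.foldr X.Dx a))

/-- The symbol class `S^{m,n}(D)`. -/
structure IsSymbol (X : AdaptedFrame D) (m n : ℝ) (a : Space d × Space d → ℂ) : Prop where
  smooth : ContDiff ℝ ∞ a
  bound : ∀ (α : List (Fin (d + 1))) (β : ℕ) (I : List (Fin (d + 1))), ∃ C : ℝ,
    ∀ x ξ : Space d, ‖X.deriv α β I a (x, ξ)‖ ≤
      C * (1 + ‖ξ‖) ^ (m - (β : ℝ)) * (1 + X.rho x ξ + Real.sqrt ‖ξ‖) ^ (n - (α.length : ℝ))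

/-- `T_a f (x) = ∫ a(x, ξ) f^(ξ) e^{2 π i x · ξ} dξ` for Schwartz `f`, where
`f^(ξ) = ∫ f(y) e^{-2 π i y · ξ} dy`. -/
def pseudo (a : Space d × Space d → ℂ) (f : 𝓢(Space d, ℂ)) (x : Space d) : ℂ :=
  ∫ ξ : Space d, a (x, ξ) * 𝓕 (f : Space d → ℂ) ξ *
    Complex.exp (2 * Real.pi * Complex.I * (inner ℝ x ξ : ℝ))

/-- The linear operator `T` on the Schwartz space is `T_a`. -/
def Represents (a : Space d × Space d → ℂ) (T : Module.End ℂ 𝓢(Space d, ℂ)) : Prop :=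
  ∀ (f : 𝓢(Space d, ℂ)) (x : Space d), T f x = pseudo a f x

/-- The class `Ψ^{m,n}` of the operators `T_a`, `a ∈ S^{m,n}`, on the Schwartz space. -/
def Psi (X : AdaptedFrame D) (m n : ℝ) : Set (Module.End ℂ 𝓢(Space d, ℂ)) :=
  {T | ∃ a, IsSymbol X m n a ∧ Represents a T}

end MixedSymbol

end

/-! Write λ = 1 + |ξ| and w = 1 + ρ_x(ξ) + |ξ|^{1/2}. Formally the symbol of T_a ∘ T_b is ∬ a(x, ξ +
θ) b(x + z, ξ) e^{-2πi z·θ} dz dθ. This oscillatory integral is made convergent by a kernel G(x, x +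
z) that decays in z with all its derivatives; the result is `J a G b`. The theorem reduces to two
facts: `J a G b` is a symbol of the summed orders (`J_isSymbol`), and the symbol of the composite is
a finite sum of such integrals (`exists_comp_symbol`).

The mixed derivatives are handled by a closure principle, `isSymbol_of_generators`: if a family of
functions satisfies the undifferentiated estimate and is stable, up to finite sums, under ∂_ξ, D_ξ
and D_i with the right change of orders, all its members are symbols. The family of all `J a G b` is
stable. The Leibniz rule fails only because the coefficients of D_ξ and D_i sit at x while b is
evaluated at y = x + z, and because a carries ξ + θ instead of ξ. Hadamard's lemma writes c(y) -
c(x) = ∑ (y_r - x_r) H_r(x, y); H_r joins the kernel, and integration by parts turns y_r - x_r into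
∂/∂ξ_r on a. A factor θ_l becomes a z-derivative of G b. Each error has lost two orders in w,
possibly against a gain of one order in λ, or is harmless. Since λ ≤ w², that is S^{m,n} ⊆
S^{m-1,n+2} (`lower_lam`), the errors have the required order.

What remains is the size estimate `J_norm_le`. At (x, ξ) the natural scale is s ~ λ/w: θ is measured
in units of s and z in units of 1/s. In these units a(x, ξ + θ) grows polynomially
(`weights_fiber`), the weights at x + z are comparable to those at x for |sz| ≤ 2 (`weights_base`),
and each z-derivative of b costs one factor s. The pairing of a with the Fourier transform of G b is
invariant under this scaling (`norm_pair_le`), which settles the near part. On the far part 2K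
coordinate factors (s z_j)^{2K} become derivatives of a and gain (s/w)^{2K} ~ (λ/w²)^{2K}. This
beats the loss in comparing the weights at distant points, which is a power of h = w/√λ, because w ≥
√λ everywhere.

For the composite, T_a g(x) is the pairing of a(x, ·) with g(x + ·). Inserting 1 = cutoff + ∑
z_r^{2K} tail, integrating by parts, and using Fubini for g = T_b f gives the symbol as a sum of
integrals `J`. That T_a preserves Schwartz space follows from integration by parts in ξ. -/

noncomputable section
namespace MixedSymbol

open MeasureTheory

/-! ### Smooth functions with weighted bounds on all derivatives -/

section Generic

variable {V W F : Type*} [NormedAddCommGroup V] [NormedSpace ℝ V] [NormedAddCommGroup W]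
  [NormedSpace ℝ W] [NormedAddCommGroup F] [NormedSpace ℝ F]

lemma norm_iteratedFDeriv_comp_clm_le (L : W →L[ℝ] V) {f : V → F} (hf : ContDiff ℝ ∞ f)
    (k : ℕ) (x : W) :
    ‖iteratedFDeriv ℝ k (fun y => f (L y)) x‖ ≤ ‖iteratedFDeriv ℝ k f (L x)‖ * ‖L‖ ^ k := by
  have h := L.iteratedFDeriv_comp_right hf x (i := k) (by exact_mod_cast le_top)
  have h2 := ContinuousMultilinearMap.norm_compContinuousLinearMap_le
    (iteratedFDeriv ℝ k f (L x)) (fun _ : Fin k => L)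
  simp only [Finset.prod_const, Finset.card_univ, Fintype.card_fin] at h2
  rw [← h] at h2
  exact h2

lemma norm_iteratedFDeriv_slice_le {f : V × W → F} (hf : ContDiff ℝ ∞ f) (k : ℕ) (p : V) (z : W) :
    ‖iteratedFDeriv ℝ k (fun y => f (p, y)) z‖ ≤ ‖iteratedFDeriv ℝ k f (p, z)‖ := by
  have hg : ContDiff ℝ ∞ (fun q : V × W => f ((p, 0) + q)) :=
    hf.comp (contDiff_const.add contDiff_id)
  have h := norm_iteratedFDeriv_comp_clm_le (ContinuousLinearMap.inr ℝ V W) hg k z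
  rw [iteratedFDeriv_comp_add_left] at h
  simp only [ContinuousLinearMap.inr_apply, Prod.mk_add_mk, add_zero, zero_add] at h
  refine h.trans ?_
  refine mul_le_of_le_one_right (norm_nonneg _) (pow_le_one₀ (norm_nonneg _) ?_)
  exact ContinuousLinearMap.opNorm_le_bound _ zero_le_one (fun x => by simp [Prod.norm_def])

lemma fderiv_eq_sum_basis [FiniteDimensional ℝ V] {ι : Type*} [Fintype ι] (b : Module.Basis ι ℝ V)
    (f : V → F) (x : V) :
    fderiv ℝ f x = ∑ i, (ContinuousLinearMap.smulRightL ℝ V F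
      (LinearMap.toContinuousLinearMap (b.coord i))) (fderiv ℝ f x (b i)) := by
  ext v
  conv_lhs => rw [← b.sum_repr v, map_sum]
  simp

/-- The total derivative is a fixed linear combination of partial derivatives, which stay in the
family, so regularity bootstraps from order n to n + 1. Parameter integrals that can only be
differentiated once at a time (`segAvg`, `J`, `osc`) become smooth through this. -/
theorem contDiff_of_family [FiniteDimensional ℝ V] {ι : Type*} [Fintype ι] (b : Module.Basis ι ℝ V)
    (S : Set (V → F)) (hd : ∀ f ∈ S, Differentiable ℝ f)
    (hp : ∀ f ∈ S, ∀ i, (fun x => fderiv ℝ f x (b i)) ∈ S) {f : V → F} (hf : f ∈ S) :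
    ContDiff ℝ ∞ f := by
  rw [contDiff_infty]
  intro n
  induction n generalizing f with
  | zero => exact contDiff_zero.2 (hd f hf).continuous
  | succ n ih =>
    have : ((n + 1 : ℕ) : WithTop ℕ∞) = (n : WithTop ℕ∞) + 1 := by norm_cast
    rw [this, contDiff_succ_iff_fderiv]
    refine ⟨hd f hf, fun h => by simp at h, ?_⟩
    have : fderiv ℝ f = fun x => ∑ i, (ContinuousLinearMap.smulRightL ℝ V F
      (LinearMap.toContinuousLinearMap (b.coord i))) (fderiv ℝ f x (b i)) :=
      funext fun x => fderiv_eq_sum_basis b f x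
    rw [this]
    exact ContDiff.sum fun i _ => (ContinuousLinearMap.contDiff _).comp (ih (hp f hf i))

/-- The level k counts the derivatives already spent, so the weight may change with each of them.
Symbols need this: a total derivative moves the orders from (m, n) to (m + 1, n - 1). -/
theorem iteratedFDeriv_bound_of_family [FiniteDimensional ℝ V] {ι : Type*} [Fintype ι]
    (b : Module.Basis ι ℝ V) (S : ℕ → Set (V → F)) (η : ℕ → V → ℝ)
    (hd : ∀ k, ∀ f ∈ S k, ContDiff ℝ ∞ f)
    (hp : ∀ k, ∀ f ∈ S k, ∀ i, (fun x => fderiv ℝ f x (b i)) ∈ S (k + 1))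
    (hb : ∀ k, ∀ f ∈ S k, ∃ C : ℝ, ∀ x, ‖f x‖ ≤ C * η k x) (j : ℕ) :
    ∀ k, ∀ f ∈ S k, ∃ C : ℝ, ∀ x, ‖iteratedFDeriv ℝ j f x‖ ≤ C * η (k + j) x := by
  induction j with
  | zero => simpa using hb
  | succ j ih =>
    intro k f hf
    choose C hC using fun i => ih (k + 1) _ (hp k f hf i)
    let T : ι → F →L[ℝ] V →L[ℝ] F := fun i => ContinuousLinearMap.smulRightL ℝ V F
      (LinearMap.toContinuousLinearMap (b.coord i))
    refine ⟨∑ i, ‖T i‖ * C i, fun x => ?_⟩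
    rw [← norm_iteratedFDeriv_fderiv]
    have : fderiv ℝ f = fun x => ∑ i, T i (fderiv ℝ f x (b i)) :=
      funext fun x => fderiv_eq_sum_basis b f x
    rw [this, iteratedFDeriv_fun_sum_apply, Finset.sum_mul]
    · refine norm_sum_le_of_le _ fun i _ => ?_
      have h1 := (T i).norm_iteratedFDeriv_comp_left (x := x)
        ((hd _ _ (hp k f hf i)).contDiffAt.of_le (m := j) (by exact_mod_cast le_top)) le_rfl
      refine h1.trans ?_
      rw [mul_assoc]
      refine mul_le_mul_of_nonneg_left ?_ (norm_nonneg _)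
      have := hC i x
      rwa [add_assoc, add_comm 1 j] at this
    · intro i _
      exact (((T i).contDiff.comp (hd _ _ (hp k f hf i))).contDiffAt).of_le
        (by exact_mod_cast le_top)

/-- All derivatives of the smooth function `f` are bounded on `S` by multiples of `η`. -/
structure DerivBound (S : Set V) (η : V → ℝ) (f : V → F) : Prop where
  smooth : ContDiff ℝ ∞ f
  bound : ∀ k : ℕ, ∃ C : ℝ, 0 ≤ C ∧ ∀ x ∈ S, ‖iteratedFDeriv ℝ k f x‖ ≤ C * η x

namespace DerivBound

variable {S : Set V} {η η' : V → ℝ} {f g : V → F}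

lemma of_bound (hη : ∀ x ∈ S, 0 ≤ η x) (hf : ContDiff ℝ ∞ f)
    (h : ∀ k : ℕ, ∃ C : ℝ, ∀ x ∈ S, ‖iteratedFDeriv ℝ k f x‖ ≤ C * η x) : DerivBound S η f := by
  refine ⟨hf, fun k => ?_⟩
  obtain ⟨C, hC⟩ := h k
  exact ⟨max C 0, le_max_right _ _, fun x hx => (hC x hx).trans
    (mul_le_mul_of_nonneg_right (le_max_left _ _) (hη x hx))⟩

lemma mono_set {S' : Set V} (h : DerivBound S η f) (hS : S' ⊆ S) : DerivBound S' η f :=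
  ⟨h.smooth, fun k => let ⟨C, h0, hC⟩ := h.bound k; ⟨C, h0, fun x hx => hC x (hS hx)⟩⟩

lemma mono (h : DerivBound S η f) {c : ℝ} (hc : 0 ≤ c) (hη : ∀ x ∈ S, η x ≤ c * η' x) :
    DerivBound S η' f := by
  refine ⟨h.smooth, fun k => ?_⟩
  obtain ⟨C, h0, hC⟩ := h.bound k
  refine ⟨C * c, by positivity, fun x hx => (hC x hx).trans ?_⟩
  rw [mul_assoc]
  exact mul_le_mul_of_nonneg_left (hη x hx) h0

lemma norm_le (h : DerivBound S η f) : ∃ C : ℝ, 0 ≤ C ∧ ∀ x ∈ S, ‖f x‖ ≤ C * η x := by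
  simpa using h.bound 0

lemma add (hf : DerivBound S η f) (hg : DerivBound S η g) :
    DerivBound S η (fun x => f x + g x) := by
  refine ⟨hf.smooth.add hg.smooth, fun k => ?_⟩
  obtain ⟨C, h0, hC⟩ := hf.bound k
  obtain ⟨C', h0', hC'⟩ := hg.bound k
  refine ⟨C + C', by positivity, fun x hx => ?_⟩
  rw [fun_iteratedFDeriv_add_apply (hf.smooth.contDiffAt.of_le (by exact_mod_cast le_top))
    (hg.smooth.contDiffAt.of_le (by exact_mod_cast le_top)), add_mul]
  exact (norm_add_le _ _).trans (add_le_add (hC x hx) (hC' x hx))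

lemma sum {ι : Type*} {s : Finset ι} {f : ι → V → F} (hη : ∀ x ∈ S, 0 ≤ η x)
    (hf : ∀ i ∈ s, DerivBound S η (f i)) :
    DerivBound S η (fun x => ∑ i ∈ s, f i x) := by
  classical
  induction s using Finset.induction_on with
  | empty =>
    refine of_bound hη (by simpa using contDiff_const) fun k => ⟨0, fun x _ => ?_⟩
    simp only [Finset.sum_empty, zero_mul]
    rw [show iteratedFDeriv ℝ k (fun _ : V => (0 : F)) = 0 from iteratedFDeriv_fun_zero]
    simp
  | insert a s ha ih =>
    simp only [Finset.sum_insert ha]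
    exact (hf a (Finset.mem_insert_self _ _)).add
      (ih fun i hi => hf i (Finset.mem_insert_of_mem hi))

lemma smul {c : V → ℝ} (hc : DerivBound S η c) (hf : DerivBound S η' f) :
    DerivBound S (fun x => η x * η' x) (fun x => c x • f x) := by
  refine ⟨hc.smooth.smul hf.smooth, fun k => ?_⟩
  choose C h0 hC using hc.bound
  choose C' h0' hC' using hf.bound
  refine ⟨∑ i ∈ Finset.range (k + 1), (k.choose i : ℝ) * C i * C' (k - i),
    Finset.sum_nonneg fun i _ => by have := h0 i; have := h0' (k - i); positivity,
    fun x hx => ?_⟩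
  refine (norm_iteratedFDeriv_smul_le hc.smooth hf.smooth x
    (by exact_mod_cast le_top)).trans ?_
  rw [Finset.sum_mul]
  refine Finset.sum_le_sum fun i _ => ?_
  have h1 := hC i x hx
  have h2 := hC' (k - i) x hx
  calc _ ≤ (k.choose i : ℝ) * (C i * η x) * (C' (k - i) * η' x) := by
        have := (norm_nonneg _).trans h1
        gcongr
    _ = _ := by ring

lemma comp_clm (hf : DerivBound S η f) (L : W →L[ℝ] V) :
    DerivBound (L ⁻¹' S) (fun x => η (L x)) (fun x => f (L x)) := by
  refine ⟨hf.smooth.comp L.contDiff, fun k => ?_⟩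
  obtain ⟨C, h0, hC⟩ := hf.bound k
  refine ⟨C * ‖L‖ ^ k, by positivity, fun x hx => ?_⟩
  refine (norm_iteratedFDeriv_comp_clm_le L hf.smooth k x).trans ?_
  rw [mul_right_comm]
  exact mul_le_mul_of_nonneg_right (hC _ hx) (by positivity)

lemma fderiv_apply (hf : DerivBound S η f) (e : V) :
    DerivBound S η (fun x => fderiv ℝ f x e) := by
  have h1 : ContDiff ℝ ∞ (fderiv ℝ f) := hf.smooth.fderiv_right (by simp)
  refine ⟨h1.clm_apply contDiff_const, fun k => ?_⟩
  obtain ⟨C, h0, hC⟩ := hf.bound (k + 1)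
  let T : (V →L[ℝ] F) →L[ℝ] F := ContinuousLinearMap.apply ℝ F e
  refine ⟨‖T‖ * C, by positivity, fun x hx => ?_⟩
  refine (T.norm_iteratedFDeriv_comp_left (f := fderiv ℝ f) (x := x)
    (h1.contDiffAt.of_le (m := k) (by exact_mod_cast le_top)) le_rfl).trans ?_
  rw [norm_iteratedFDeriv_fderiv, mul_assoc]
  exact mul_le_mul_of_nonneg_left (hC x hx) (norm_nonneg _)

lemma const_smul (hf : DerivBound S η f) (c : ℝ) : DerivBound S η (fun x => c • f x) := by
  refine ⟨hf.smooth.const_smul c, fun k => ?_⟩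
  obtain ⟨C, h0, hC⟩ := hf.bound k
  refine ⟨|c| * C, by positivity, fun x hx => ?_⟩
  rw [iteratedFDeriv_const_smul_apply' (hf.smooth.contDiffAt.of_le (by exact_mod_cast le_top)),
    norm_smul, mul_assoc]
  exact mul_le_mul_of_nonneg_left (hC x hx) (abs_nonneg c)

lemma const (hη : ∀ x ∈ S, 0 ≤ η x) (c : F) (h : ∀ x ∈ S, 1 ≤ η x) :
    DerivBound S η (fun _ => c) := by
  refine of_bound hη contDiff_const fun k => ?_
  rcases k with _ | k
  · refine ⟨‖c‖, fun x hx => ?_⟩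
    simpa using le_mul_of_one_le_right (norm_nonneg c) (h x hx)
  · refine ⟨0, fun x _ => ?_⟩
    rw [iteratedFDeriv_const_of_ne (by simp)]
    simp

end DerivBound

/-- The smooth functions with all derivatives bounded. -/
abbrev IsCb (f : V → F) : Prop := DerivBound Set.univ (fun _ => (1 : ℝ)) f

lemma IsCb.smul {c : V → ℝ} {f : V → F} (hc : IsCb c) (hf : IsCb f) : IsCb fun x => c x • f x := by
  simpa using DerivBound.smul hc hf

lemma IsCb.mul {c f : V → ℝ} (hc : IsCb c) (hf : IsCb f) : IsCb fun x => c x * f x :=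
  IsCb.smul hc hf

lemma IsCb.sum {ι : Type*} {s : Finset ι} {f : ι → V → F} (hf : ∀ i ∈ s, IsCb (f i)) :
    IsCb fun x => ∑ i ∈ s, f i x :=
  DerivBound.sum (fun _ _ => zero_le_one) hf

lemma IsCb.const (c : F) : IsCb fun _ : V => c :=
  DerivBound.const (fun _ _ => zero_le_one) c fun _ _ => le_rfl

lemma IsCb.comp_clm {f : V → F} (hf : IsCb f) (L : W →L[ℝ] V) : IsCb fun x => f (L x) := by
  simpa using DerivBound.comp_clm hf L

lemma IsCb.norm_le {f : V → F} (hf : IsCb f) : ∃ C : ℝ, 0 ≤ C ∧ ∀ x, ‖f x‖ ≤ C := by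
  simpa using DerivBound.norm_le hf

lemma IsCb.lipschitz {f : V → F} (hf : IsCb f) :
    ∃ C : ℝ, 0 ≤ C ∧ ∀ x y, ‖f x - f y‖ ≤ C * ‖x - y‖ := by
  obtain ⟨C, h0, hC⟩ := hf.bound 1
  refine ⟨C, h0, fun x y => ?_⟩
  refine Convex.norm_image_sub_le_of_norm_fderiv_le (𝕜 := ℝ) (s := Set.univ)
    (fun z _ => (hf.smooth.differentiable (by simp)).differentiableAt) (fun z _ => ?_)
    convex_univ (Set.mem_univ _) (Set.mem_univ _)
  simpa using hC z (Set.mem_univ _)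

lemma isCb_of_family [FiniteDimensional ℝ V] {ι : Type*} [Fintype ι] (b : Module.Basis ι ℝ V)
    (S : Set (V → F)) (hd : ∀ f ∈ S, Differentiable ℝ f)
    (hp : ∀ f ∈ S, ∀ i, (fun x => fderiv ℝ f x (b i)) ∈ S)
    (hb : ∀ f ∈ S, ∃ C : ℝ, ∀ x, ‖f x‖ ≤ C) {f : V → F} (hf : f ∈ S) : IsCb f := by
  have hc : ∀ g ∈ S, ContDiff ℝ ∞ g := fun g hg => contDiff_of_family b S hd hp hg
  refine DerivBound.of_bound (fun _ _ => zero_le_one) (hc f hf) fun k => ?_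
  obtain ⟨C, hC⟩ := iteratedFDeriv_bound_of_family b (fun _ => S) (fun _ _ => 1) (fun _ => hc)
    (fun _ => hp) (fun _ => by simpa using hb) k 0 f hf
  exact ⟨C, fun x _ => hC x⟩

/-- The inverse of a function bounded away from zero. -/
lemma IsCb.inv [FiniteDimensional ℝ V] {q : V → ℝ} (hq : IsCb q) {c : ℝ} (hc : 0 < c)
    (h : ∀ x, c ≤ |q x|) : IsCb fun x => (q x)⁻¹ := by
  have hq0 : ∀ x, q x ≠ 0 := fun x hx => by have := h x; rw [hx, abs_zero] at this; linarith
  have hqd : Differentiable ℝ q := hq.smooth.differentiable (by simp)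
  -- The quotients p / q^k form a family stable under differentiation: (p q^{-k})' = (p' q - k p q')
  -- q^{-k-1}.
  let S : Set (V → ℝ) := {f | ∃ (p : V → ℝ) (k : ℕ), IsCb p ∧ f = fun x => p x * ((q x)⁻¹) ^ k}
  have hpd : ∀ p : V → ℝ, IsCb p → Differentiable ℝ p := fun p hp =>
    hp.smooth.differentiable (by simp)
  refine isCb_of_family (Module.finBasis ℝ V) S ?_ ?_ ?_ (f := fun x => (q x)⁻¹)
    ⟨fun _ => 1, 1, IsCb.const 1, by simp⟩
  · rintro f ⟨p, k, hp, rfl⟩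
    exact (hpd p hp).mul ((hqd.inv hq0).pow k)
  · rintro f ⟨p, k, hp, rfl⟩ i
    set e := Module.finBasis ℝ V i
    refine ⟨fun x => fderiv ℝ p x e * q x - (k : ℝ) • (p x * fderiv ℝ q x e), k + 1, ?_, ?_⟩
    · have h1 := (hp.fderiv_apply e).smul hq
      have h2 := (IsCb.mul hp (hq.fderiv_apply e)).const_smul (-(k : ℝ))
      have := DerivBound.add (IsCb.mul (hp.fderiv_apply e) hq) h2
      simpa [sub_eq_add_neg] using this
    · funext x
      have h1 : HasFDerivAt (fun x => p x * ((q x)⁻¹) ^ k) _ x :=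
        ((hpd p hp x).hasFDerivAt).mul
          ((((hasDerivAt_inv (hq0 x)).comp_hasFDerivAt x (hqd x).hasFDerivAt)).pow k)
      rw [h1.fderiv]
      have := hq0 x
      rcases k with _ | k
      · simp; field_simp
      · simp
        field_simp
        ring
  · rintro f ⟨p, k, hp, rfl⟩
    obtain ⟨C, h0, hC⟩ := hp.norm_le
    refine ⟨C * (c⁻¹) ^ k, fun x => ?_⟩
    rw [norm_mul, norm_pow, norm_inv]
    have := h x
    have h3 := hC x
    rw [← Real.norm_eq_abs] at this
    gcongr

end Generic

end MixedSymbol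
end
-- The frame, its inverse, and the weights λ and w
noncomputable section
namespace MixedSymbol

open MeasureTheory

variable {d : ℕ} {D : Space d → Submodule ℝ (Space d)}

lemma IsCb.prod {V ι : Type*} [NormedAddCommGroup V] [NormedSpace ℝ V] {s : Finset ι}
    {f : ι → V → ℝ} (hf : ∀ i ∈ s, IsCb (f i)) : IsCb fun x => ∏ i ∈ s, f i x := by
  classical
  induction s using Finset.induction_on with
  | empty => simpa using IsCb.const (1 : ℝ)
  | insert a s ha ih =>
    simp only [Finset.prod_insert ha]
    exact (hf a (Finset.mem_insert_self _ _)).mul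
      (ih fun i hi => hf i (Finset.mem_insert_of_mem hi))

lemma isCb_det {V : Type*} [NormedAddCommGroup V] [NormedSpace ℝ V] {n : ℕ}
    {M : V → Matrix (Fin n) (Fin n) ℝ} (hM : ∀ i j, IsCb fun x => M x i j) :
    IsCb fun x => (M x).det := by
  simp only [Matrix.det_apply']
  exact IsCb.sum fun σ _ => (IsCb.const _).mul (IsCb.prod fun i _ => hM _ _)

namespace AdaptedFrame

variable (X : AdaptedFrame D)

lemma isCb_A (i j : Fin (d + 1)) : IsCb fun x => X.A x i j := by
  refine DerivBound.of_bound (fun _ _ => zero_le_one) (X.smooth i j) fun k => ?_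
  obtain ⟨C, hC⟩ := X.bounded i j k
  exact ⟨C, fun x _ => by simpa using hC x⟩

lemma isUnit_det (x : Space d) : IsUnit (X.A x).det := by
  obtain ⟨c, hc, h⟩ := X.det_bound
  refine isUnit_iff_ne_zero.2 fun h0 => ?_
  have := h x
  rw [h0, abs_zero] at this
  linarith

/-- Cramer's rule: the cofactors are polynomials in the coefficients, and the determinant is bounded
away from zero. -/
lemma isCb_B (i j : Fin (d + 1)) : IsCb fun x => X.B x i j := by
  obtain ⟨c, hc, h⟩ := X.det_bound
  have h1 : IsCb fun x => ((X.A x).det)⁻¹ := IsCb.inv (isCb_det X.isCb_A) hc h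
  have h2 : IsCb fun x => (X.A x).adjugate i j := by
    simp only [Matrix.adjugate_apply]
    refine isCb_det fun k l => ?_
    by_cases hk : k = j
    · subst hk
      simpa using IsCb.const _
    · simpa [Matrix.updateRow_ne hk] using X.isCb_A k l
  have := h1.mul h2
  simpa [AdaptedFrame.B, Matrix.inv_def, Ring.inverse_eq_inv'] using this

lemma A_mul_B (x : Space d) : X.A x * X.B x = 1 := Matrix.mul_nonsing_inv _ (X.isUnit_det x)

/-- The coefficient `∑ q, (∂B_k^q/∂x^i) A_q^l` of the vector field `D_i`. -/
def L (i k l : Fin (d + 1)) (x : Space d) : ℝ :=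
  ∑ q, fderiv ℝ (fun y => X.B y k q) x (EuclideanSpace.single i 1) * X.A x q l

lemma isCb_L (i k l : Fin (d + 1)) : IsCb (X.L i k l) :=
  IsCb.sum fun q _ => IsCb.mul ((X.isCb_B k q).fderiv_apply _) (X.isCb_A q l)

lemma rho_nonneg (x ξ : Space d) : 0 ≤ X.rho x ξ := Real.sqrt_nonneg _

lemma rho_eq_norm (x ξ : Space d) :
    X.rho x ξ = ‖(WithLp.toLp 2 (fun i : Fin d => X.M x ξ i.castSucc) :
      EuclideanSpace ℝ (Fin d))‖ := by
  simp [rho, EuclideanSpace.norm_eq]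

lemma euclidean_norm_le_sum {n : ℕ} (v : EuclideanSpace ℝ (Fin n)) : ‖v‖ ≤ ∑ i, |v i| := by
  conv_lhs => rw [← (EuclideanSpace.basisFun (Fin n) ℝ).sum_repr v]
  refine (norm_sum_le _ _).trans (le_of_eq ?_)
  simp [norm_smul]

lemma abs_coord_le {n : ℕ} (v : EuclideanSpace ℝ (Fin n)) (i : Fin n) : |v i| ≤ ‖v‖ :=
  PiLp.norm_apply_le v i

lemma rho_le_add_sum (x y ξ η : Space d) :
    X.rho x ξ ≤ X.rho y η + ∑ i, |X.M x ξ i - X.M y η i| := by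
  rw [rho_eq_norm, rho_eq_norm]
  refine (norm_le_norm_add_norm_sub' _
    (WithLp.toLp 2 (fun i : Fin d => X.M y η i.castSucc) : EuclideanSpace ℝ (Fin d))).trans ?_
  refine add_le_add_right ((euclidean_norm_le_sum _).trans ?_) _
  rw [Fin.sum_univ_castSucc (n := d)]
  exact le_add_of_nonneg_right (abs_nonneg _)

/-- The vector M_x ξ is linear in ξ with coefficients Lipschitz in x. A base displacement z
therefore moves ρ by at most a multiple of |z| |ξ|, which makes w/λ the length on which w stays
comparable. -/
lemma rho_lipschitz_base : ∃ C : ℝ, 0 ≤ C ∧ ∀ x y ξ : Space d,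
    X.rho x ξ ≤ X.rho y ξ + C * ‖x - y‖ * ‖ξ‖ := by
  choose C h0 hC using fun i j => (X.isCb_A i j).lipschitz
  refine ⟨∑ i, ∑ j, C i j, Finset.sum_nonneg fun i _ => Finset.sum_nonneg fun j _ => h0 i j,
    fun x y ξ => (X.rho_le_add_sum x y ξ ξ).trans ?_⟩
  simp only [M, ← Finset.sum_sub_distrib, Finset.sum_mul]
  refine add_le_add_right (Finset.sum_le_sum fun i _ => ?_) _
  refine (Finset.abs_sum_le_sum_abs _ _).trans (Finset.sum_le_sum fun j _ => ?_)
  rw [← sub_mul, abs_mul]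
  have h1 := hC i j x y
  have h2 := abs_coord_le ξ j
  have h3 := h0 i j
  rw [Real.norm_eq_abs] at h1
  gcongr

lemma rho_lipschitz_fiber : ∃ C : ℝ, 0 ≤ C ∧ ∀ x ξ η : Space d,
    X.rho x ξ ≤ X.rho x η + C * ‖ξ - η‖ := by
  choose C h0 hC using fun i j => (X.isCb_A i j).norm_le
  refine ⟨∑ i, ∑ j, C i j, Finset.sum_nonneg fun i _ => Finset.sum_nonneg fun j _ => h0 i j,
    fun x ξ η => (X.rho_le_add_sum x x ξ η).trans ?_⟩
  simp only [M, ← Finset.sum_sub_distrib, Finset.sum_mul]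
  refine add_le_add_right (Finset.sum_le_sum fun i _ => ?_) _
  refine (Finset.abs_sum_le_sum_abs _ _).trans (Finset.sum_le_sum fun j _ => ?_)
  rw [← mul_sub, abs_mul]
  have h1 := hC i j x
  have h2 := abs_coord_le (ξ - η) j
  rw [Real.norm_eq_abs] at h1
  exact mul_le_mul h1 h2 (abs_nonneg _) (h0 i j)

end AdaptedFrame

/-- The isotropic weight `1 + |ξ|`. -/
def lam (ξ : Space d) : ℝ := 1 + ‖ξ‖

lemma one_le_lam (ξ : Space d) : 1 ≤ lam ξ := le_add_of_nonneg_right (norm_nonneg _)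

lemma lam_pos (ξ : Space d) : 0 < lam ξ := zero_lt_one.trans_le (one_le_lam ξ)

namespace AdaptedFrame

variable (X : AdaptedFrame D)

/-- The weight `1 + ρ_x(ξ) + |ξ|^{1/2}`. -/
def w (x ξ : Space d) : ℝ := 1 + X.rho x ξ + Real.sqrt ‖ξ‖

lemma one_le_w (x ξ : Space d) : 1 ≤ X.w x ξ := by
  have := X.rho_nonneg x ξ
  have := Real.sqrt_nonneg ‖ξ‖
  unfold w; linarith

lemma w_pos (x ξ : Space d) : 0 < X.w x ξ := zero_lt_one.trans_le (X.one_le_w x ξ)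

/-- This is the purpose of the term |ξ|^{1/2} in w: two orders in w can always be traded for one
order in λ. -/
lemma lam_le_w_sq (x ξ : Space d) : lam ξ ≤ X.w x ξ ^ 2 := by
  have h1 := X.rho_nonneg x ξ
  have h2 := Real.sqrt_nonneg ‖ξ‖
  have h3 := Real.sq_sqrt (norm_nonneg ξ)
  unfold w lam
  nlinarith [mul_nonneg h1 h2, mul_nonneg h1 h1]

lemma sqrt_lam_le_w (x ξ : Space d) : Real.sqrt (lam ξ) ≤ X.w x ξ := by
  rw [Real.sqrt_le_left (X.w_pos x ξ).le]
  exact X.lam_le_w_sq x ξ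

lemma sqrt_norm_le (ξ : Space d) : Real.sqrt ‖ξ‖ ≤ 1 + ‖ξ‖ := by
  rw [Real.sqrt_le_left (by positivity)]
  nlinarith [norm_nonneg ξ]

lemma w_le_lam : ∃ C : ℝ, 1 ≤ C ∧ ∀ x ξ : Space d, X.w x ξ ≤ C * lam ξ := by
  obtain ⟨C, h0, hC⟩ := X.rho_lipschitz_fiber
  refine ⟨C + 2, by linarith, fun x ξ => ?_⟩
  have h := hC x ξ 0
  have h1 : X.rho x 0 = 0 := by simp [rho, M]
  rw [h1, sub_zero] at h
  have := sqrt_norm_le ξ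
  unfold w lam
  nlinarith [norm_nonneg ξ]

/-- The weight `(1 + |ξ|)^m (1 + ρ_x(ξ) + |ξ|^{1/2})^n`. -/
def wt (m n : ℝ) (p : Space d × Space d) : ℝ := lam p.2 ^ m * X.w p.1 p.2 ^ n

lemma wt_pos (m n : ℝ) (p : Space d × Space d) : 0 < X.wt m n p :=
  mul_pos (Real.rpow_pos_of_pos (lam_pos _) _) (Real.rpow_pos_of_pos (X.w_pos _ _) _)

lemma wt_zero (p : Space d × Space d) : X.wt 0 0 p = 1 := by simp [wt]

lemma wt_mul (m n m' n' : ℝ) (p : Space d × Space d) :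
    X.wt m n p * X.wt m' n' p = X.wt (m + m') (n + n') p := by
  unfold wt
  rw [Real.rpow_add (lam_pos _), Real.rpow_add (X.w_pos _ _)]
  ring

lemma wt_mono {m n m' n' : ℝ} (hm : m ≤ m') (hn : n ≤ n') (p : Space d × Space d) :
    X.wt m n p ≤ X.wt m' n' p :=
  mul_le_mul (Real.rpow_le_rpow_of_exponent_le (one_le_lam _) hm)
    (Real.rpow_le_rpow_of_exponent_le (X.one_le_w _ _) hn)
    (Real.rpow_nonneg (X.w_pos _ _).le _) (Real.rpow_nonneg (lam_pos _).le _)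

lemma wt_one_neg_two_le (p : Space d × Space d) : X.wt 1 (-2) p ≤ 1 := by
  unfold wt
  rw [Real.rpow_one, Real.rpow_neg (X.w_pos _ _).le, ← div_eq_mul_inv,
    div_le_one (Real.rpow_pos_of_pos (X.w_pos _ _) _)]
  exact_mod_cast X.lam_le_w_sq p.1 p.2

lemma wt_neg_one_one_le : ∃ C : ℝ, 1 ≤ C ∧ ∀ p : Space d × Space d, X.wt (-1) 1 p ≤ C := by
  obtain ⟨C, h0, hC⟩ := X.w_le_lam
  refine ⟨C, h0, fun p => ?_⟩
  unfold wt
  rw [Real.rpow_one, Real.rpow_neg_one, inv_mul_le_iff₀ (lam_pos _), mul_comm]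
  exact hC p.1 p.2

lemma wt_le_lam_rpow (m n : ℝ) : ∃ (C : ℝ) (M : ℕ), 0 ≤ C ∧ ∀ p : Space d × Space d,
    X.wt m n p ≤ C * lam p.2 ^ M := by
  obtain ⟨C, h0, hC⟩ := X.w_le_lam
  refine ⟨C ^ |n|, ⌈|m| + |n|⌉₊, by positivity, fun p => ?_⟩
  have h1 := one_le_lam p.2
  calc X.wt m n p ≤ X.wt |m| |n| p := X.wt_mono (le_abs_self m) (le_abs_self n) p
    _ ≤ lam p.2 ^ |m| * (C * lam p.2) ^ |n| := by
        unfold wt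
        have := X.w_pos p.1 p.2
        have := lam_pos p.2
        gcongr
        exact hC _ _
    _ = C ^ |n| * lam p.2 ^ (|m| + |n|) := by
        rw [Real.mul_rpow (by positivity) (lam_pos _).le, Real.rpow_add (lam_pos _)]; ring
    _ ≤ _ := by
        rw [← Real.rpow_natCast]
        gcongr
        exact Nat.le_ceil _

end AdaptedFrame

/-- Comparability of positive reals passes to real powers. -/
lemma rpow_le_of_comparable {a b c : ℝ} (ha : 0 < a) (hb : 0 < b) (hc : 1 ≤ c) (h1 : a ≤ c * b)
    (h2 : b ≤ c * a) (t : ℝ) : a ^ t ≤ c ^ |t| * b ^ t := by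
  have hc0 : 0 < c := by linarith
  rcases le_total 0 t with ht | ht
  · rw [abs_of_nonneg ht, ← Real.mul_rpow hc0.le hb.le]
    exact Real.rpow_le_rpow ha.le h1 ht
  · rw [abs_of_nonpos ht]
    have h3 : c⁻¹ * b ≤ a := by rwa [inv_mul_le_iff₀ hc0]
    calc a ^ t ≤ (c⁻¹ * b) ^ t := Real.rpow_le_rpow_of_nonpos (by positivity) h3 ht
      _ = c ^ (-t) * b ^ t := by
        rw [Real.mul_rpow (by positivity) hb.le, Real.inv_rpow hc0.le, Real.rpow_neg hc0.le]

namespace AdaptedFrame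

variable (X : AdaptedFrame D)

/-- Temperance in the fibre: with `T = 1 + |θ| w / λ`, the weights at `ξ + θ` and `ξ` compare up
to powers of `T`. -/
lemma weights_fiber : ∃ C : ℝ, 1 ≤ C ∧ ∀ x ξ θ : Space d,
    X.w x (ξ + θ) ≤ C * (1 + ‖θ‖ * (X.w x ξ / lam ξ)) * X.w x ξ ∧
    X.w x ξ ≤ C * (1 + ‖θ‖ * (X.w x ξ / lam ξ)) * X.w x (ξ + θ) ∧
    lam (ξ + θ) ≤ C * (1 + ‖θ‖ * (X.w x ξ / lam ξ)) ^ 2 * lam ξ ∧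
    lam ξ ≤ C * (1 + ‖θ‖ * (X.w x ξ / lam ξ)) ^ 2 * lam (ξ + θ) := by
  obtain ⟨C, h0, hC⟩ := X.rho_lipschitz_fiber
  -- additive form of the Lipschitz bound
  have key : ∀ x ξ θ : Space d, X.w x (ξ + θ) ≤ 2 * X.w x ξ + (C + 1) * ‖θ‖ := by
    intro x ξ θ
    have h1 := hC x (ξ + θ) ξ
    rw [add_sub_cancel_left] at h1
    have h2 : Real.sqrt ‖ξ + θ‖ ≤ Real.sqrt ‖ξ‖ + Real.sqrt ‖θ‖ := by
      refine (Real.sqrt_le_sqrt (norm_add_le _ _)).trans ?_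
      rw [Real.sqrt_le_left (by positivity)]
      nlinarith [Real.sq_sqrt (norm_nonneg ξ), Real.sq_sqrt (norm_nonneg θ),
        mul_nonneg (Real.sqrt_nonneg ‖ξ‖) (Real.sqrt_nonneg ‖θ‖)]
    have h3 := sqrt_norm_le θ
    have h4 := X.rho_nonneg x ξ
    have h5 := Real.sqrt_nonneg ‖ξ‖
    unfold w
    linarith
  refine ⟨4 * C + 12, by linarith, fun x ξ θ => ?_⟩
  set w0 := X.w x ξ with hw0
  set w1 := X.w x (ξ + θ) with hw1
  set l0 := lam ξ with hl0
  set l1 := lam (ξ + θ) with hl1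
  have hw0' : 1 ≤ w0 := X.one_le_w _ _
  have hw1' : 1 ≤ w1 := X.one_le_w _ _
  have hl0' : 1 ≤ l0 := one_le_lam _
  have hl1' : 1 ≤ l1 := one_le_lam _
  have hsq : l0 ≤ w0 ^ 2 := X.lam_le_w_sq _ _
  have hsq1 : l1 ≤ w1 ^ 2 := X.lam_le_w_sq _ _
  have ht := norm_nonneg θ
  set t := ‖θ‖ with htdef
  have k1 : w1 ≤ 2 * w0 + (C + 1) * t := key x ξ θ
  have k2 : w0 ≤ 2 * w1 + (C + 1) * t := by
    have := key x (ξ + θ) (-θ)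
    simpa [norm_neg, add_neg_cancel_right] using this
  have k3 : l1 ≤ l0 + t := by
    have := norm_add_le ξ θ
    simp only [hl0, hl1, lam]; linarith
  have k4 : l0 ≤ l1 + t := by
    have := norm_add_le (ξ + θ) (-θ)
    rw [add_neg_cancel_right, norm_neg] at this
    simp only [hl0, hl1, lam]; linarith
  -- Here r is |θ| in units of λ/w. From r λ = |θ| w follow both |θ| ≤ r λ (as w ≥ 1) and |θ| ≤ r w
  -- (as λ ≤ w²).
  set r := t * (w0 / l0) with hr
  have hr0 : 0 ≤ r := by positivity
  have hrl : r * l0 = t * w0 := by rw [hr]; field_simp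
  have htl : t ≤ r * l0 := by rw [hrl]; nlinarith
  have htw : t ≤ r * w0 := by
    have : t * l0 ≤ (r * w0) * l0 := by
      rw [mul_right_comm, hrl]; nlinarith
    exact le_of_mul_le_mul_right this (by linarith)
  refine ⟨?_, ?_, ?_, ?_⟩
  · nlinarith [mul_nonneg h0 hr0, mul_nonneg h0 (by linarith : (0:ℝ) ≤ w0)]
  -- For |θ| ≤ λ/2 the point ξ + θ still has size at least λ/2, so λ ≤ 2 w₁² and |θ| can be bounded
  -- by 2 r w₁ in place of r w₀. For larger |θ| the identity r λ = |θ| w gives w₀ ≤ 2 r, so the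
  -- factor 1 + r alone dominates.
  · rcases le_total t (l0 / 2) with h | h
    · have e1 : l0 ≤ 2 * w1 ^ 2 := by linarith
      have e2 : t ≤ 2 * r * w1 := by
        have h6 : l0 ≤ 2 * w1 * w0 ∨ w0 ≤ w1 := by
          rcases le_total w0 w1 with h' | h'
          · exact Or.inr h'
          · left; nlinarith
        rcases h6 with h6 | h6
        · have : t * l0 ≤ (2 * r * w1) * l0 := by
            calc t * l0 ≤ t * (2 * w1 * w0) := by gcongr
              _ = 2 * w1 * (t * w0) := by ring
              _ = (2 * r * w1) * l0 := by rw [← hrl]; ring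
          exact le_of_mul_le_mul_right this (by linarith)
        · calc t ≤ r * w0 := htw
            _ ≤ r * w1 := by gcongr
            _ ≤ 2 * r * w1 := by nlinarith [mul_nonneg hr0 (by linarith : (0:ℝ) ≤ w1)]
      have e3 : (C + 1) * t ≤ (C + 1) * (2 * r * w1) := by gcongr
      nlinarith [mul_nonneg (mul_nonneg h0 hr0) (by linarith : (0:ℝ) ≤ w1),
        mul_nonneg h0 (by linarith : (0:ℝ) ≤ w1), mul_nonneg hr0 (by linarith : (0:ℝ) ≤ w1)]
    · have e1 : w0 ≤ 2 * r := by
        have : w0 * l0 ≤ (2 * r) * l0 := by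
          rw [mul_assoc, hrl]; nlinarith
        exact le_of_mul_le_mul_right this (by linarith)
      calc w0 ≤ 2 * r := e1
        _ ≤ (4 * C + 12) * (1 + r) * 1 := by nlinarith [mul_nonneg h0 hr0]
        _ ≤ _ := by gcongr
  · calc l1 ≤ (1 + r) * l0 := by linarith
      _ ≤ (4 * C + 12) * (1 + r) ^ 2 * l0 := by
        gcongr
        nlinarith [mul_nonneg h0 hr0, mul_nonneg hr0 hr0, mul_nonneg h0 (mul_nonneg hr0 hr0)]
  · rcases le_total t (l0 / 2) with h | h
    · calc l0 ≤ 2 * l1 := by linarith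
        _ ≤ (4 * C + 12) * (1 + r) ^ 2 * l1 := by
          gcongr
          nlinarith [mul_nonneg h0 hr0, mul_nonneg hr0 hr0, mul_nonneg h0 (mul_nonneg hr0 hr0)]
    -- As before w₀ is dominated by r; passing to λ ≤ w₀² is what forces the square on 1 + r.
    · have e1 : w0 ≤ 2 * r := by
        have : w0 * l0 ≤ (2 * r) * l0 := by
          rw [mul_assoc, hrl]; nlinarith
        exact le_of_mul_le_mul_right this (by linarith)
      calc l0 ≤ w0 ^ 2 := hsq
        _ ≤ (2 * r) ^ 2 := by gcongr
        _ ≤ (4 * C + 12) * (1 + r) ^ 2 * 1 := by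
          nlinarith [mul_nonneg h0 hr0, mul_nonneg hr0 hr0, mul_nonneg h0 (mul_nonneg hr0 hr0)]
        _ ≤ _ := by gcongr

/-- Slow variation and temperance in the base, at the scale `κ λ / w`. -/
lemma weights_base : ∃ κ : ℝ, 1 ≤ κ ∧ (∀ x ξ : Space d, 1 ≤ κ * (lam ξ / X.w x ξ)) ∧
    ∀ x z ξ : Space d,
    X.w (x + z) ξ ≤ (1 + (κ * (lam ξ / X.w x ξ)) * ‖z‖) * X.w x ξ ∧
    (‖(κ * (lam ξ / X.w x ξ)) • z‖ ≤ 2 → X.w x ξ ≤ 2 * X.w (x + z) ξ) := by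
  obtain ⟨C, h0, hC⟩ := X.rho_lipschitz_base
  obtain ⟨C', h0', hC'⟩ := X.w_le_lam
  -- The summand C' keeps the scale κ λ / w at least 1. The summand 4 C makes the drift C |z| λ at
  -- most w / 2 as soon as the scaled displacement is at most 2, and then w can at most halve.
  refine ⟨4 * C + C', by linarith, fun x ξ => ?_, fun x z ξ => ?_⟩
  · have hw0 := X.w_pos x ξ
    rw [← mul_div_assoc, le_div_iff₀ hw0, one_mul]
    exact (hC' x ξ).trans (mul_le_mul_of_nonneg_right (by linarith) (lam_pos ξ).le)
  have hw0 := X.w_pos x ξ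
  have hl := lam_pos ξ
  have h1 := hC (x + z) x ξ
  have h2 := hC x (x + z) ξ
  rw [add_sub_cancel_left] at h1
  rw [sub_add_cancel_left, norm_neg] at h2
  have h3 : ‖ξ‖ ≤ lam ξ := by unfold lam; linarith
  have h4 : C * ‖z‖ * ‖ξ‖ ≤ C * ‖z‖ * lam ξ := by gcongr
  have e : (4 * C + C') * (lam ξ / X.w x ξ) * ‖z‖ * X.w x ξ = (4 * C + C') * lam ξ * ‖z‖ := by
    field_simp
  have hz := mul_nonneg hl.le (norm_nonneg z)
  have hCz := mul_nonneg h0 hz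
  have hCz' := mul_nonneg (by linarith : 0 ≤ C') hz
  constructor
  · rw [add_mul, e, one_mul]
    have : X.w (x + z) ξ ≤ X.w x ξ + C * ‖z‖ * lam ξ := by unfold w; linarith
    nlinarith
  · intro h
    rw [norm_smul, Real.norm_of_nonneg (by positivity)] at h
    have h5 : (4 * C + C') * lam ξ * ‖z‖ ≤ 2 * X.w x ξ := by
      rw [← e]; gcongr
    have : X.w x ξ ≤ X.w (x + z) ξ + C * ‖z‖ * lam ξ := by unfold w; linarith
    nlinarith

end AdaptedFrame

end MixedSymbol
end
-- Leibniz rules and commutators of ∂_ξ, D_ξ and D_i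
noncomputable section
namespace MixedSymbol

open MeasureTheory

variable {d : ℕ} {D : Space d → Submodule ℝ (Space d)}

section Dir

variable {V F : Type*} [NormedAddCommGroup V] [NormedSpace ℝ V] [NormedAddCommGroup F]
  [NormedSpace ℝ F]

/-- The derivative of `a` in the constant direction `e`. -/
def dir (e : V) (a : V → F) : V → F := fun p => fderiv ℝ a p e

lemma contDiff_dir {a : V → F} (ha : ContDiff ℝ ∞ a) (e : V) : ContDiff ℝ ∞ (dir e a) :=
  (ha.fderiv_right (by simp)).clm_apply contDiff_const

lemma _root_.ContDiff.diff {a : V → F} (ha : ContDiff ℝ ∞ a) : Differentiable ℝ a :=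
  ha.differentiable (by simp)

lemma contDiff_fun_smul {c : V → ℝ} {a : V → F} (hc : ContDiff ℝ ∞ c) (ha : ContDiff ℝ ∞ a) :
    ContDiff ℝ ∞ (fun p => c p • a p) := hc.smul ha

lemma dir_comm {a : V → F} (ha : ContDiff ℝ ∞ a) (e e' : V) :
    dir e (dir e' a) = dir e' (dir e a) := by
  have h1 : Differentiable ℝ (fderiv ℝ a) := ContDiff.diff (ha.fderiv_right (by simp))
  have key : ∀ u v p, dir u (dir v a) p = fderiv ℝ (fderiv ℝ a) p u v := by
    intro u v p
    have := ((ContinuousLinearMap.apply ℝ F v).hasFDerivAt.comp p (h1 p).hasFDerivAt).fderiv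
    change fderiv ℝ (fun q => fderiv ℝ a q v) p u = _
    exact congrArg (fun T : V →L[ℝ] F => T u) this
  funext p
  rw [key, key]
  have : IsSymmSndFDerivAt ℝ a p := (ha.contDiffAt).isSymmSndFDerivAt (by
    rw [minSmoothness_of_isRCLikeNormedField]; exact WithTop.coe_le_coe.2 le_top)
  exact this e e'

lemma dir_add {a b : V → F} (ha : Differentiable ℝ a) (hb : Differentiable ℝ b) (e : V) :
    dir e (fun p => a p + b p) = fun p => dir e a p + dir e b p := by
  funext p
  simp only [dir]
  rw [fderiv_fun_add (ha p) (hb p)]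
  rfl

lemma dir_sum {ι : Type*} {s : Finset ι} {a : ι → V → F} (ha : ∀ i ∈ s, Differentiable ℝ (a i))
    (e : V) : dir e (fun p => ∑ i ∈ s, a i p) = fun p => ∑ i ∈ s, dir e (a i) p := by
  funext p
  simp only [dir]
  rw [fderiv_fun_sum fun i hi => ha i hi p]
  simp

lemma dir_smul {c : V → ℝ} {a : V → F} (hc : Differentiable ℝ c) (ha : Differentiable ℝ a)
    (e : V) : dir e (fun p => c p • a p) = fun p => dir e c p • a p + c p • dir e a p := by
  funext p
  simp only [dir]
  rw [fderiv_fun_smul (hc p) (ha p)]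
  simp [add_comm]

lemma dir_mul {a b : V → ℂ} (ha : Differentiable ℝ a) (hb : Differentiable ℝ b)
    (e : V) : dir e (fun p => a p * b p) = fun p => dir e a p * b p + a p * dir e b p := by
  funext p
  simp only [dir]
  rw [fderiv_fun_mul (ha p) (hb p)]
  simp [add_comm, mul_comm]

end Dir

lemma partialX_eq_dir (i : Fin (d + 1)) (a : Space d × Space d → ℂ) :
    partialX i a = dir (EuclideanSpace.single i 1, 0) a := rfl

lemma partialXi_eq_dir (i : Fin (d + 1)) (a : Space d × Space d → ℂ) :
    partialXi i a = dir (0, EuclideanSpace.single i 1) a := rfl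

lemma dir_comp_fst {F : Type*} [NormedAddCommGroup F] [NormedSpace ℝ F] {c : Space d → F}
    (hc : Differentiable ℝ c) (e : Space d × Space d) :
    dir e (fun p : Space d × Space d => c p.1) = fun p => fderiv ℝ c p.1 e.1 := by
  funext p
  have h := ((hc p.1).hasFDerivAt.comp p (hasFDerivAt_fst (𝕜 := ℝ))).fderiv
  exact congrArg (fun T : Space d × Space d →L[ℝ] F => T e) h

/-- The `l`-th coordinate of the covector. -/
def coordXi (l : Fin (d + 1)) : Space d × Space d →L[ℝ] ℝ :=
  (EuclideanSpace.proj l).comp (ContinuousLinearMap.snd ℝ (Space d) (Space d))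

lemma dir_coord (l : Fin (d + 1)) (e : Space d × Space d) :
    dir e (fun p : Space d × Space d => p.2 l) = fun _ => e.2 l := by
  funext p
  exact congrArg (fun T : Space d × Space d →L[ℝ] ℝ => T e) (coordXi (d := d) l).fderiv

lemma contDiff_coord (l : Fin (d + 1)) :
    ContDiff ℝ ∞ (fun p : Space d × Space d => p.2 l) := (coordXi (d := d) l).contDiff

lemma contDiff_partialX {a : Space d × Space d → ℂ} (ha : ContDiff ℝ ∞ a) (i : Fin (d + 1)) :
    ContDiff ℝ ∞ (partialX i a) := contDiff_dir ha _

lemma contDiff_partialXi {a : Space d × Space d → ℂ} (ha : ContDiff ℝ ∞ a) (i : Fin (d + 1)) :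
    ContDiff ℝ ∞ (partialXi i a) := contDiff_dir ha _

lemma partialXi_comm {a : Space d × Space d → ℂ} (ha : ContDiff ℝ ∞ a) (i j : Fin (d + 1)) :
    partialXi i (partialXi j a) = partialXi j (partialXi i a) := dir_comm ha _ _

namespace AdaptedFrame

variable (X : AdaptedFrame D)

lemma contDiff_B_fst (j k : Fin (d + 1)) :
    ContDiff ℝ ∞ (fun p : Space d × Space d => X.B p.1 j k) :=
  (X.isCb_B j k).smooth.comp contDiff_fst

lemma contDiff_L_fst (i j k : Fin (d + 1)) :
    ContDiff ℝ ∞ (fun p : Space d × Space d => X.L i j k p.1) :=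
  (X.isCb_L i j k).smooth.comp contDiff_fst

lemma Dx_eq (i : Fin (d + 1)) (a : Space d × Space d → ℂ) :
    X.Dx i a = fun p => partialX i a p +
      ∑ k, ∑ l, X.L i k l p.1 • (p.2 l • partialXi k a p) := by
  funext p
  simp only [Dx, L]
  congr 1
  refine Finset.sum_congr rfl fun k _ => ?_
  rw [Finset.sum_comm]
  refine Finset.sum_congr rfl fun l _ => ?_
  rw [Finset.sum_smul]
  exact Finset.sum_congr rfl fun q _ => by rw [mul_smul]

lemma contDiff_Dxi {a : Space d × Space d → ℂ} (ha : ContDiff ℝ ∞ a) :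
    ContDiff ℝ ∞ (X.Dxi a) :=
  ContDiff.sum fun j _ => contDiff_fun_smul (X.contDiff_B_fst j _) (contDiff_partialXi ha j)

lemma contDiff_Dx {a : Space d × Space d → ℂ} (ha : ContDiff ℝ ∞ a) (i : Fin (d + 1)) :
    ContDiff ℝ ∞ (X.Dx i a) := by
  rw [Dx_eq]
  exact (contDiff_partialX ha i).add (ContDiff.sum fun k _ => ContDiff.sum fun l _ =>
    contDiff_fun_smul (X.contDiff_L_fst i k l) (contDiff_fun_smul (contDiff_coord l) (contDiff_partialXi ha k)))

/-- `D_ξ` and `D_i` as pointwise directional derivatives. -/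
lemma Dxi_eq_fderiv (a : Space d × Space d → ℂ) (p : Space d × Space d) :
    X.Dxi a p = fderiv ℝ a p
      (∑ j, X.B p.1 j (Fin.last d) • (0, EuclideanSpace.single j 1)) := by
  rw [map_sum]
  simp only [map_smul]
  rfl

lemma Dx_eq_fderiv (i : Fin (d + 1)) (a : Space d × Space d → ℂ) (p : Space d × Space d) :
    X.Dx i a p = fderiv ℝ a p ((EuclideanSpace.single i 1, 0) +
      ∑ k, ∑ l, X.L i k l p.1 • (p.2 l • ((0 : Space d), EuclideanSpace.single k (1 : ℝ)))) := by
  rw [Dx_eq, map_add, map_sum]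
  simp only [map_sum, map_smul]
  rfl

section Leibniz

variable {a b : Space d × Space d → ℂ} {c : Space d → ℝ}

lemma Dxi_add (ha : Differentiable ℝ a) (hb : Differentiable ℝ b) :
    X.Dxi (fun p => a p + b p) = fun p => X.Dxi a p + X.Dxi b p := by
  funext p
  simp only [Dxi_eq_fderiv]
  rw [fderiv_fun_add (ha p) (hb p)]
  rfl

lemma Dx_add (ha : Differentiable ℝ a) (hb : Differentiable ℝ b) (i : Fin (d + 1)) :
    X.Dx i (fun p => a p + b p) = fun p => X.Dx i a p + X.Dx i b p := by
  funext p
  simp only [Dx_eq_fderiv]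
  rw [fderiv_fun_add (ha p) (hb p)]
  rfl

lemma Dxi_mul (ha : Differentiable ℝ a) (hb : Differentiable ℝ b) :
    X.Dxi (fun p => a p * b p) = fun p => X.Dxi a p * b p + a p * X.Dxi b p := by
  funext p
  simp only [Dxi_eq_fderiv]
  rw [fderiv_fun_mul (ha p) (hb p)]
  simp only [add_apply, smul_apply, smul_eq_mul]
  ring

lemma Dx_mul (ha : Differentiable ℝ a) (hb : Differentiable ℝ b) (i : Fin (d + 1)) :
    X.Dx i (fun p => a p * b p) = fun p => X.Dx i a p * b p + a p * X.Dx i b p := by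
  funext p
  simp only [Dx_eq_fderiv]
  rw [fderiv_fun_mul (ha p) (hb p)]
  simp only [add_apply, smul_apply, smul_eq_mul]
  ring

lemma partialXi_smul_base (hc : Differentiable ℝ c) (ha : Differentiable ℝ a) (k : Fin (d + 1)) :
    partialXi k (fun p => c p.1 • a p) = fun p => c p.1 • partialXi k a p := by
  rw [partialXi_eq_dir, dir_smul (c := fun p : Space d × Space d => c p.1) (hc.comp differentiable_fst) ha, dir_comp_fst hc]
  simp [partialXi_eq_dir]

lemma Dxi_smul_base (hc : Differentiable ℝ c) (ha : Differentiable ℝ a) :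
    X.Dxi (fun p => c p.1 • a p) = fun p => c p.1 • X.Dxi a p := by
  funext p
  simp only [Dxi, partialXi_smul_base hc ha, Finset.smul_sum]
  exact Finset.sum_congr rfl fun j _ => smul_comm _ _ _

lemma Dx_smul_base (hc : Differentiable ℝ c) (ha : Differentiable ℝ a) (i : Fin (d + 1)) :
    X.Dx i (fun p => c p.1 • a p) = fun p =>
      fderiv ℝ c p.1 (EuclideanSpace.single i 1) • a p + c p.1 • X.Dx i a p := by
  funext p
  simp only [Dx_eq, partialXi_smul_base hc ha]
  rw [partialX_eq_dir, dir_smul (c := fun p : Space d × Space d => c p.1) (hc.comp differentiable_fst) ha, dir_comp_fst hc]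
  simp only [smul_add, Finset.smul_sum, add_assoc]
  congr 2
  refine Finset.sum_congr rfl fun k _ => Finset.sum_congr rfl fun l _ => ?_
  rw [smul_comm (c p.1) (X.L i k l p.1), smul_comm (c p.1) (p.2 l)]

end Leibniz

section Commutators

variable {a : Space d × Space d → ℂ}

lemma partialXi_Dxi (ha : ContDiff ℝ ∞ a) (k : Fin (d + 1)) :
    partialXi k (X.Dxi a) = X.Dxi (partialXi k a) := by
  change partialXi k (fun p => ∑ j, X.B p.1 j (Fin.last d) • partialXi j a p) = _
  rw [partialXi_eq_dir, dir_sum fun j _ =>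
    (contDiff_fun_smul (X.contDiff_B_fst j _) (contDiff_partialXi ha j)).diff]
  funext p
  simp only [Dxi]
  refine Finset.sum_congr rfl fun j _ => ?_
  rw [← partialXi_eq_dir, partialXi_smul_base (c := fun x => X.B x j (Fin.last d))
    (X.isCb_B j _).smooth.diff (contDiff_partialXi ha j).diff, partialXi_comm ha]

/-- The coefficients of D_i are linear in ξ, so ∂/∂ξ_k hits them only through the constant
∂ξ_l/∂ξ_k. The commutator is again a combination of ξ-derivatives with coefficients depending on x
alone, hence of the same order. -/
lemma Dx_partialXi (ha : ContDiff ℝ ∞ a) (i k : Fin (d + 1)) :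
    X.Dx i (partialXi k a) = fun p => partialXi k (X.Dx i a) p +
      ∑ j, (-X.L i j k p.1) • partialXi j a p := by
  have h1 : partialXi k (X.Dx i a) = fun p => X.Dx i (partialXi k a) p +
      ∑ j, X.L i j k p.1 • partialXi j a p := by
    rw [X.Dx_eq i a, partialXi_eq_dir, dir_add (contDiff_partialX ha i).diff
      (ContDiff.diff (ContDiff.sum fun j _ => ContDiff.sum fun l _ =>
        contDiff_fun_smul (X.contDiff_L_fst i j l) (contDiff_fun_smul (contDiff_coord l) (contDiff_partialXi ha j)))),
      dir_sum fun j _ => (ContDiff.diff (ContDiff.sum fun l _ =>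
        contDiff_fun_smul (X.contDiff_L_fst i j l) (contDiff_fun_smul (contDiff_coord l) (contDiff_partialXi ha j))))]
    funext p
    rw [X.Dx_eq i (partialXi k a)]
    simp only []
    rw [add_assoc, ← Finset.sum_add_distrib, partialX_eq_dir, partialX_eq_dir, partialXi_eq_dir,
      dir_comm ha]
    congr 1
    refine Finset.sum_congr rfl fun j _ => ?_
    rw [dir_sum fun l _ => (contDiff_fun_smul (X.contDiff_L_fst i j l)
      (contDiff_fun_smul (contDiff_coord l) (contDiff_partialXi ha j))).diff]
    simp only [← partialXi_eq_dir]
    simp only [partialXi_smul_base (X.isCb_L i j _).smooth.diff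
      (contDiff_fun_smul (contDiff_coord _) (contDiff_partialXi ha j)).diff]
    simp only [partialXi_eq_dir k]
    simp only [dir_smul (contDiff_coord _).diff (contDiff_partialXi ha j).diff, dir_coord]
    simp only [smul_add, Finset.sum_add_distrib, ← partialXi_eq_dir]
    rw [add_comm]
    congr 1
    · simp only [partialXi_comm ha]
    · rw [Finset.sum_eq_single k]
      · simp
      · intro l _ hl
        simp [hl]
      · simp
  rw [h1]
  funext p
  simp

/-- In the coordinates (x, η) with η = M_x ξ, thus ξ = B η, the field D_i is ∂/∂x^i at fixed η and
D_ξ is ∂/∂η_N; coordinate fields commute. In the computation the derivative of B_k^N cancels the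
commutator terms because A B = 1. -/
lemma Dx_Dxi (ha : ContDiff ℝ ∞ a) (i : Fin (d + 1)) :
    X.Dx i (X.Dxi a) = X.Dxi (X.Dx i a) := by
  have hsum : X.Dx i (X.Dxi a) = fun p => ∑ j,
      X.Dx i (fun p => X.B p.1 j (Fin.last d) • partialXi j a p) p := by
    funext p
    simp only [Dx_eq_fderiv]
    rw [show X.Dxi a = fun p => ∑ j, X.B p.1 j (Fin.last d) • partialXi j a p from rfl,
      fderiv_fun_sum fun j _ =>
        (contDiff_fun_smul (X.contDiff_B_fst j _) (contDiff_partialXi ha j)).diff p]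
    simp only [sum_apply]
  rw [hsum]
  funext p
  simp only [X.Dx_smul_base (c := fun x => X.B x _ (Fin.last d)) (X.isCb_B _ _).smooth.diff
    (contDiff_partialXi ha _).diff, X.Dx_partialXi ha]
  simp only [smul_add, Finset.sum_add_distrib, Dxi]
  have key : ∀ k, fderiv ℝ (fun x => X.B x k (Fin.last d)) p.1 (EuclideanSpace.single i 1) =
      ∑ j, X.B p.1 j (Fin.last d) * X.L i k j p.1 := by
    intro k
    have h := X.A_mul_B p.1
    simp only [L, Finset.mul_sum]
    rw [Finset.sum_comm]
    have h2 : ∀ q, ∑ j, X.A p.1 q j * X.B p.1 j (Fin.last d) =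
        if q = Fin.last d then 1 else 0 := by
      intro q
      have := congrFun (congrFun h q) (Fin.last d)
      rwa [Matrix.mul_apply, Matrix.one_apply] at this
    calc _ = ∑ q, fderiv ℝ (fun x => X.B x k q) p.1 (EuclideanSpace.single i 1) *
          (if q = Fin.last d then 1 else 0) := by simp
      _ = _ := by
        refine Finset.sum_congr rfl fun q _ => ?_
        rw [← h2 q, Finset.mul_sum]
        exact Finset.sum_congr rfl fun j _ => by ring
  simp only [key, Finset.sum_smul, Finset.smul_sum]
  rw [Finset.sum_comm]
  have e : ∀ x j : Fin (d + 1), X.B p.1 x (Fin.last d) • -X.L i j x p.1 • partialXi j a p =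
      -((X.B p.1 x (Fin.last d) * X.L i j x p.1) • partialXi j a p) := by
    intro x j
    rw [smul_smul, mul_neg, neg_smul]
  simp only [e, Finset.sum_neg_distrib]
  abel

end Commutators

end AdaptedFrame

end MixedSymbol
end
-- The closure principle and the calculus of symbol classes
noncomputable section
namespace MixedSymbol

open MeasureTheory

variable {d : ℕ} {D : Space d → Submodule ℝ (Space d)}

/-- Finite sums of members of a family indexed by two orders. -/
inductive AddGen (G : ℝ → ℝ → (Space d × Space d → ℂ) → Prop) (m n : ℝ) :
    (Space d × Space d → ℂ) → Prop
  | base {f} : G m n f → AddGen G m n f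
  | zero : AddGen G m n (fun _ => 0)
  | add {f g} : AddGen G m n f → AddGen G m n g → AddGen G m n (fun p => f p + g p)

namespace AddGen

variable {G : ℝ → ℝ → (Space d × Space d → ℂ) → Prop} {m n m' n' : ℝ}
  {f g : Space d × Space d → ℂ}

lemma sum {ι : Type*} {s : Finset ι} {f : ι → Space d × Space d → ℂ}
    (h : ∀ i ∈ s, AddGen G m n (f i)) : AddGen G m n (fun p => ∑ i ∈ s, f i p) := by
  classical
  induction s using Finset.induction_on with
  | empty => simpa using AddGen.zero
  | insert a s ha ih =>
    simp only [Finset.sum_insert ha]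
    exact (h a (Finset.mem_insert_self _ _)).add
      (ih fun i hi => h i (Finset.mem_insert_of_mem hi))

lemma contDiff (hG : ∀ f, G m n f → ContDiff ℝ ∞ f) (h : AddGen G m n f) : ContDiff ℝ ∞ f := by
  induction h with
  | base h => exact hG _ h
  | zero => exact contDiff_const
  | add _ _ h1 h2 => exact h1.add h2

lemma map {T : (Space d × Space d → ℂ) → Space d × Space d → ℂ}
    (hs : ∀ f, G m n f → ContDiff ℝ ∞ f)
    (hT0 : T (fun _ => 0) = fun _ => 0)
    (hT : ∀ f g, Differentiable ℝ f → Differentiable ℝ g →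
      T (fun p => f p + g p) = fun p => T f p + T g p)
    (hG : ∀ f, G m n f → AddGen G m' n' (T f)) (h : AddGen G m n f) : AddGen G m' n' (T f) := by
  induction h with
  | base h => exact hG _ h
  | zero => rw [hT0]; exact AddGen.zero
  | add hf hg h1 h2 =>
    rw [hT _ _ (hf.contDiff hs).diff (hg.contDiff hs).diff]
    exact h1.add h2

end AddGen

lemma partialXi_zero (k : Fin (d + 1)) :
    partialXi k (fun _ : Space d × Space d => (0 : ℂ)) = fun _ => 0 := by
  funext p; simp [partialXi]

lemma partialXi_add {a b : Space d × Space d → ℂ} (k : Fin (d + 1)) (ha : Differentiable ℝ a)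
    (hb : Differentiable ℝ b) :
    partialXi k (fun p => a p + b p) = fun p => partialXi k a p + partialXi k b p :=
  dir_add ha hb _

namespace AdaptedFrame

variable (X : AdaptedFrame D)

lemma Dxi_zero : X.Dxi (fun _ => (0 : ℂ)) = fun _ => 0 := by
  funext p; simp [Dxi, partialXi_zero]

lemma Dx_zero (i : Fin (d + 1)) : X.Dx i (fun _ => (0 : ℂ)) = fun _ => 0 := by
  funext p; simp [Dx_eq, partialXi_zero, partialX]

variable {X} {m n m' n' : ℝ} {a b : Space d × Space d → ℂ}

lemma Dxi_iterate_contDiff (ha : ContDiff ℝ ∞ a) (β : ℕ) : ContDiff ℝ ∞ (X.Dxi^[β] a) := by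
  induction β generalizing a with
  | zero => exact ha
  | succ β ih => exact ih (X.contDiff_Dxi ha)

lemma foldr_Dx_contDiff (ha : ContDiff ℝ ∞ a) (I : List (Fin (d + 1))) :
    ContDiff ℝ ∞ (I.foldr X.Dx a) := by
  induction I with
  | nil => exact ha
  | cons i I ih => exact X.contDiff_Dx ih i

lemma deriv_contDiff (ha : ContDiff ℝ ∞ a) (α : List (Fin (d + 1))) (β : ℕ)
    (I : List (Fin (d + 1))) : ContDiff ℝ ∞ (X.deriv α β I a) := by
  induction α with
  | nil => exact Dxi_iterate_contDiff (foldr_Dx_contDiff ha I) β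
  | cons k α ih => exact contDiff_partialXi ih k

lemma Dxi_deriv (ha : ContDiff ℝ ∞ a) (α : List (Fin (d + 1))) (β : ℕ) (I : List (Fin (d + 1))) :
    X.Dxi (X.deriv α β I a) = X.deriv α (β + 1) I a := by
  induction α with
  | nil => simp [deriv, Function.iterate_succ_apply']
  | cons k α ih =>
    change X.Dxi (partialXi k (X.deriv α β I a)) = partialXi k (X.deriv α (β + 1) I a)
    rw [← X.partialXi_Dxi (deriv_contDiff ha α β I), ih]

lemma Dx_deriv_nil (ha : ContDiff ℝ ∞ a) (β : ℕ) (I : List (Fin (d + 1))) (i : Fin (d + 1)) :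
    X.Dx i (X.deriv [] β I a) = X.deriv [] β (i :: I) a := by
  induction β with
  | zero => rfl
  | succ β ih =>
    rw [← Dxi_deriv ha, X.Dx_Dxi (deriv_contDiff ha [] β I), ih, Dxi_deriv ha]

end AdaptedFrame

section Principle

variable {X : AdaptedFrame D}

/-- A family of smooth functions that satisfies the zeroth order estimates and is stable, up to
finite sums, under the three kinds of derivatives consists of symbols. -/
theorem isSymbol_of_generators (X : AdaptedFrame D)
    (G : ℝ → ℝ → (Space d × Space d → ℂ) → Prop)
    (hs : ∀ m n f, G m n f → ContDiff ℝ ∞ f)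
    (hb : ∀ m n f, G m n f → ∃ C : ℝ, ∀ p, ‖f p‖ ≤ C * X.wt m n p)
    (h1 : ∀ m n f, G m n f → ∀ k, AddGen G m (n - 1) (partialXi k f))
    (h2 : ∀ m n f, G m n f → AddGen G (m - 1) n (X.Dxi f))
    (h3 : ∀ m n f, G m n f → ∀ i, AddGen G m n (X.Dx i f))
    {m n : ℝ} {f : Space d × Space d → ℂ} (hf : AddGen G m n f) : IsSymbol X m n f := by
  refine ⟨hf.contDiff (hs m n), fun α β I => ?_⟩
  have hI : AddGen G m n (I.foldr X.Dx f) := by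
    induction I with
    | nil => exact hf
    | cons i I ih =>
      exact AddGen.map (T := X.Dx i) (hs _ _) (X.Dx_zero i)
        (fun f g hf hg => X.Dx_add hf hg i) (fun f hf => h3 _ _ f hf i) ih
  have hβ : AddGen G (m - β) n (X.Dxi^[β] (I.foldr X.Dx f)) := by
    induction β with
    | zero => simpa using hI
    | succ β ih =>
      rw [Function.iterate_succ_apply']
      have := AddGen.map (T := X.Dxi) (hs _ _) X.Dxi_zero
        (fun f g hf hg => X.Dxi_add hf hg) (fun f hf => h2 _ _ f hf) ih
      convert this using 1
      push_cast; ring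
  have hα : AddGen G (m - β) (n - α.length) (X.deriv α β I f) := by
    induction α with
    | nil => simpa [AdaptedFrame.deriv] using hβ
    | cons k α ih =>
      have := AddGen.map (T := partialXi k) (hs _ _) (partialXi_zero k)
        (fun f g hf hg => partialXi_add k hf hg) (fun f hf => h1 _ _ f hf k) ih
      rw [show n - ((k :: α).length : ℝ) = n - α.length - 1 by
        rw [List.length_cons]; push_cast; ring]
      exact this
  have hbound : ∀ m n g, AddGen G m n g → ∃ C : ℝ, ∀ p, ‖g p‖ ≤ C * X.wt m n p := by
    intro m n g hg
    induction hg with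
    | base h => exact hb _ _ _ h
    | zero => exact ⟨0, fun p => by simp⟩
    | add _ _ h1 h2 =>
      obtain ⟨C1, hC1⟩ := h1
      obtain ⟨C2, hC2⟩ := h2
      exact ⟨C1 + C2, fun p => (norm_add_le_of_le (hC1 p) (hC2 p)).trans_eq (by ring)⟩
  obtain ⟨C, hC⟩ := hbound _ _ _ hα
  exact ⟨C, fun x ξ => by rw [mul_assoc]; exact hC (x, ξ)⟩

end Principle

namespace IsSymbol

variable {X : AdaptedFrame D} {m n m' n' : ℝ} {a b : Space d × Space d → ℂ}

lemma deriv_le (h : IsSymbol X m n a) (α : List (Fin (d + 1))) (β : ℕ)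
    (I : List (Fin (d + 1))) : ∃ C : ℝ, 0 ≤ C ∧ ∀ p, ‖X.deriv α β I a p‖ ≤
      C * X.wt (m - β) (n - α.length) p := by
  obtain ⟨C, hC⟩ := h.bound α β I
  refine ⟨max C 0, le_max_right _ _, fun p => ?_⟩
  have := hC p.1 p.2
  rw [mul_assoc] at this
  exact this.trans (mul_le_mul_of_nonneg_right (le_max_left _ _) (X.wt_pos _ _ p).le)

lemma norm_le (h : IsSymbol X m n a) : ∃ C : ℝ, 0 ≤ C ∧ ∀ p, ‖a p‖ ≤ C * X.wt m n p := by
  simpa [AdaptedFrame.deriv] using h.deriv_le [] 0 []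

/-- The functions `c(x) ∂_ξ^α D_ξ^β D^I a`. -/
inductive Gen (X : AdaptedFrame D) (m n : ℝ) (a : Space d × Space d → ℂ) :
    ℝ → ℝ → (Space d × Space d → ℂ) → Prop
  | mk (c : Space d → ℝ) (hc : IsCb c) (α : List (Fin (d + 1))) (β : ℕ) (I : List (Fin (d + 1)))
      {m' n' : ℝ} (hm : m' = m - β) (hn : n' = n - α.length) :
      Gen X m n a m' n' (fun p => c p.1 • X.deriv α β I a p)

lemma Gen.contDiff (ha : ContDiff ℝ ∞ a) {m' n' : ℝ} {f : Space d × Space d → ℂ}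
    (h : Gen X m n a m' n' f) : ContDiff ℝ ∞ f := by
  obtain ⟨c, hc, α, β, I, _, _⟩ := h
  exact contDiff_fun_smul (hc.smooth.comp contDiff_fst) (AdaptedFrame.deriv_contDiff ha α β I)

lemma Gen.smul {c : Space d → ℝ} (hc : IsCb c) {m' n' : ℝ} {f : Space d × Space d → ℂ}
    (h : AddGen (Gen X m n a) m' n' f) :
    AddGen (Gen X m n a) m' n' (fun p => c p.1 • f p) := by
  induction h with
  | base h =>
    obtain ⟨c', hc', α, β, I, hm, hn⟩ := h
    simp only [smul_smul]
    exact AddGen.base (Gen.mk (fun x => c x * c' x) (IsCb.mul hc hc') α β I hm hn)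
  | zero => simpa using AddGen.zero
  | add _ _ h1 h2 => simpa [smul_add] using h1.add h2

lemma Gen.partialXi (ha : ContDiff ℝ ∞ a) {m' n' : ℝ} {f : Space d × Space d → ℂ}
    (h : Gen X m n a m' n' f) (k : Fin (d + 1)) :
    AddGen (Gen X m n a) m' (n' - 1) (partialXi k f) := by
  obtain ⟨c, hc, α, β, I, hm, hn⟩ := h
  rw [AdaptedFrame.partialXi_smul_base hc.smooth.diff (AdaptedFrame.deriv_contDiff ha α β I).diff]
  refine AddGen.base (Gen.mk c hc (k :: α) β I hm ?_)
  rw [hn, List.length_cons]; push_cast; ring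

lemma Gen.deriv (α : List (Fin (d + 1))) (β : ℕ) (I : List (Fin (d + 1)))
    {m' n' : ℝ} (hm : m' = m - β) (hn : n' = n - α.length) :
    AddGen (Gen X m n a) m' n' (X.deriv α β I a) := by
  have := AddGen.base (Gen.mk (X := X) (a := a) (fun _ => 1) (IsCb.const 1) α β I hm hn)
  simpa using this

/-- By induction on α, D_i is moved inwards past each ξ-derivative. Every commutation leaves terms
c(x) ∂_ξ of unchanged order, which is why the generators carry coefficients c(x). -/
lemma Gen.Dx_deriv (ha : ContDiff ℝ ∞ a) (α : List (Fin (d + 1))) (β : ℕ)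
    (I : List (Fin (d + 1))) (i : Fin (d + 1)) {m' n' : ℝ} (hm : m' = m - β)
    (hn : n' = n - α.length) : AddGen (Gen X m n a) m' n' (X.Dx i (X.deriv α β I a)) := by
  induction α generalizing n' with
  | nil =>
    rw [AdaptedFrame.Dx_deriv_nil ha]
    exact Gen.deriv [] β (i :: I) hm hn
  | cons k α ih =>
    have hs := AdaptedFrame.deriv_contDiff (X := X) ha α β I
    have hn' : n' = (n - α.length) - 1 := by
      rw [hn, List.length_cons]; push_cast; ring
    change AddGen _ _ _ (X.Dx i (MixedSymbol.partialXi k (X.deriv α β I a)))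
    rw [X.Dx_partialXi hs]
    refine AddGen.add ?_ (AddGen.sum fun j _ => ?_)
    · rw [hn']
      exact AddGen.map (T := MixedSymbol.partialXi k) (fun f hf => hf.contDiff ha)
        (partialXi_zero k) (fun f g hf hg => partialXi_add k hf hg)
        (fun f hf => hf.partialXi ha k) (ih rfl)
    · have hL : IsCb fun x => -X.L i j k x := by
        simpa using (X.isCb_L i j k).const_smul (-1)
      refine AddGen.base (Gen.mk (fun x => -X.L i j k x) hL (j :: α) β I hm hn)

/-- Multiples of derivatives of a symbol are symbols of the corresponding order. -/
lemma of_gen (h : IsSymbol X m n a) {f : Space d × Space d → ℂ}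
    (hf : AddGen (Gen X m n a) m' n' f) : IsSymbol X m' n' f := by
  have ha := h.smooth
  refine isSymbol_of_generators X (Gen X m n a) (fun _ _ _ h => h.contDiff ha) ?_
    (fun _ _ _ h k => h.partialXi ha k) ?_ ?_ hf
  · rintro _ _ _ ⟨c, hc, α, β, I, rfl, rfl⟩
    obtain ⟨C, h0, hC⟩ := hc.norm_le
    obtain ⟨C', h0', hC'⟩ := h.deriv_le α β I
    refine ⟨C * C', fun p => ?_⟩
    rw [norm_smul, mul_assoc]
    exact mul_le_mul (hC _) (hC' p) (norm_nonneg _) h0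
  · rintro _ _ _ ⟨c, hc, α, β, I, hm, hn⟩
    rw [X.Dxi_smul_base hc.smooth.diff (AdaptedFrame.deriv_contDiff ha α β I).diff,
      AdaptedFrame.Dxi_deriv ha]
    refine AddGen.base (Gen.mk c hc α (β + 1) I ?_ hn)
    rw [hm]; push_cast; ring
  · rintro _ _ _ ⟨c, hc, α, β, I, hm, hn⟩ i
    rw [X.Dx_smul_base hc.smooth.diff (AdaptedFrame.deriv_contDiff ha α β I).diff]
    exact (AddGen.base (Gen.mk (fun x => fderiv ℝ c x (EuclideanSpace.single i 1))
      (hc.fderiv_apply _) α β I hm hn)).add (Gen.smul hc (Gen.Dx_deriv ha α β I i hm hn))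

lemma partialXi (h : IsSymbol X m n a) (k : Fin (d + 1)) :
    IsSymbol X m (n - 1) (partialXi k a) :=
  h.of_gen (Gen.deriv [k] 0 [] (by simp) (by simp))

lemma Dxi (h : IsSymbol X m n a) : IsSymbol X (m - 1) n (X.Dxi a) :=
  h.of_gen (Gen.deriv [] 1 [] (by simp) (by simp))

lemma Dx (h : IsSymbol X m n a) (i : Fin (d + 1)) : IsSymbol X m n (X.Dx i a) :=
  h.of_gen (Gen.deriv [] 0 [i] (by simp) (by simp))

lemma smul_base (h : IsSymbol X m n a) {c : Space d → ℝ} (hc : IsCb c) :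
    IsSymbol X m n (fun p => c p.1 • a p) :=
  h.of_gen (AddGen.base (Gen.mk c hc [] 0 [] (by simp) (by simp)))

lemma of_addGen (h : AddGen (IsSymbol X) m n a) : IsSymbol X m n a :=
  isSymbol_of_generators X (IsSymbol X) (fun _ _ _ h => h.smooth)
    (fun _ _ _ h => let ⟨C, _, hC⟩ := h.norm_le; ⟨C, hC⟩)
    (fun _ _ _ h k => AddGen.base (h.partialXi k)) (fun _ _ _ h => AddGen.base h.Dxi)
    (fun _ _ _ h i => AddGen.base (h.Dx i)) h

lemma add (h : IsSymbol X m n a) (h' : IsSymbol X m n b) : IsSymbol X m n (fun p => a p + b p) :=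
  of_addGen (AddGen.add (.base h) (.base h'))

lemma sum {ι : Type*} {s : Finset ι} {f : ι → Space d × Space d → ℂ}
    (h : ∀ i ∈ s, IsSymbol X m n (f i)) : IsSymbol X m n (fun p => ∑ i ∈ s, f i p) :=
  of_addGen (AddGen.sum fun i hi => .base (h i hi))

/-- Weights are multiplicative in the orders, so one comparison of the undifferentiated weights
gives the comparison after any number of derivatives. -/
lemma of_wt_le {C : ℝ} (hC : ∀ p, X.wt m n p ≤ C * X.wt m' n' p) (h : IsSymbol X m n a) :
    IsSymbol X m' n' a := by
  refine ⟨h.smooth, fun α β I => ?_⟩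
  obtain ⟨C', h0', hC'⟩ := h.deriv_le α β I
  refine ⟨C' * C, fun x ξ => (hC' (x, ξ)).trans ?_⟩
  rw [mul_assoc, mul_assoc C' C]
  refine mul_le_mul_of_nonneg_left ?_ h0'
  have e : ∀ r s : ℝ, X.wt (r - β) (s - α.length) (x, ξ) =
      X.wt r s (x, ξ) * X.wt (-β) (-α.length) (x, ξ) := fun r s => by
    rw [X.wt_mul, sub_eq_add_neg, sub_eq_add_neg]
  change _ ≤ C * X.wt (m' - β) (n' - α.length) (x, ξ)
  rw [e, e, ← mul_assoc]
  exact mul_le_mul_of_nonneg_right (hC _) (X.wt_pos _ _ _).le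

lemma mono (hm : m ≤ m') (hn : n ≤ n') (h : IsSymbol X m n a) : IsSymbol X m' n' a :=
  h.of_wt_le (C := 1) fun p => by rw [one_mul]; exact X.wt_mono hm hn p

/-- `S^{m,n} ⊆ S^{m-1,n+2}`. -/
lemma lower_lam (h : IsSymbol X m n a) : IsSymbol X (m - 1) (n + 2) a := by
  refine h.of_wt_le (C := 1) fun p => ?_
  have := mul_le_mul_of_nonneg_right (X.wt_one_neg_two_le p) (X.wt_pos (m - 1) (n + 2) p).le
  rwa [X.wt_mul, show (1 : ℝ) + (m - 1) = m by ring, show (-2 : ℝ) + (n + 2) = n by ring] at this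

/-- `S^{m,n} ⊆ S^{m+1,n-1}`. -/
lemma raise_lam (h : IsSymbol X m n a) : IsSymbol X (m + 1) (n - 1) a := by
  obtain ⟨C, h0, hC⟩ := X.wt_neg_one_one_le
  refine h.of_wt_le (C := C) fun p => ?_
  have := mul_le_mul_of_nonneg_right (hC p) (X.wt_pos (m + 1) (n - 1) p).le
  rwa [X.wt_mul, show (-1 : ℝ) + (m + 1) = m by ring, show (1 : ℝ) + (n - 1) = n by ring] at this

/-- Products of two symbols. -/
inductive MulGen (X : AdaptedFrame D) (m n : ℝ) : (Space d × Space d → ℂ) → Prop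
  | mk {m₁ n₁ m₂ n₂ : ℝ} {a b : Space d × Space d → ℂ} (ha : IsSymbol X m₁ n₁ a)
      (hb : IsSymbol X m₂ n₂ b) (hm : m = m₁ + m₂) (hn : n = n₁ + n₂) :
      MulGen X m n (fun p => a p * b p)

lemma mul (h : IsSymbol X m n a) (h' : IsSymbol X m' n' b) :
    IsSymbol X (m + m') (n + n') (fun p => a p * b p) := by
  refine isSymbol_of_generators X (MulGen X) ?_ ?_ ?_ ?_ ?_ (.base (.mk h h' rfl rfl))
  · rintro _ _ _ ⟨ha, hb, _, _⟩
    exact ha.smooth.mul hb.smooth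
  · rintro _ _ _ ⟨ha, hb, rfl, rfl⟩
    obtain ⟨C, h0, hC⟩ := ha.norm_le
    obtain ⟨C', h0', hC'⟩ := hb.norm_le
    refine ⟨C * C', fun p => ?_⟩
    rw [norm_mul, ← X.wt_mul]
    calc _ ≤ _ := mul_le_mul (hC p) (hC' p) (norm_nonneg _) ((norm_nonneg _).trans (hC p))
      _ = _ := by ring
  · rintro _ _ _ ⟨ha, hb, rfl, rfl⟩ k
    rw [partialXi_eq_dir, dir_mul ha.smooth.diff hb.smooth.diff]
    exact (AddGen.base (.mk (ha.partialXi k) hb (by ring) (by ring))).add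
      (.base (.mk ha (hb.partialXi k) (by ring) (by ring)))
  · rintro _ _ _ ⟨ha, hb, rfl, rfl⟩
    rw [X.Dxi_mul ha.smooth.diff hb.smooth.diff]
    exact (AddGen.base (.mk ha.Dxi hb (by ring) (by ring))).add
      (.base (.mk ha hb.Dxi (by ring) (by ring)))
  · rintro _ _ _ ⟨ha, hb, rfl, rfl⟩ i
    rw [X.Dx_mul ha.smooth.diff hb.smooth.diff]
    exact (AddGen.base (.mk (ha.Dx i) hb (by ring) (by ring))).add
      (.base (.mk ha (hb.Dx i) (by ring) (by ring)))

/-- The functions `c(x) z` with constant `z`. -/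
inductive ConstGen (m n : ℝ) : (Space d × Space d → ℂ) → Prop
  | mk (c : Space d → ℝ) (hc : IsCb c) (z : ℂ) (hm : m = 0) (hn : n = 0) :
      ConstGen m n (fun p => c p.1 • z)

lemma base_smul (X : AdaptedFrame D) {c : Space d → ℝ} (hc : IsCb c) (z : ℂ) :
    IsSymbol X 0 0 (fun p => c p.1 • z) := by
  have hz : Differentiable ℝ (fun _ : Space d × Space d => z) := differentiable_const z
  have h0 : ∀ k, MixedSymbol.partialXi k (fun _ : Space d × Space d => z) = fun _ => 0 := by
    intro k; funext p; simp [MixedSymbol.partialXi]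
  refine isSymbol_of_generators X ConstGen ?_ ?_ ?_ ?_ ?_ (.base (.mk c hc z rfl rfl))
  · rintro _ _ _ ⟨c, hc, z, _, _⟩
    exact contDiff_fun_smul (hc.smooth.comp contDiff_fst) contDiff_const
  · rintro _ _ _ ⟨c, hc, z, rfl, rfl⟩
    obtain ⟨C, h0, hC⟩ := hc.norm_le
    refine ⟨C * ‖z‖, fun p => ?_⟩
    rw [X.wt_zero, mul_one, norm_smul]
    gcongr
    exact hC _
  · rintro _ _ _ ⟨c, hc, z, _, _⟩ k
    rw [AdaptedFrame.partialXi_smul_base hc.smooth.diff (differentiable_const z)]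
    have : MixedSymbol.partialXi k (fun _ : Space d × Space d => z) = fun _ => 0 := by
      funext p; simp [MixedSymbol.partialXi]
    simpa [this] using AddGen.zero
  · rintro _ _ _ ⟨c, hc, z, _, _⟩
    rw [X.Dxi_smul_base hc.smooth.diff (differentiable_const z)]
    have : X.Dxi (fun _ : Space d × Space d => z) = fun _ => 0 := by
      funext p; simp [AdaptedFrame.Dxi, MixedSymbol.partialXi]
    simpa [this] using AddGen.zero
  · rintro _ _ _ ⟨c, hc, z, hm, hn⟩ i
    rw [X.Dx_smul_base hc.smooth.diff (differentiable_const z)]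
    have : X.Dx i (fun _ : Space d × Space d => z) = fun _ => 0 := by
      funext p; simp [AdaptedFrame.Dx_eq, MixedSymbol.partialXi, partialX]
    simpa [this] using AddGen.base
      (ConstGen.mk (fun x => fderiv ℝ c x (EuclideanSpace.single i 1)) (hc.fderiv_apply _) z hm hn)

lemma const (X : AdaptedFrame D) (z : ℂ) : IsSymbol X 0 0 (fun _ => z) := by
  simpa using base_smul X (IsCb.const (1 : ℝ)) z

lemma const_mul (h : IsSymbol X m n a) (z : ℂ) : IsSymbol X m n (fun p => z * a p) := by
  simpa using (const X z).mul h

/-- Symbols, and the functions `c(x) ξ_l`. -/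
inductive CoordGen (X : AdaptedFrame D) (m n : ℝ) : (Space d × Space d → ℂ) → Prop
  | symbol {a : Space d × Space d → ℂ} (h : IsSymbol X m n a) : CoordGen X m n a
  | mk (c : Space d → ℝ) (hc : IsCb c) (l : Fin (d + 1)) (hm : m = 1) (hn : n = 0) :
      CoordGen X m n (fun p => c p.1 • ((p.2 l : ℝ) : ℂ))

/-- The functions c(x) ξ_l are stable: D_i returns combinations of the same kind, D_ξ returns c(x)
B_l^N(x) of order (0, 0), and ∂_ξ returns functions of x alone, which lie in S^{0,0} ⊆ S^{1,-1}
because w is at most a multiple of λ. -/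
lemma coord (X : AdaptedFrame D) (l : Fin (d + 1)) :
    IsSymbol X 1 0 (fun p => ((p.2 l : ℝ) : ℂ)) := by
  have hsm : ∀ l, ContDiff ℝ ∞ (fun p : Space d × Space d => ((p.2 l : ℝ) : ℂ)) := fun l =>
    Complex.ofRealCLM.contDiff.comp (contDiff_coord l)
  have hdir : ∀ (l : Fin (d + 1)) (e p : Space d × Space d),
      fderiv ℝ (fun p : Space d × Space d => ((p.2 l : ℝ) : ℂ)) p e = ((e.2 l : ℝ) : ℂ) := by
    intro l e p
    exact congrArg (fun T : Space d × Space d →L[ℝ] ℂ => T e)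
      (Complex.ofRealCLM.comp (coordXi (d := d) l)).fderiv
  have key : AddGen (CoordGen X) 1 0 (fun p => (1 : ℝ) • ((p.2 l : ℝ) : ℂ)) :=
    .base (.mk (fun _ => 1) (IsCb.const 1) l rfl rfl)
  simp only [one_smul] at key
  refine isSymbol_of_generators X (CoordGen X) ?_ ?_ ?_ ?_ ?_ key
  · rintro _ _ _ (h | ⟨c, hc, l, _, _⟩)
    · exact h.smooth
    · exact contDiff_fun_smul (hc.smooth.comp contDiff_fst) (hsm l)
  · rintro _ _ _ (h | ⟨c, hc, l, rfl, rfl⟩)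
    · obtain ⟨C, _, hC⟩ := h.norm_le
      exact ⟨C, hC⟩
    · obtain ⟨C, h0, hC⟩ := hc.norm_le
      refine ⟨C, fun p => ?_⟩
      rw [norm_smul, Complex.norm_real]
      have h1 : ‖p.2 l‖ ≤ ‖p.2‖ := AdaptedFrame.abs_coord_le p.2 l
      have h2 : X.wt 1 0 p = 1 + ‖p.2‖ := by simp [AdaptedFrame.wt, lam]
      rw [h2]
      exact mul_le_mul (hC _) (by linarith) (norm_nonneg _) h0
  · rintro _ _ _ (h | ⟨c, hc, l, rfl, rfl⟩) k
    · exact .base (.symbol (h.partialXi k))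
    · rw [AdaptedFrame.partialXi_smul_base hc.smooth.diff (hsm l).diff]
      have := (base_smul X hc ((EuclideanSpace.single k (1 : ℝ) l : ℝ) : ℂ)).raise_lam
      rw [zero_add] at this
      refine .base (.symbol ?_)
      convert this using 3
      exact hdir _ _ _
  · rintro _ _ _ (h | ⟨c, hc, l, rfl, rfl⟩)
    · exact .base (.symbol h.Dxi)
    · rw [X.Dxi_smul_base hc.smooth.diff (hsm l).diff]
      have := base_smul X (hc.mul (X.isCb_B l (Fin.last d))) 1
      refine .base (.symbol ?_)
      rw [sub_self]
      convert this using 2 with p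
      rw [X.Dxi_eq_fderiv, hdir]
      simp only [Prod.snd_sum, Prod.smul_snd, WithLp.ofLp_sum, WithLp.ofLp_smul,
        Finset.sum_apply, Pi.smul_apply, smul_eq_mul]
      rw [Finset.sum_eq_single l (fun k _ hk => by simp [hk.symm]) (by simp)]
      simp
  · rintro _ _ _ (h | ⟨c, hc, l, hm, hn⟩) i
    · exact .base (.symbol (h.Dx i))
    · rw [X.Dx_smul_base hc.smooth.diff (hsm l).diff]
      refine (AddGen.base (.mk (fun x => fderiv ℝ c x (EuclideanSpace.single i 1))
        (hc.fderiv_apply _) l hm hn)).add ?_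
      have e : (fun p : Space d × Space d =>
          c p.1 • X.Dx i (fun p => ((p.2 l : ℝ) : ℂ)) p) =
          fun p => ∑ l', (c p.1 * X.L i l l' p.1) • ((p.2 l' : ℝ) : ℂ) := by
        funext p
        rw [X.Dx_eq_fderiv, hdir]
        simp only [Prod.snd_add, Prod.snd_sum, Prod.smul_snd, zero_add, WithLp.ofLp_sum,
          WithLp.ofLp_smul, Finset.sum_apply, Pi.smul_apply, smul_eq_mul]
        rw [Finset.sum_eq_single l (fun k _ hk => by simp [hk.symm]) (by simp)]
        simp [Finset.mul_sum, mul_assoc]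
      rw [e]
      exact AddGen.sum fun l' _ => .base
        (.mk (fun x => c x * X.L i l l' x) (hc.mul (X.isCb_L i l l')) l' hm hn)

lemma coord_mul (h : IsSymbol X m n a) (l : Fin (d + 1)) :
    IsSymbol X (m + 1) n (fun p => ((p.2 l : ℝ) : ℂ) * a p) := by
  simpa [add_comm] using (coord X l).mul h

/-- Solve the definition of D_i for ∂/∂x^i. The terms L(x) ξ_l ∂_ξ a have order (m + 1, n - 1), and
D_i a, of order (m, n), is contained in that class by `raise_lam`. -/
lemma partialX (h : IsSymbol X m n a) (i : Fin (d + 1)) :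
    IsSymbol X (m + 1) (n - 1) (partialX i a) := by
  have e : MixedSymbol.partialX i a = fun p => X.Dx i a p + (-1) *
      ∑ k, ∑ l, X.L i k l p.1 • (((p.2 l : ℝ) : ℂ) * MixedSymbol.partialXi k a p) := by
    funext p
    rw [X.Dx_eq]
    simp
  rw [e]
  exact (h.Dx i).raise_lam.add ((IsSymbol.sum fun k _ => IsSymbol.sum fun l _ =>
    ((h.partialXi k).coord_mul l).smul_base (X.isCb_L i k l)).const_mul (-1))

/-- The standard basis of `ℝ^N × ℝ^N`. -/
def pairBasis (d : ℕ) : Module.Basis (Fin (d + 1) ⊕ Fin (d + 1)) ℝ (Space d × Space d) :=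
  (EuclideanSpace.basisFun (Fin (d + 1)) ℝ).toBasis.prod
    (EuclideanSpace.basisFun (Fin (d + 1)) ℝ).toBasis

lemma pairBasis_inl (i : Fin (d + 1)) :
    pairBasis d (Sum.inl i) = (EuclideanSpace.single i 1, 0) := by
  simp [pairBasis]

lemma pairBasis_inr (i : Fin (d + 1)) :
    pairBasis d (Sum.inr i) = (0, EuclideanSpace.single i 1) := by
  simp [pairBasis]

/-- Estimates for the total derivatives of a symbol. -/
lemma norm_iteratedFDeriv_le (h : IsSymbol X m n a) (k : ℕ) : ∃ C : ℝ, 0 ≤ C ∧ ∀ p,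
    ‖iteratedFDeriv ℝ k a p‖ ≤ C * X.wt (m + k) (n - k) p := by
  have hp : ∀ k : ℕ, ∀ f ∈ {a | IsSymbol X (m + k) (n - k) a}, ∀ i,
      (fun x => fderiv ℝ f x (pairBasis d i)) ∈
        {a | IsSymbol X (m + (k + 1 : ℕ)) (n - (k + 1 : ℕ)) a} := by
    intro k f hf i
    change IsSymbol X _ _ _
    rw [show m + ((k + 1 : ℕ) : ℝ) = m + k + 1 by push_cast; ring,
      show n - ((k + 1 : ℕ) : ℝ) = n - k - 1 by push_cast; ring]
    rcases i with i | i
    · rw [pairBasis_inl]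
      exact IsSymbol.partialX hf i
    · rw [pairBasis_inr]
      -- A ξ-derivative needs only (m, n - 1); it is weakened to the order of an x-derivative so
      -- that a single weight serves all directions.
      exact (IsSymbol.partialXi hf i).mono (by linarith) le_rfl
  obtain ⟨C, hC⟩ := iteratedFDeriv_bound_of_family (pairBasis d)
    (fun k => {a | IsSymbol X (m + k) (n - k) a}) (fun k => X.wt (m + k) (n - k))
    (fun _ _ h => h.smooth) hp (fun k f h => let ⟨C, _, hC⟩ := IsSymbol.norm_le h; ⟨C, hC⟩) k 0 a
    (by simpa using h)
  refine ⟨max C 0, le_max_right _ _, fun p => ?_⟩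
  have := hC p
  rw [zero_add] at this
  exact this.trans (mul_le_mul_of_nonneg_right (le_max_left _ _) (X.wt_pos _ _ p).le)

/-- Polynomial bounds for the total derivatives of a symbol. -/
lemma norm_iteratedFDeriv_le_pow (h : IsSymbol X m n a) (k : ℕ) : ∃ (C : ℝ) (M : ℕ), 0 ≤ C ∧
    ∀ p, ‖iteratedFDeriv ℝ k a p‖ ≤ C * (1 + ‖p.2‖) ^ M := by
  obtain ⟨C, h0, hC⟩ := h.norm_iteratedFDeriv_le k
  obtain ⟨C', M, h0', hC'⟩ := X.wt_le_lam_rpow (m + k) (n - k)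
  refine ⟨C * C', M, by positivity, fun p => (hC p).trans ?_⟩
  rw [mul_assoc]
  exact mul_le_mul_of_nonneg_left (hC' p) h0

end IsSymbol

end MixedSymbol
end
-- Fourier decay and the scale-invariant pairing
noncomputable section
namespace MixedSymbol

open MeasureTheory

variable {d : ℕ}

/-- The weight `(1 + |z|)^{-q}`. -/
def decay (q : ℕ) (z : Space d) : ℝ := ((1 + ‖z‖) ^ q)⁻¹

lemma decay_pos (q : ℕ) (z : Space d) : 0 < decay q z := by unfold decay; positivity

lemma decay_anti {q q' : ℕ} (h : q ≤ q') (z : Space d) : decay q' z ≤ decay q z := by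
  unfold decay
  gcongr
  exact le_add_of_nonneg_right (norm_nonneg z)

lemma decay_le_one (q : ℕ) (z : Space d) : decay q z ≤ 1 :=
  inv_le_one_of_one_le₀ (one_le_pow₀ (le_add_of_nonneg_right (norm_nonneg z)))

lemma decay_mul (q q' : ℕ) (z : Space d) : decay q z * decay q' z = decay (q + q') z := by
  unfold decay
  rw [pow_add, mul_inv]

lemma pow_mul_decay (M q : ℕ) (z : Space d) : (1 + ‖z‖) ^ M * decay (M + q) z = decay q z := by
  unfold decay
  rw [pow_add]
  field_simp

lemma integrable_decay {q : ℕ} (hq : d + 1 < q) : Integrable (decay q : Space d → ℝ) := by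
  have h := integrable_one_add_norm (E := Space d) (μ := volume) (r := q)
    (by simpa using (by exact_mod_cast hq : (d : ℝ) + 1 < q))
  refine h.congr (Filter.Eventually.of_forall fun z => ?_)
  simp only [decay]
  rw [Real.rpow_neg (by positivity), Real.rpow_natCast]

lemma integrable_of_decay {F : Type*} [NormedAddCommGroup F] {f : Space d → F} {q : ℕ}
    (hq : d + 1 < q) (hf : AEStronglyMeasurable f) {C : ℝ} (h : ∀ z, ‖f z‖ ≤ C * decay q z) :
    Integrable f :=
  ((integrable_decay hq).const_mul C).mono' hf (Filter.Eventually.of_forall h)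

lemma integrable_decay_smul {q : ℕ} (hq : d + 1 < q) {s : ℝ} (hs : 0 < s) :
    Integrable (fun z : Space d => decay q (s • z)) :=
  (integrable_decay hq).comp_smul hs.ne'

lemma integral_decay_smul (q : ℕ) {s : ℝ} (hs : 0 < s) :
    ∫ z : Space d, decay q (s • z) = (s ^ (d + 1))⁻¹ * ∫ z : Space d, decay q z := by
  rw [Measure.integral_comp_smul]
  simp only [finrank_euclideanSpace, Fintype.card_fin, smul_eq_mul]
  rw [abs_of_pos (by positivity)]

section Fourier

/-- The pairing `∫ u(θ) v^(θ) dθ`. -/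
def pair (u v : Space d → ℂ) : ℂ := ∫ θ, u θ * 𝓕 v θ

/-- Rapid decay of the Fourier transform, at the scale `s`. -/
lemma norm_fourier_le {q : ℕ} (hq : d + 1 < q) (k : ℕ) : ∃ C : ℝ, 0 ≤ C ∧
    ∀ (v : Space d → ℂ) (s V : ℝ), 1 ≤ s → 0 ≤ V → ContDiff ℝ ∞ v →
      (∀ j ≤ k, ∀ z, ‖iteratedFDeriv ℝ j v z‖ ≤ V * s ^ j * decay q (s • z)) →
      ∀ θ, ‖𝓕 v θ‖ ≤ C * (V * (s ^ (d + 1))⁻¹) * decay k (s⁻¹ • θ) := by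
  set I : ℝ := ∫ z : Space d, decay q z with hI
  have hI0 : 0 ≤ I := integral_nonneg fun z => (decay_pos q z).le
  refine ⟨2 ^ k * (2 ^ 0 * 1 * I + 2 ^ k * (k + 1) * I), by positivity,
    fun v s V hs hV hv hb θ => ?_⟩
  have hs0 : 0 < s := by linarith
  have hint : ∀ j ≤ k, Integrable (iteratedFDeriv ℝ j v) := fun j hj =>
    (((integrable_decay_smul hq hs0).const_mul (V * s ^ j))).mono'
      (hv.continuous_iteratedFDeriv (m := j) (by exact_mod_cast le_top)).aestronglyMeasurable
      (Filter.Eventually.of_forall (hb j hj))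
  have hnorm : ∀ j ≤ k, ∫ z, ‖iteratedFDeriv ℝ j v z‖ ≤ V * s ^ j * ((s ^ (d + 1))⁻¹ * I) := by
    intro j hj
    calc _ ≤ ∫ z, V * s ^ j * decay q (s • z) :=
          integral_mono (hint j hj).norm ((integrable_decay_smul hq hs0).const_mul _) (hb j hj)
      _ = _ := by rw [integral_const_mul, integral_decay_smul q hs0]
  -- Multiplication by |θ|^n is controlled by the L¹ norms of the derivatives up to order n; since s
  -- ≥ 1, the largest power s^n bounds them all. Only the orders 0 and k are used afterwards,
  -- through (1 + |θ|/s)^k ≤ 2^k (1 + (|θ|/s)^k).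
  have hF : ∀ n ≤ k, ‖θ‖ ^ n * ‖𝓕 v θ‖ ≤
      2 ^ n * ((n + 1) * (V * s ^ n * ((s ^ (d + 1))⁻¹ * I))) := by
    intro n hn
    have h := Real.pow_mul_norm_iteratedFDeriv_fourier_le (K := 0) (N := (n : ℕ∞))
      (f := v) (hv.of_le (by exact_mod_cast le_top)) (fun k' n' hk' hn' => by
        have : k' = 0 := by simpa using hk'
        subst this
        simp only [pow_zero, one_mul]
        exact (hint n' ((by exact_mod_cast hn' : n' ≤ n).trans hn)).norm)
      (k := 0) (n := n) le_rfl le_rfl θ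
    simp only [norm_iteratedFDeriv_zero, pow_zero, one_mul, zero_add, Finset.range_one,
      CharP.cast_eq_zero, mul_zero] at h
    refine h.trans (mul_le_mul_of_nonneg_left ?_ (by positivity))
    rw [Finset.sum_product]
    simp only [Finset.sum_singleton, pow_zero, one_mul]
    refine (Finset.sum_le_card_nsmul _ _ (V * s ^ n * ((s ^ (d + 1))⁻¹ * I)) fun j hj => ?_).trans
      (by simp)
    have hj' : j ≤ n := Nat.lt_succ_iff.1 (Finset.mem_range.1 hj)
    refine (hnorm j (hj'.trans hn)).trans ?_
    gcongr
  have h0 := hF 0 (Nat.zero_le _)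
  have hk := hF k le_rfl
  simp only [pow_zero, one_mul, CharP.cast_eq_zero, zero_add, mul_one] at h0
  unfold decay
  rw [← div_eq_mul_inv, le_div_iff₀ (by positivity), norm_smul, Real.norm_of_nonneg (by positivity)]
  have hp : (1 + s⁻¹ * ‖θ‖) ^ k ≤ 2 ^ k * (1 + (s⁻¹ * ‖θ‖) ^ k) := by
    have := add_pow_le (zero_le_one) (by positivity : 0 ≤ s⁻¹ * ‖θ‖) k
    rw [one_pow] at this
    refine this.trans (mul_le_mul_of_nonneg_right ?_ (by positivity))
    exact pow_le_pow_right₀ (by norm_num) (Nat.sub_le _ _)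
  calc ‖𝓕 v θ‖ * (1 + s⁻¹ * ‖θ‖) ^ k ≤ ‖𝓕 v θ‖ * (2 ^ k * (1 + (s⁻¹ * ‖θ‖) ^ k)) := by gcongr
    _ = 2 ^ k * (‖𝓕 v θ‖ + (s ^ k)⁻¹ * (‖θ‖ ^ k * ‖𝓕 v θ‖)) := by
        rw [mul_pow, inv_pow]; ring
    _ ≤ 2 ^ k * (V * ((s ^ (d + 1))⁻¹ * I) + (s ^ k)⁻¹ *
          (2 ^ k * ((k + 1) * (V * s ^ k * ((s ^ (d + 1))⁻¹ * I))))) := by gcongr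
    _ = _ := by field_simp

lemma norm_pair_le_of_fourier {u v : Space d → ℂ} {q M : ℕ} (hq : d + 1 < q)
    {s U K : ℝ} (hs : 0 < s) (hU : ∀ θ, ‖u θ‖ ≤ U * (1 + ‖s⁻¹ • θ‖) ^ M)
    (hK : ∀ θ, ‖𝓕 v θ‖ ≤ K * decay (M + q) (s⁻¹ • θ)) :
    ‖pair u v‖ ≤ U * K * (s ^ (d + 1) * ∫ z : Space d, decay q z) := by
  have hb : ∀ θ, ‖u θ * 𝓕 v θ‖ ≤ U * K * decay q (s⁻¹ • θ) := by
    intro θ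
    rw [norm_mul]
    calc _ ≤ U * (1 + ‖s⁻¹ • θ‖) ^ M * (K * decay (M + q) (s⁻¹ • θ)) :=
          mul_le_mul (hU θ) (hK θ) (norm_nonneg _) ((norm_nonneg _).trans (hU θ))
      _ = _ := by rw [← pow_mul_decay M q]; ring
  refine (norm_integral_le_of_norm_le ((integrable_decay_smul hq (inv_pos.2 hs)).const_mul _)
    (Filter.Eventually.of_forall hb)).trans (le_of_eq ?_)
  rw [integral_const_mul, integral_decay_smul q (inv_pos.2 hs), inv_pow, inv_inv]

/-- The scale invariant estimate for the pairing. -/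
lemma norm_pair_le {q : ℕ} (hq : d + 1 < q) (M : ℕ) : ∃ C : ℝ, 0 ≤ C ∧
    ∀ (u v : Space d → ℂ) (s U V : ℝ), 1 ≤ s → 0 ≤ U → 0 ≤ V → ContDiff ℝ ∞ v →
      (∀ j ≤ M + q, ∀ z, ‖iteratedFDeriv ℝ j v z‖ ≤ V * s ^ j * decay q (s • z)) →
      (∀ θ, ‖u θ‖ ≤ U * (1 + ‖s⁻¹ • θ‖) ^ M) → ‖pair u v‖ ≤ C * (U * V) := by
  obtain ⟨C, h0, hC⟩ := norm_fourier_le hq (M + q)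
  have hI0 : 0 ≤ ∫ z : Space d, decay q z := integral_nonneg fun z => (decay_pos q z).le
  refine ⟨C * ∫ z : Space d, decay q z, by positivity, fun u v s U V hs hU hV hv hb hu => ?_⟩
  have hs0 : 0 < s := by linarith
  -- The Jacobian s^{d+1} of the θ-integral cancels the factor s^{-(d+1)} in the bound for the
  -- Fourier transform, so the constant is independent of s.
  refine (norm_pair_le_of_fourier hq hs0 hu (hC v s V hs hV hv hb)).trans (le_of_eq ?_)
  field_simp

/-- Smooth functions on `ℝ^N` with integrable decay of all derivatives. -/
abbrev IsDecay (v : Space d → ℂ) : Prop := DerivBound Set.univ (decay (d + 3)) v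

/-- The dimension is d + 1, so exponent d + 2 already gives integrability. The spare power keeps |z|
v(z) integrable, as differentiation of the Fourier transform requires. -/
lemma lt_decay_exp : d + 1 < d + 3 := by omega

namespace IsDecay

variable {v : Space d → ℂ}

lemma integrable (hv : IsDecay v) : Integrable v := by
  obtain ⟨C, _, hC⟩ := hv.norm_le
  exact integrable_of_decay lt_decay_exp hv.smooth.continuous.aestronglyMeasurable
    fun z => hC z (Set.mem_univ z)

lemma norm_fourier_le (hv : IsDecay v) (k : ℕ) : ∃ C : ℝ, 0 ≤ C ∧
    ∀ θ, ‖𝓕 v θ‖ ≤ C * decay k θ := by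
  obtain ⟨C, h0, hC⟩ := MixedSymbol.norm_fourier_le (d := d) lt_decay_exp k
  choose C' h0' hC' using hv.bound
  set V := ∑ j ∈ Finset.range (k + 1), C' j with hV
  have hV0 : 0 ≤ V := Finset.sum_nonneg fun j _ => h0' j
  refine ⟨C * V, by positivity, fun θ => ?_⟩
  have := hC v 1 V le_rfl hV0 hv.smooth (fun j hj z => ?_) θ
  · simpa using this
  · rw [one_pow, mul_one, one_smul]
    refine (hC' j z (Set.mem_univ z)).trans (mul_le_mul_of_nonneg_right ?_ (decay_pos _ _).le)
    exact Finset.single_le_sum (f := C') (fun j _ => h0' j)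
      (Finset.mem_range.2 (Nat.lt_succ_of_le hj))

lemma integrable_mul_norm (hv : IsDecay v) : Integrable (fun z => ‖z‖ * ‖v z‖) := by
  obtain ⟨C, h0, hC⟩ := hv.norm_le
  refine integrable_of_decay (q := d + 2) (C := C) (by omega)
    (continuous_norm.mul hv.smooth.continuous.norm).aestronglyMeasurable fun z => ?_
  rw [norm_mul, norm_norm, norm_norm]
  have h1 := hC z (Set.mem_univ z)
  have h2 := pow_mul_decay 1 (d + 2) z
  rw [pow_one, show 1 + (d + 2) = d + 3 by ring] at h2
  rw [← h2]
  calc _ ≤ (1 + ‖z‖) * (C * decay (d + 3) z) := by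
        gcongr; linarith
    _ = _ := by ring

lemma differentiable_fourier (hv : IsDecay v) : Differentiable ℝ (𝓕 v) :=
  Real.differentiable_fourier hv.integrable hv.integrable_mul_norm

lemma fourier_dir (hv : IsDecay v) (e θ : Space d) :
    𝓕 (MixedSymbol.dir e v) θ = 2 * Real.pi * Complex.I * (inner ℝ e θ : ℝ) * 𝓕 v θ := by
  have hd : Integrable (fderiv ℝ v) := by
    obtain ⟨C, _, hC⟩ := hv.bound 1
    refine integrable_of_decay lt_decay_exp (C := C)
      (hv.smooth.continuous_fderiv (by simp)).aestronglyMeasurable fun z => ?_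
    simpa using hC z (Set.mem_univ z)
  have h := congrFun (Real.fourier_fderiv hv.integrable hv.smooth.diff hd) θ
  have h2 : 𝓕 (MixedSymbol.dir e v) θ = (𝓕 (fderiv ℝ v) θ) e := by
    rw [Real.fourier_eq, Real.fourier_eq, ContinuousLinearMap.integral_apply]
    · rfl
    · exact (Real.fourierIntegral_convergent_iff θ).2 hd
  rw [h2, h]
  have h3 : VectorFourier.fourierSMulRight (-innerSL ℝ) (𝓕 v) θ e =
      -(2 * Real.pi * Complex.I) • ((-(inner ℝ θ e : ℝ)) • 𝓕 v θ) :=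
    VectorFourier.fourierSMulRight_apply _ _ _ _
  rw [h3, real_inner_comm θ e]
  simp
  ring

lemma fderiv_fourier (hv : IsDecay v) (e θ : Space d) :
    fderiv ℝ (𝓕 v) θ e = -(2 * Real.pi * Complex.I) *
      𝓕 (fun z => (inner ℝ e z : ℝ) • v z) θ := by
  rw [Real.fderiv_fourier hv.integrable hv.integrable_mul_norm, Real.fourier_eq, Real.fourier_eq,
    ContinuousLinearMap.integral_apply, ← integral_const_mul]
  · refine integral_congr_ae (Filter.Eventually.of_forall fun z => ?_)
    have h3 : VectorFourier.fourierSMulRight (innerSL ℝ) v z e =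
        -(2 * Real.pi * Complex.I) • ((inner ℝ z e : ℝ) • v z) :=
      VectorFourier.fourierSMulRight_apply _ _ _ _
    change Real.fourierChar (-inner ℝ z θ) • (VectorFourier.fourierSMulRight (innerSL ℝ) v z e) = _
    rw [h3]
    simp [Circle.smul_def, real_inner_comm z e]
    ring
  · refine (Real.fourierIntegral_convergent_iff θ).2 ?_
    refine (hv.integrable_mul_norm.const_mul (2 * Real.pi)).mono'
      (hv.integrable.aestronglyMeasurable.fourierSMulRight)
      (Filter.Eventually.of_forall fun z => ?_)
    refine (VectorFourier.norm_fourierSMulRight_le _ _ _).trans ?_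
    have := norm_innerSL_le (E := Space d) ℝ
    calc _ ≤ 2 * Real.pi * 1 * ‖z‖ * ‖v z‖ := by gcongr
      _ = _ := by ring

end IsDecay

/-- Functions of at most polynomial growth. -/
def PolyBdd (u : Space d → ℂ) : Prop := ∃ (C : ℝ) (M : ℕ), 0 ≤ C ∧ ∀ θ, ‖u θ‖ ≤ C * (1 + ‖θ‖) ^ M

lemma PolyBdd.integrable_mul_fourier {u v : Space d → ℂ} (hu : PolyBdd u) (hc : Continuous u)
    (hv : IsDecay v) : Integrable (fun θ => u θ * 𝓕 v θ) := by
  obtain ⟨C, M, h0, hC⟩ := hu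
  obtain ⟨C', h0', hC'⟩ := hv.norm_fourier_le (M + (d + 3))
  refine integrable_of_decay lt_decay_exp (C := C * C')
    (hc.mul hv.differentiable_fourier.continuous).aestronglyMeasurable fun θ => ?_
  rw [norm_mul, ← pow_mul_decay M]
  calc _ ≤ C * (1 + ‖θ‖) ^ M * (C' * decay (M + (d + 3)) θ) :=
        mul_le_mul (hC θ) (hC' θ) (norm_nonneg _) (by positivity)
    _ = _ := by ring

/-- Integration by parts: multiplication by a coordinate in the second argument is a derivative of
the first. -/
lemma pair_inner_smul {u v : Space d → ℂ} (e : Space d) (hu : PolyBdd u) (hud : ContDiff ℝ ∞ u)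
    (hu' : PolyBdd (dir e u)) (hv : IsDecay v) (hv' : IsDecay (fun z => (inner ℝ e z : ℝ) • v z)) :
    pair u (fun z => (inner ℝ e z : ℝ) • v z) =
      (2 * Real.pi * Complex.I)⁻¹ * pair (dir e u) v := by
  have h1 : ∀ θ, 𝓕 (fun z => (inner ℝ e z : ℝ) • v z) θ =
      -(2 * Real.pi * Complex.I)⁻¹ * fderiv ℝ (𝓕 v) θ e := by
    intro θ
    rw [hv.fderiv_fourier e θ]
    have : (2 * Real.pi * Complex.I : ℂ) ≠ 0 := Complex.two_pi_I_ne_zero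
    field_simp
  have h2 : ∀ θ, fderiv ℝ (𝓕 v) θ e = -(2 * Real.pi * Complex.I) *
      𝓕 (fun z => (inner ℝ e z : ℝ) • v z) θ := fun θ => hv.fderiv_fourier e θ
  have key := integral_mul_fderiv_eq_neg_fderiv_mul_of_integrable (μ := volume) (f := u)
    (g := 𝓕 v) (v := e) (hu'.integrable_mul_fourier (contDiff_dir hud e).continuous hv) ?_
    (hu.integrable_mul_fourier hud.continuous hv) (fun θ _ => hud.diff θ)
    (fun θ _ => hv.differentiable_fourier θ)
  · unfold pair
    calc ∫ θ, u θ * 𝓕 (fun z => (inner ℝ e z : ℝ) • v z) θ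
        = ∫ θ, -(2 * Real.pi * Complex.I)⁻¹ * (u θ * fderiv ℝ (𝓕 v) θ e) := by
          refine integral_congr_ae (Filter.Eventually.of_forall fun θ => ?_)
          simp only [h1 θ]; ring
      _ = _ := by
          rw [integral_const_mul, key]
          simp only [dir]; ring
  · have := (hu.integrable_mul_fourier hud.continuous hv').const_mul (-(2 * Real.pi * Complex.I))
    refine this.congr (Filter.Eventually.of_forall fun θ => ?_)
    simp only [h2 θ]; ring

end Fourier

end MixedSymbol
end
-- Pairings depending on a parameter
noncomputable section
namespace MixedSymbol

open MeasureTheory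

variable {d : ℕ} {P : Type*} [NormedAddCommGroup P]

/-- Bounds by multiples of `ν`, locally uniformly in the parameter. -/
def LocBound {F : Type*} [NormedAddCommGroup F] (ν : Space d → ℝ) (f : P × Space d → F) : Prop :=
  ∀ R : ℝ, ∃ C : ℝ, 0 ≤ C ∧ ∀ p, ‖p‖ ≤ R → ∀ z, ‖f (p, z)‖ ≤ C * ν z

/-- Polynomial growth in the second variable, locally uniformly in the parameter. -/
def LocPoly (u : P × Space d → ℂ) : Prop :=
  ∀ R : ℝ, ∃ (C : ℝ) (M : ℕ), 0 ≤ C ∧ ∀ p, ‖p‖ ≤ R → ∀ θ, ‖u (p, θ)‖ ≤ C * (1 + ‖θ‖) ^ M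

lemma LocPoly.slice {u : P × Space d → ℂ} (hu : LocPoly u) (p : P) :
    PolyBdd (fun θ => u (p, θ)) := by
  obtain ⟨C, M, h0, hC⟩ := hu ‖p‖
  exact ⟨C, M, h0, hC p le_rfl⟩

variable [NormedSpace ℝ P]

lemma fderiv_slice {F : P × Space d → ℂ} (hF : Differentiable ℝ F) (p : P) (z : Space d) :
    HasFDerivAt (fun p => F (p, z))
      ((fderiv ℝ F (p, z)).comp (ContinuousLinearMap.inl ℝ P (Space d))) p :=
  (hF (p, z)).hasFDerivAt.comp p (hasFDerivAt_prodMk_left p z)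

lemma dir_slice_right {F : P × Space d → ℂ} (hF : Differentiable ℝ F) (p : P) (e z : Space d) :
    dir e (fun z => F (p, z)) z = dir (0, e) F (p, z) := by
  have := ((hF (p, z)).hasFDerivAt.comp z (hasFDerivAt_prodMk_right p z)).fderiv
  exact congrArg (fun T : Space d →L[ℝ] ℂ => T e) this

/-- Differentiation under the integral sign. -/
theorem differentiable_integral [FiniteDimensional ℝ P] {q : ℕ} (hq : d + 1 < q)
    {F : P × Space d → ℂ}
    (hF : Differentiable ℝ F) (h0 : LocBound (decay q) F)
    (h1 : ∀ e : P, LocBound (decay q) (dir (e, 0) F)) :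
    Differentiable ℝ (fun p => ∫ z, F (p, z)) ∧
      ∀ e p, dir e (fun p => ∫ z, F (p, z)) p = ∫ z, dir (e, 0) F (p, z) := by
  have hmeas : ∀ p : P, AEStronglyMeasurable (fun z => F (p, z)) volume := fun p =>
    (hF.continuous.comp (Continuous.prodMk_right p)).aestronglyMeasurable
  have hint : ∀ p : P, Integrable (fun z => F (p, z)) := fun p => by
    obtain ⟨C, _, hC⟩ := h0 ‖p‖
    exact integrable_of_decay hq (hmeas p) (hC p le_rfl)
  have hmeas' : ∀ p : P, AEStronglyMeasurable (fun z =>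
      (fderiv ℝ F (p, z)).comp (ContinuousLinearMap.inl ℝ P (Space d))) volume := by
    intro p
    borelize P
    have h : Measurable fun z : Space d => fderiv ℝ F (p, z) :=
      (measurable_fderiv ℝ F).comp measurable_prodMk_left
    have hc : Continuous fun T : P × Space d →L[ℝ] ℂ =>
        T.comp (ContinuousLinearMap.inl ℝ P (Space d)) :=
      ((ContinuousLinearMap.compL ℝ P (P × Space d) ℂ).flip _).continuous
    exact (hc.measurable.comp h).aestronglyMeasurable
  have hder : ∀ R : ℝ, ∃ C : ℝ, ∀ p : P, ‖p‖ ≤ R → ∀ z, ‖(fderiv ℝ F (p, z)).comp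
      (ContinuousLinearMap.inl ℝ P (Space d))‖ ≤ C * decay q z := by
    intro R
    let b := Module.finBasis ℝ P
    choose C h0' hC using fun i => h1 (b i) R
    let T : Fin (Module.finrank ℝ P) → ℂ →L[ℝ] P →L[ℝ] ℂ := fun i =>
      ContinuousLinearMap.smulRightL ℝ P ℂ (LinearMap.toContinuousLinearMap (b.coord i))
    refine ⟨∑ i, ‖T i‖ * C i, fun p hp z => ?_⟩
    have e := fderiv_eq_sum_basis b (fun p => F (p, z)) p
    rw [(fderiv_slice hF p z).fderiv] at e
    rw [e, Finset.sum_mul]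
    refine norm_sum_le_of_le _ fun i _ => ((T i).le_opNorm _).trans ?_
    rw [mul_assoc]
    exact mul_le_mul_of_nonneg_left (hC i p hp z) (norm_nonneg _)
  have hmain : ∀ p0 : P, HasFDerivAt (fun p => ∫ z, F (p, z))
      (∫ z, (fderiv ℝ F (p0, z)).comp (ContinuousLinearMap.inl ℝ P (Space d))) p0 := by
    intro p0
    obtain ⟨C, hC⟩ := hder (‖p0‖ + 1)
    refine hasFDerivAt_integral_of_dominated_of_fderiv_le (F := fun p z => F (p, z))
      (F' := fun p z => (fderiv ℝ F (p, z)).comp (ContinuousLinearMap.inl ℝ P (Space d)))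
      (bound := fun z => C * decay q z) (Metric.ball_mem_nhds p0 one_pos)
      (Filter.Eventually.of_forall hmeas) (hint p0) (hmeas' p0)
      (Filter.Eventually.of_forall fun z p hp => hC p ?_ z) ((integrable_decay hq).const_mul C)
      (Filter.Eventually.of_forall fun z p _ => fderiv_slice hF p z)
    have := norm_le_norm_add_norm_sub' p p0
    rw [mem_ball_iff_norm] at hp
    linarith
  refine ⟨fun p => (hmain p).differentiableAt, fun e p => ?_⟩
  simp only [dir]
  rw [(hmain p).fderiv, ContinuousLinearMap.integral_apply]
  · rfl
  · obtain ⟨C, hC⟩ := hder ‖p‖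
    exact integrable_of_decay hq (hmeas' p) (hC p le_rfl)

/-- Amplitudes that decay in the second variable with all derivatives, locally uniformly in the
parameter. -/
def LocDecay (v : P × Space d → ℂ) : Prop :=
  ∀ R : ℝ, DerivBound {x : P × Space d | ‖x.1‖ ≤ R} (fun x => decay (d + 3) x.2) v

namespace LocDecay

variable {v : P × Space d → ℂ}

lemma contDiff (hv : LocDecay v) : ContDiff ℝ ∞ v := (hv 0).smooth

lemma dir (hv : LocDecay v) (e : P × Space d) : LocDecay (dir e v) := fun R => (hv R).fderiv_apply e

lemma locBound (hv : LocDecay v) : LocBound (decay (d + 3)) v := fun R => by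
  obtain ⟨C, h0, hC⟩ := (hv R).norm_le
  exact ⟨C, h0, fun p hp z => hC (p, z) hp⟩

lemma slice (hv : LocDecay v) (p : P) : IsDecay (fun z => v (p, z)) := by
  refine ⟨hv.contDiff.comp (contDiff_prodMk_right p), fun k => ?_⟩
  obtain ⟨C, h0, hC⟩ := (hv ‖p‖).bound k
  exact ⟨C, h0, fun z _ => (norm_iteratedFDeriv_slice_le hv.contDiff k p z).trans
    (hC (p, z) (le_refl ‖p‖))⟩

end LocDecay

/-- The partial Fourier transform. -/
def ft (v : P × Space d → ℂ) (x : P × Space d) : ℂ := 𝓕 (fun z => v (x.1, z)) x.2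

lemma LocDecay.ft_locBound {v : P × Space d → ℂ} (hv : LocDecay v) (k : ℕ) :
    LocBound (decay k) (ft v) := by
  intro R
  obtain ⟨C, h0, hC⟩ := norm_fourier_le (d := d) lt_decay_exp k
  choose C' h0' hC' using (hv R).bound
  set V := ∑ j ∈ Finset.range (k + 1), C' j with hV
  have hV0 : 0 ≤ V := Finset.sum_nonneg fun j _ => h0' j
  refine ⟨C * V, by positivity, fun p hp θ => ?_⟩
  have := hC (fun z => v (p, z)) 1 V le_rfl hV0 (hv.slice p).smooth (fun j hj z => ?_) θ
  · simpa [ft] using this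
  · rw [one_pow, mul_one, one_smul]
    refine (norm_iteratedFDeriv_slice_le hv.contDiff j p z).trans ((hC' j (p, z) hp).trans
      (mul_le_mul_of_nonneg_right ?_ (decay_pos _ _).le))
    exact Finset.single_le_sum (f := C') (fun j _ => h0' j)
      (Finset.mem_range.2 (Nat.lt_succ_of_le hj))

/-- The Fourier phase. -/
def phase (x : ℝ) : ℂ := Complex.exp (-(2 * Real.pi * Complex.I) * x)

lemma fourier_eq_phase (v : Space d → ℂ) (θ : Space d) :
    𝓕 v θ = ∫ z, phase (inner ℝ z θ) * v z := by
  rw [Real.fourier_eq]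
  refine integral_congr_ae (Filter.Eventually.of_forall fun z => ?_)
  simp only [Circle.smul_def, Real.fourierChar_apply, phase, smul_eq_mul]
  congr 2
  push_cast
  ring

lemma norm_phase (x : ℝ) : ‖phase x‖ = 1 := by
  rw [phase, Complex.norm_exp]
  simp

lemma contDiff_phase : ContDiff ℝ ∞ phase := by
  unfold phase
  exact (contDiff_const.mul Complex.ofRealCLM.contDiff).cexp

lemma hasDerivAt_phase (x : ℝ) : HasDerivAt phase (-(2 * Real.pi * Complex.I) * phase x) x := by
  have h : HasDerivAt (fun x : ℝ => -(2 * Real.pi * Complex.I) * (x : ℂ))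
      (-(2 * Real.pi * Complex.I) * 1) x :=
    (Complex.ofRealCLM.hasDerivAt (x := x)).const_mul _
  have := h.cexp
  unfold phase
  convert this using 1
  ring

lemma dir_phase_comp {V : Type*} [NormedAddCommGroup V] [NormedSpace ℝ V] {f : V → ℝ}
    (hf : Differentiable ℝ f) (e : V) :
    dir e (fun p => phase (f p)) = fun p => -(2 * Real.pi * Complex.I) * dir e f p * phase (f p) := by
  funext p
  have h := ((hasDerivAt_phase (f p)).hasFDerivAt.comp p (hf p).hasFDerivAt).fderiv
  have h2 := congrArg (fun T : V →L[ℝ] ℂ => T e) h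
  simp only [dir]
  refine h2.trans ?_
  simp
  ring

/-- Both p and θ are treated as parameters of the integral of phase times v, which yields joint
differentiability; the directions (e, 0) leave the phase alone. -/
theorem LocDecay.ft_differentiable [FiniteDimensional ℝ P] {v : P × Space d → ℂ}
    (hv : LocDecay v) :
    Differentiable ℝ (ft v) ∧ ∀ (e : P) (x : P × Space d),
      MixedSymbol.dir (e, 0) (ft v) x = ft (MixedSymbol.dir (e, 0) v) x := by
  have hs : ContDiff ℝ ∞ (fun y : (P × Space d) × Space d => v (y.1.1, y.2)) :=
    hv.contDiff.comp ((contDiff_fst.comp contDiff_fst).prodMk contDiff_snd)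
  have hi : ContDiff ℝ ∞ (fun y : (P × Space d) × Space d => (inner ℝ y.2 y.1.2 : ℝ)) :=
    contDiff_snd.inner ℝ (contDiff_snd.comp contDiff_fst)
  have hph : ContDiff ℝ ∞ (fun y : (P × Space d) × Space d => phase (inner ℝ y.2 y.1.2)) :=
    contDiff_phase.comp hi
  have hdv : ∀ (e : P) (e' : Space d), MixedSymbol.dir ((e, e'), (0 : Space d))
      (fun y : (P × Space d) × Space d => v (y.1.1, y.2)) =
      fun y => MixedSymbol.dir (e, 0) v (y.1.1, y.2) := by
    intro e e'
    funext y
    have h := ((hv.contDiff.diff (y.1.1, y.2)).hasFDerivAt.comp y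
      (((hasFDerivAt_fst (𝕜 := ℝ) (E := P) (F := Space d)).comp y
        (hasFDerivAt_fst (𝕜 := ℝ))).prodMk (hasFDerivAt_snd (𝕜 := ℝ)))).fderiv
    exact congrArg (fun T : (P × Space d) × Space d →L[ℝ] ℂ => T ((e, e'), 0)) h
  have hdi : ∀ (e : P) (e' : Space d), MixedSymbol.dir ((e, e'), (0 : Space d))
      (fun y : (P × Space d) × Space d => (inner ℝ y.2 y.1.2 : ℝ)) =
      fun y => inner ℝ y.2 e' := by
    intro e e'
    funext y
    have h := ((hasFDerivAt_snd (𝕜 := ℝ) (p := y)).inner ℝ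
      ((hasFDerivAt_snd (𝕜 := ℝ) (E := P) (F := Space d)).comp y (hasFDerivAt_fst (𝕜 := ℝ)))).fderiv
    have h2 := congrArg (fun T : (P × Space d) × Space d →L[ℝ] ℝ => T ((e, e'), 0)) h
    refine h2.trans ?_
    simp
  have hdir : ∀ (e : P) (e' : Space d), MixedSymbol.dir ((e, e'), (0 : Space d))
      (fun y : (P × Space d) × Space d => phase (inner ℝ y.2 y.1.2) * v (y.1.1, y.2)) =
      fun y => -(2 * Real.pi * Complex.I) * (inner ℝ y.2 e' : ℝ) * phase (inner ℝ y.2 y.1.2) *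
        v (y.1.1, y.2) + phase (inner ℝ y.2 y.1.2) * MixedSymbol.dir (e, 0) v (y.1.1, y.2) := by
    intro e e'
    rw [dir_mul hph.diff hs.diff, hdv, dir_phase_comp hi.diff, hdi]
  -- A θ-derivative brings down a factor of size |z|, which consumes one of the d + 3 powers of
  -- decay; d + 2 still exceeds the dimension.
  have h := differentiable_integral (q := d + 2) (by omega)
    (F := fun y : (P × Space d) × Space d => phase (inner ℝ y.2 y.1.2) * v (y.1.1, y.2))
    (hph.mul hs).diff ?_ ?_
  · have e1 : ft v = fun x => ∫ z, phase (inner ℝ z x.2) * v (x.1, z) := by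
      funext x; exact fourier_eq_phase _ _
    rw [e1]
    refine ⟨h.1, fun e x => ?_⟩
    rw [h.2 (e, 0) x]
    simp only [hdir, inner_zero_right]
    rw [ft, fourier_eq_phase]
    simp
  · intro R
    obtain ⟨C, h0, hC⟩ := hv.locBound R
    refine ⟨C, h0, fun p hp z => ?_⟩
    rw [norm_mul, norm_phase, one_mul]
    exact (hC p.1 ((norm_fst_le p).trans hp) z).trans
      (mul_le_mul_of_nonneg_left (decay_anti (by omega) z) h0)
  · rintro ⟨e, e'⟩ R
    obtain ⟨C, h0, hC⟩ := hv.locBound R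
    obtain ⟨C', h0', hC'⟩ := (hv.dir (e, 0)).locBound R
    refine ⟨2 * Real.pi * ‖e'‖ * C + C', by positivity, fun p hp z => ?_⟩
    have hp' := (norm_fst_le p).trans hp
    rw [hdir, add_mul]
    refine norm_add_le_of_le ?_ ?_
    · rw [norm_mul, norm_mul, norm_phase, mul_one, norm_mul]
      have h1 : ‖-(2 * Real.pi * Complex.I : ℂ)‖ = 2 * Real.pi := by
        simp [abs_of_pos Real.pi_pos]
      rw [h1, Complex.norm_real]
      have h2 := norm_inner_le_norm (𝕜 := ℝ) z e'
      have h3 := hC p.1 hp' z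
      have h4 := pow_mul_decay 1 (d + 2) z
      rw [pow_one, show 1 + (d + 2) = d + 3 by ring] at h4
      calc _ ≤ 2 * Real.pi * ((1 + ‖z‖) * ‖e'‖) * (C * decay (d + 3) z) := by
            gcongr
            exact h2.trans (mul_le_mul_of_nonneg_right (by linarith) (norm_nonneg _))
        _ = 2 * Real.pi * ‖e'‖ * C * ((1 + ‖z‖) * decay (d + 3) z) := by ring
        _ = _ := by rw [h4]
    · rw [norm_mul, norm_phase, one_mul]
      exact (hC' p.1 hp' z).trans (mul_le_mul_of_nonneg_left (decay_anti (by omega) z) h0')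

lemma LocPoly.mul_ft {u v : P × Space d → ℂ} (hu : LocPoly u) (hv : LocDecay v) :
    LocBound (decay (d + 3)) (fun x => u x * ft v x) := by
  intro R
  obtain ⟨C, M, h0, hC⟩ := hu R
  obtain ⟨C', h0', hC'⟩ := hv.ft_locBound (M + (d + 3)) R
  refine ⟨C * C', by positivity, fun p hp θ => ?_⟩
  rw [norm_mul, ← pow_mul_decay M]
  calc _ ≤ C * (1 + ‖θ‖) ^ M * (C' * decay (M + (d + 3)) θ) :=
        mul_le_mul (hC p hp θ) (hC' p hp θ) (norm_nonneg _) (by positivity)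
    _ = _ := by ring

/-- The parametric pairing `p ↦ ∫ u(p, θ) v^(p, θ) dθ`. -/
def ppair (u v : P × Space d → ℂ) (p : P) : ℂ := pair (fun θ => u (p, θ)) (fun z => v (p, z))

/-- In θ the first factor grows polynomially while the partial Fourier transform decays to every
order, locally uniformly in p. Hence the product rule passes under the integral. -/
theorem ppair_differentiable [FiniteDimensional ℝ P] {u v : P × Space d → ℂ}
    (hud : Differentiable ℝ u) (hu : LocPoly u) (hu' : ∀ e : P, LocPoly (dir (e, 0) u))
    (hv : LocDecay v) :
    Differentiable ℝ (ppair u v) ∧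
      ∀ e p, dir e (ppair u v) p = ppair (dir (e, 0) u) v p + ppair u (dir (e, 0) v) p := by
  obtain ⟨hd, hdir⟩ := hv.ft_differentiable
  have hdir' : ∀ e : P, dir (e, 0) (fun x => u x * ft v x) =
      fun x => dir (e, 0) u x * ft v x + u x * ft (dir (e, 0) v) x := by
    intro e
    rw [dir_mul hud hd]
    funext x
    rw [hdir]
  have h := differentiable_integral (q := d + 3) (by omega) (F := fun x => u x * ft v x)
    (hud.mul hd) (hu.mul_ft hv) (fun e => ?_)
  · refine ⟨h.1, fun e p => (h.2 e p).trans ?_⟩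
    rw [hdir']
    have i1 : Integrable (fun θ => dir (e, 0) u (p, θ) * ft v (p, θ)) := by
      obtain ⟨C, _, hC⟩ := (hu' e).mul_ft hv ‖p‖
      refine integrable_of_decay lt_decay_exp (AEStronglyMeasurable.mul ?_ ?_) (hC p le_rfl)
      · borelize P
        exact ((measurable_fderiv_apply_const ℝ u (e, 0)).comp
          measurable_prodMk_left).aestronglyMeasurable
      · exact (hd.continuous.comp (Continuous.prodMk_right p)).aestronglyMeasurable
    have i2 : Integrable (fun θ => u (p, θ) * ft (dir (e, 0) v) (p, θ)) := by
      obtain ⟨C, _, hC⟩ := hu.mul_ft (hv.dir (e, 0)) ‖p‖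
      refine integrable_of_decay lt_decay_exp (AEStronglyMeasurable.mul ?_ ?_) (hC p le_rfl)
      · exact (hud.continuous.comp (Continuous.prodMk_right p)).aestronglyMeasurable
      · exact ((hv.dir (e, 0)).ft_differentiable.1.continuous.comp
          (Continuous.prodMk_right p)).aestronglyMeasurable
    exact integral_add i1 i2
  · intro R
    rw [hdir']
    obtain ⟨C, h0, hC⟩ := (hu' e).mul_ft hv R
    obtain ⟨C', h0', hC'⟩ := hu.mul_ft (hv.dir (e, 0)) R
    exact ⟨C + C', by positivity, fun p hp z => by
      rw [add_mul]; exact norm_add_le_of_le (hC p hp z) (hC' p hp z)⟩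

end MixedSymbol
end
-- Hadamard's lemma with bounded derivatives
noncomputable section
namespace MixedSymbol

open MeasureTheory

variable {d : ℕ} {D : Space d → Submodule ℝ (Space d)}

section Hadamard

/-- The point `(1 - t) x + t y`, linear in `(x, y)`. -/
def segMap (d : ℕ) (t : ℝ) : Space d × Space d →L[ℝ] Space d :=
  (1 - t) • ContinuousLinearMap.fst ℝ (Space d) (Space d) +
    t • ContinuousLinearMap.snd ℝ (Space d) (Space d)

lemma segMap_apply (t : ℝ) (q : Space d × Space d) : segMap d t q = (1 - t) • q.1 + t • q.2 := rfl

lemma norm_segMap_le {t : ℝ} (h0 : 0 ≤ t) (h1 : t ≤ 1) : ‖segMap d t‖ ≤ 1 := by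
  refine ContinuousLinearMap.opNorm_le_bound _ zero_le_one fun q => ?_
  rw [segMap_apply, one_mul]
  refine (norm_add_le _ _).trans ?_
  rw [norm_smul, norm_smul, Real.norm_of_nonneg h0, Real.norm_of_nonneg (by linarith : 0 ≤ 1 - t)]
  have h2 := norm_fst_le q
  have h3 := norm_snd_le q
  nlinarith [mul_le_mul_of_nonneg_left h2 (by linarith : 0 ≤ 1 - t), mul_le_mul_of_nonneg_left h3 h0]

lemma continuous_segMap_apply (q : Space d × Space d) : Continuous fun t => segMap d t q := by
  simp only [segMap_apply]
  fun_prop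

lemma continuous_segMap : Continuous (segMap d) := by
  unfold segMap
  fun_prop

/-- Weighted averages of a function along segments. -/
def segAvg (p : ℝ → ℝ) (g : Space d → ℝ) (q : Space d × Space d) : ℝ :=
  ∫ t in (0 : ℝ)..1, p t * g (segMap d t q)

lemma hasFDerivAt_segAvg {p : ℝ → ℝ} (hp : Continuous p)
    (hp1 : ∀ t, 0 ≤ t → t ≤ 1 → |p t| ≤ 1) {g : Space d → ℝ} (hg : IsCb g)
    (q : Space d × Space d) :
    HasFDerivAt (segAvg p g)
      (∫ t in (0 : ℝ)..1, p t • (fderiv ℝ g (segMap d t q)).comp (segMap d t)) q := by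
  obtain ⟨C, h0, hC⟩ := hg.bound 1
  have hgc := hg.smooth.continuous
  have hgc' : Continuous (fderiv ℝ g) := hg.smooth.continuous_fderiv (by simp)
  refine intervalIntegral.hasFDerivAt_integral_of_dominated_of_fderiv_le
    (F := fun q t => p t * g (segMap d t q))
    (F' := fun q t => p t • (fderiv ℝ g (segMap d t q)).comp (segMap d t)) (bound := fun _ => C)
    Filter.univ_mem (Filter.Eventually.of_forall fun q => ?_) ?_ ?_
    (Filter.Eventually.of_forall fun t ht q _ => ?_) (by simp)
    (Filter.Eventually.of_forall fun t _ q _ => ?_)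
  · exact (hp.mul (hgc.comp (continuous_segMap_apply q))).aestronglyMeasurable
  · exact (hp.mul (hgc.comp (continuous_segMap_apply q))).intervalIntegrable _ _
  · exact (hp.smul ((hgc'.comp (continuous_segMap_apply q)).clm_comp
      continuous_segMap)).aestronglyMeasurable
  · rw [Set.uIoc_of_le zero_le_one] at ht
    rw [norm_smul]
    have h1 := hp1 t ht.1.le ht.2
    have h2 : ‖fderiv ℝ g (segMap d t q)‖ ≤ C := by simpa using hC (segMap d t q) (Set.mem_univ _)
    have h3 := norm_segMap_le (d := d) ht.1.le ht.2
    calc _ ≤ 1 * (C * 1) := by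
          refine mul_le_mul h1 ((ContinuousLinearMap.opNorm_comp_le _ _).trans
            (mul_le_mul h2 h3 (norm_nonneg _) h0)) (norm_nonneg _) zero_le_one
      _ = C := by ring
  · have := (hg.smooth.diff (segMap d t q)).hasFDerivAt.comp q (segMap d t).hasFDerivAt
    exact this.const_mul (p t)

lemma dir_segAvg {p : ℝ → ℝ} (hp : Continuous p)
    (hp1 : ∀ t, 0 ≤ t → t ≤ 1 → |p t| ≤ 1) {g : Space d → ℝ} (hg : IsCb g)
    (q e : Space d × Space d) :
    fderiv ℝ (segAvg p g) q e =
      ∫ t in (0 : ℝ)..1, p t * fderiv ℝ g (segMap d t q) (segMap d t e) := by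
  have hgc' : Continuous (fderiv ℝ g) := hg.smooth.continuous_fderiv (by simp)
  rw [(hasFDerivAt_segAvg hp hp1 hg q).fderiv, ContinuousLinearMap.intervalIntegral_apply]
  · rfl
  · exact (hp.smul ((hgc'.comp (continuous_segMap_apply q)).clm_comp
      continuous_segMap)).intervalIntegrable _ _

/-- Differentiating an average in x or y differentiates g and multiplies the averaging weight by 1 -
t or t. Averages with weights bounded by 1 on [0, 1] are therefore a family stable under partial
derivatives. -/
lemma isCb_segAvg {p : ℝ → ℝ} (hp : Continuous p)
    (hp1 : ∀ t, 0 ≤ t → t ≤ 1 → |p t| ≤ 1) {g : Space d → ℝ} (hg : IsCb g) :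
    IsCb (segAvg p g) := by
  let S : Set (Space d × Space d → ℝ) := {f | ∃ (p : ℝ → ℝ) (g : Space d → ℝ), Continuous p ∧
    (∀ t, 0 ≤ t → t ≤ 1 → |p t| ≤ 1) ∧ IsCb g ∧ f = segAvg p g}
  refine isCb_of_family (IsSymbol.pairBasis d) S ?_ ?_ ?_ (f := segAvg p g)
    ⟨p, g, hp, hp1, hg, rfl⟩
  · rintro f ⟨p, g, hp, hp1, hg, rfl⟩
    exact fun q => (hasFDerivAt_segAvg hp hp1 hg q).differentiableAt
  · rintro f ⟨p, g, hp, hp1, hg, rfl⟩ (i | i)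
    · refine ⟨fun t => p t * (1 - t), fun x => fderiv ℝ g x (EuclideanSpace.single i 1),
        by fun_prop, fun t h0 h1 => ?_, hg.fderiv_apply _, ?_⟩
      · rw [abs_mul, abs_of_nonneg (by linarith : 0 ≤ 1 - t)]
        exact mul_le_one₀ (hp1 t h0 h1) (by linarith) (by linarith)
      · funext q
        rw [IsSymbol.pairBasis_inl, dir_segAvg hp hp1 hg, segAvg]
        simp [segMap_apply, mul_assoc]
    · refine ⟨fun t => p t * t, fun x => fderiv ℝ g x (EuclideanSpace.single i 1),
        by fun_prop, fun t h0 h1 => ?_, hg.fderiv_apply _, ?_⟩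
      · rw [abs_mul, abs_of_nonneg h0]
        exact mul_le_one₀ (hp1 t h0 h1) h0 h1
      · funext q
        rw [IsSymbol.pairBasis_inr, dir_segAvg hp hp1 hg, segAvg]
        simp [segMap_apply, mul_assoc]
  · rintro f ⟨p, g, hp, hp1, hg, rfl⟩
    obtain ⟨C, h0, hC⟩ := hg.norm_le
    refine ⟨C, fun q => ?_⟩
    have := intervalIntegral.norm_integral_le_of_norm_le_const (a := 0) (b := 1) (C := C)
      (f := fun t => p t * g (segMap d t q)) fun t ht => ?_
    · simpa [segAvg] using this
    · rw [Set.uIoc_of_le zero_le_one] at ht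
      rw [norm_mul]
      calc _ ≤ 1 * C := mul_le_mul (hp1 t ht.1.le ht.2) (hC _) (norm_nonneg _) zero_le_one
        _ = C := one_mul C

/-- Hadamard's lemma for functions with bounded derivatives. -/
lemma exists_hadamard {c : Space d → ℝ} (hc : IsCb c) :
    ∃ H : Fin (d + 1) → Space d × Space d → ℝ, (∀ r, IsCb (H r)) ∧
      ∀ x y, c y - c x = ∑ r, (y r - x r) * H r (x, y) := by
  refine ⟨fun r => segAvg (fun _ => 1) fun x => fderiv ℝ c x (EuclideanSpace.single r 1),
    fun r => isCb_segAvg continuous_const (by simp) (hc.fderiv_apply _), fun x y => ?_⟩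
  have hcc' : Continuous (fderiv ℝ c) := hc.smooth.continuous_fderiv (by simp)
  have hd : ∀ t : ℝ, HasDerivAt (fun t => c (segMap d t (x, y)))
      (fderiv ℝ c (segMap d t (x, y)) (y - x)) t := by
    intro t
    have h1 : HasDerivAt (fun t : ℝ => segMap d t (x, y)) (y - x) t := by
      have : (fun t : ℝ => segMap d t (x, y)) = fun t => x + t • (y - x) := by
        funext t; rw [segMap_apply, smul_sub, sub_smul, one_smul]; abel
      rw [this]
      simpa using ((hasDerivAt_id t).smul_const (y - x)).const_add x
    exact (hc.smooth.diff _).hasFDerivAt.comp_hasDerivAt t h1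
  have hcont : ∀ e : Space d, Continuous fun t : ℝ => fderiv ℝ c (segMap d t (x, y)) e := fun e =>
    (hcc'.comp (continuous_segMap_apply _)).clm_apply continuous_const
  have key := intervalIntegral.integral_eq_sub_of_hasDerivAt (a := 0) (b := 1)
    (fun t _ => hd t) ((hcont (y - x)).intervalIntegrable _ _)
  simp only [segMap_apply] at key
  simp only [sub_self, zero_smul, one_smul, zero_add, sub_zero, add_zero] at key
  rw [← key]
  simp only [segAvg, one_mul, ← intervalIntegral.integral_const_mul]
  rw [← intervalIntegral.integral_finsetSum]
  · refine intervalIntegral.integral_congr fun t _ => ?_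
    have e : y - x = ∑ r, (y r - x r) • EuclideanSpace.single r (1 : ℝ) := by
      ext j; simp [Finset.sum_apply, Pi.single_apply]
    change fderiv ℝ c (segMap d t (x, y)) (y - x) = ∑ r, (y r - x r) *
      fderiv ℝ c (segMap d t (x, y)) (EuclideanSpace.single r 1)
    conv_lhs => rw [e, map_sum]
    simp only [map_smul, smul_eq_mul]
  · intro r _
    exact (continuous_const.mul (hcont _)).intervalIntegrable _ _

end Hadamard

end MixedSymbol
end
-- The composition integral J and its algebraic rules
noncomputable section
namespace MixedSymbol

open MeasureTheory

variable {d : ℕ} {D : Space d → Submodule ℝ (Space d)}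

/-- The kernels `G(x, y)`, decaying off the diagonal to order `k` with all derivatives. -/
abbrev IsKernel (k : ℕ) (G : Space d × Space d → ℝ) : Prop :=
  DerivBound Set.univ (fun p => decay k (p.2 - p.1)) G

/-- Linear functions. -/
lemma DerivBound.clm {V F : Type*} [NormedAddCommGroup V] [NormedSpace ℝ V]
    [NormedAddCommGroup F] [NormedSpace ℝ F] {S : Set V} {η : V → ℝ} (hη : ∀ x ∈ S, 1 ≤ η x)
    (T : V →L[ℝ] F) {C : ℝ} (hT : ∀ x ∈ S, ‖T x‖ ≤ C * η x) : DerivBound S η T := by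
  refine DerivBound.of_bound (fun x hx => zero_le_one.trans (hη x hx)) T.contDiff fun k => ?_
  have hf : fderiv ℝ T = fun _ => T := by funext p; exact T.fderiv
  rcases k with _ | _ | k
  · exact ⟨C, fun x hx => by simpa using hT x hx⟩
  · refine ⟨‖T‖, fun p hp => ?_⟩
    rw [← norm_iteratedFDeriv_fderiv, hf]
    simpa using le_mul_of_one_le_right (norm_nonneg T) (hη p hp)
  · refine ⟨0, fun p _ => ?_⟩
    rw [← norm_iteratedFDeriv_fderiv, hf, iteratedFDeriv_const_of_ne (by simp)]
    simp

section Kernel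

variable {k : ℕ} {G : Space d × Space d → ℝ}

lemma IsKernel.mul {c : Space d × Space d → ℝ} (hc : IsCb c) (hG : IsKernel k G) :
    IsKernel k (fun p => c p * G p) := by
  simpa using DerivBound.smul hc hG

lemma IsKernel.dir (hG : IsKernel k G) (e : Space d × Space d) :
    IsKernel k (dir e G) := hG.fderiv_apply e

lemma IsKernel.weaken {k' : ℕ} (hG : IsKernel k G) (h : k' ≤ k) : IsKernel k' G :=
  DerivBound.mono (c := 1) hG zero_le_one fun p _ => by rw [one_mul]; exact decay_anti h _

lemma IsKernel.coord_mul (hG : IsKernel (k + 1) G) (r : Fin (d + 1)) :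
    IsKernel k (fun q => (q.2 r - q.1 r) * G q) := by
  let T : Space d × Space d →L[ℝ] ℝ := (EuclideanSpace.proj r).comp
    (ContinuousLinearMap.snd ℝ (Space d) (Space d) - ContinuousLinearMap.fst ℝ (Space d) (Space d))
  have hT : DerivBound Set.univ (fun p : Space d × Space d => 1 + ‖p.2 - p.1‖) T := by
    refine DerivBound.clm (fun _ _ => le_add_of_nonneg_right (norm_nonneg _)) T (C := 1)
      fun p _ => ?_
    have : ‖T p‖ ≤ ‖p.2 - p.1‖ := AdaptedFrame.abs_coord_le (p.2 - p.1) r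
    linarith
  refine DerivBound.mono (c := 1) (DerivBound.smul hT hG) zero_le_one fun p _ => ?_
  have := pow_mul_decay 1 k (p.2 - p.1)
  rw [pow_one, add_comm 1 k] at this
  rw [this, one_mul]

end Kernel

section Maps

lemma dir_comp_clm {V W F : Type*} [NormedAddCommGroup V] [NormedSpace ℝ V] [NormedAddCommGroup W]
    [NormedSpace ℝ W] [NormedAddCommGroup F] [NormedSpace ℝ F] {f : V → F}
    (hf : Differentiable ℝ f) (L : W →L[ℝ] V) (e : W) :
    dir e (fun x => f (L x)) = fun x => dir (L e) f (L x) := by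
  funext x
  have := ((hf (L x)).hasFDerivAt.comp x L.hasFDerivAt).fderiv
  exact congrArg (fun T : W →L[ℝ] F => T e) this

/-- `((x, ξ), θ) ↦ (x, ξ + θ)`. -/
def mapU (d : ℕ) : (Space d × Space d) × Space d →L[ℝ] Space d × Space d :=
  ((ContinuousLinearMap.fst ℝ _ _).comp (ContinuousLinearMap.fst ℝ _ _)).prod
    ((ContinuousLinearMap.snd ℝ _ _).comp (ContinuousLinearMap.fst ℝ _ _) +
      ContinuousLinearMap.snd ℝ _ _)

/-- `((x, ξ), z) ↦ (x, x + z)`. -/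
def mapG (d : ℕ) : (Space d × Space d) × Space d →L[ℝ] Space d × Space d :=
  ((ContinuousLinearMap.fst ℝ _ _).comp (ContinuousLinearMap.fst ℝ _ _)).prod
    ((ContinuousLinearMap.fst ℝ _ _).comp (ContinuousLinearMap.fst ℝ _ _) +
      ContinuousLinearMap.snd ℝ _ _)

/-- `((x, ξ), z) ↦ (x + z, ξ)`. -/
def mapB (d : ℕ) : (Space d × Space d) × Space d →L[ℝ] Space d × Space d :=
  ContinuousLinearMap.prod
    (((ContinuousLinearMap.fst ℝ (Space d) (Space d)).comp
      (ContinuousLinearMap.fst ℝ (Space d × Space d) (Space d)) +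
        ContinuousLinearMap.snd ℝ (Space d × Space d) (Space d) :
          (Space d × Space d) × Space d →L[ℝ] Space d))
    ((ContinuousLinearMap.snd ℝ (Space d) (Space d)).comp
      (ContinuousLinearMap.fst ℝ (Space d × Space d) (Space d)))

lemma mapU_apply (x : (Space d × Space d) × Space d) : mapU d x = (x.1.1, x.1.2 + x.2) := rfl
lemma mapG_apply (x : (Space d × Space d) × Space d) : mapG d x = (x.1.1, x.1.1 + x.2) := rfl
lemma mapB_apply (x : (Space d × Space d) × Space d) : mapB d x = (x.1.1 + x.2, x.1.2) := rfl

end Maps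

/-- The amplitude `a(x, ξ + θ)`. -/
def ampU (a : Space d × Space d → ℂ) : (Space d × Space d) × Space d → ℂ := fun x => a (mapU d x)

/-- The amplitude `G(x, x + z) b(x + z, ξ)`. -/
def ampV (G : Space d × Space d → ℝ) (b : Space d × Space d → ℂ) :
    (Space d × Space d) × Space d → ℂ := fun x => G (mapG d x) • b (mapB d x)

/-- The composition integral
`∬ a(x, ξ + θ) G(x, x + z) b(x + z, ξ) e^{-2πi z·θ} dz dθ`. -/
def J (a : Space d × Space d → ℂ) (G : Space d × Space d → ℝ) (b : Space d × Space d → ℂ) :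
    Space d × Space d → ℂ := ppair (ampU a) (ampV G b)

/-- Smooth functions whose derivatives are of polynomial growth in the covector. -/
structure IsModerate (a : Space d × Space d → ℂ) : Prop where
  smooth : ContDiff ℝ ∞ a
  bound : ∀ k : ℕ, ∃ (C : ℝ) (M : ℕ), 0 ≤ C ∧ ∀ p, ‖iteratedFDeriv ℝ k a p‖ ≤ C * (1 + ‖p.2‖) ^ M

lemma IsSymbol.isModerate {X : AdaptedFrame D} {m n : ℝ} {a : Space d × Space d → ℂ}
    (h : IsSymbol X m n a) : IsModerate a := ⟨h.smooth, h.norm_iteratedFDeriv_le_pow⟩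

namespace IsModerate

lemma add {a b : Space d × Space d → ℂ} (ha : IsModerate a) (hb : IsModerate b) :
    IsModerate fun p => a p + b p := by
  refine ⟨ha.smooth.add hb.smooth, fun k => ?_⟩
  obtain ⟨C, M, h0, hC⟩ := ha.bound k
  obtain ⟨C', M', h0', hC'⟩ := hb.bound k
  refine ⟨C + C', max M M', by positivity, fun p => ?_⟩
  rw [fun_iteratedFDeriv_add_apply (ha.smooth.contDiffAt.of_le (by exact_mod_cast le_top))
    (hb.smooth.contDiffAt.of_le (by exact_mod_cast le_top)), add_mul]
  have h1 : (1 : ℝ) ≤ 1 + ‖p.2‖ := le_add_of_nonneg_right (norm_nonneg _)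
  refine norm_add_le_of_le ((hC p).trans ?_) ((hC' p).trans ?_)
  · exact mul_le_mul_of_nonneg_left (pow_le_pow_right₀ h1 (le_max_left _ _)) h0
  · exact mul_le_mul_of_nonneg_left (pow_le_pow_right₀ h1 (le_max_right _ _)) h0'

lemma zero : IsModerate (fun _ : Space d × Space d => (0 : ℂ)) :=
  ⟨contDiff_const, fun k => ⟨0, 0, le_rfl, fun p => by
    rw [show iteratedFDeriv ℝ k (fun _ : Space d × Space d => (0 : ℂ)) = 0 from
      iteratedFDeriv_fun_zero]
    simp⟩⟩

lemma sum {ι : Type*} {s : Finset ι} {a : ι → Space d × Space d → ℂ}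
    (ha : ∀ i, IsModerate (a i)) : IsModerate fun p => ∑ i ∈ s, a i p := by
  classical
  induction s using Finset.induction_on with
  | empty => simpa using zero
  | insert i s hi ih =>
    simp only [Finset.sum_insert hi]
    exact (ha i).add ih

variable {a b : Space d × Space d → ℂ}

lemma norm_le (ha : IsModerate a) : ∃ (C : ℝ) (M : ℕ), 0 ≤ C ∧ ∀ p, ‖a p‖ ≤ C * (1 + ‖p.2‖) ^ M := by
  simpa using ha.bound 0

lemma dir (ha : IsModerate a) (e : Space d × Space d) : IsModerate (dir e a) := by
  have h1 : ContDiff ℝ ∞ (fderiv ℝ a) := ha.smooth.fderiv_right (by simp)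
  refine ⟨contDiff_dir ha.smooth e, fun k => ?_⟩
  obtain ⟨C, M, h0, hC⟩ := ha.bound (k + 1)
  let T : (Space d × Space d →L[ℝ] ℂ) →L[ℝ] ℂ := ContinuousLinearMap.apply ℝ ℂ e
  refine ⟨‖T‖ * C, M, by positivity, fun p => ?_⟩
  refine (T.norm_iteratedFDeriv_comp_left (f := fderiv ℝ a) (x := p)
    (h1.contDiffAt.of_le (m := k) (by exact_mod_cast le_top)) le_rfl).trans ?_
  rw [norm_iteratedFDeriv_fderiv, mul_assoc]
  exact mul_le_mul_of_nonneg_left (hC p) (norm_nonneg _)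

lemma locPoly_ampU (ha : IsModerate a) : LocPoly (ampU a) := by
  intro R
  obtain ⟨C, M, h0, hC⟩ := ha.norm_le
  refine ⟨C * (1 + |R|) ^ M, M, by positivity, fun p hp θ => (hC _).trans ?_⟩
  rw [mul_assoc, ← mul_pow]
  have h1 : ‖p.2 + θ‖ ≤ |R| + ‖θ‖ :=
    (norm_add_le _ _).trans (add_le_add_left (((norm_snd_le p).trans hp).trans (le_abs_self R)) _)
  simp only [mapU_apply]
  have h2 : 1 + ‖p.2 + θ‖ ≤ (1 + |R|) * (1 + ‖θ‖) := by
    nlinarith [mul_nonneg (abs_nonneg R) (norm_nonneg θ)]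
  gcongr

lemma contDiff_ampU (ha : IsModerate a) : ContDiff ℝ ∞ (ampU a) :=
  ha.smooth.comp (mapU d).contDiff

lemma dir_ampU (ha : IsModerate a) (e : Space d × Space d) :
    MixedSymbol.dir (e, (0 : Space d)) (ampU a) = ampU (MixedSymbol.dir e a) := by
  have h : mapU d (e, 0) = e := by simp [mapU_apply]
  have := dir_comp_clm ha.smooth.diff (mapU d) (e, 0)
  rw [h] at this
  exact this

lemma dir_ampU_right (ha : IsModerate a) (e : Space d) :
    MixedSymbol.dir ((0 : Space d × Space d), e) (ampU a) = ampU (MixedSymbol.dir (0, e) a) := by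
  have h : mapU d (0, e) = (0, e) := by simp [mapU_apply]
  have := dir_comp_clm ha.smooth.diff (mapU d) (0, e)
  rw [h] at this
  exact this

/-- The decay in z comes from the kernel alone. The growth of b is in ξ, which is a parameter and
stays bounded locally. -/
lemma locDecay_ampV {G : Space d × Space d → ℝ} (hG : IsKernel (d + 3) G) (hb : IsModerate b) :
    LocDecay (ampV G b) := by
  intro R
  have h1 := hG.comp_clm (mapG d)
  have h2 : DerivBound {p : Space d × Space d | ‖p.2‖ ≤ R} (fun _ => 1) b := by
    refine DerivBound.of_bound (fun _ _ => zero_le_one) hb.smooth fun k => ?_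
    obtain ⟨C, M, h0, hC⟩ := hb.bound k
    refine ⟨C * (1 + |R|) ^ M, fun p hp => (hC p).trans ?_⟩
    rw [mul_one]
    have : ‖p.2‖ ≤ |R| := le_trans hp (le_abs_self R)
    gcongr
  have h3 := (h1.mono_set (Set.subset_univ (mapB d ⁻¹' {p | ‖p.2‖ ≤ R}))).smul
    (h2.comp_clm (mapB d))
  refine DerivBound.mono (c := 1) (h3.mono_set ?_) zero_le_one ?_
  · intro x hx
    change ‖x.1.2‖ ≤ R
    exact (norm_snd_le x.1).trans hx
  · intro x _
    simp [mapG_apply]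

lemma dir_ampV {G : Space d × Space d → ℝ} (hG : IsKernel (d + 3) G) (hb : IsModerate b)
    (e : Space d × Space d) :
    MixedSymbol.dir (e, (0 : Space d)) (ampV G b) = fun x =>
      ampV (MixedSymbol.dir (e.1, e.1) G) b x + ampV G (MixedSymbol.dir e b) x := by
  have h1 : mapG d (e, 0) = (e.1, e.1) := by simp [mapG_apply]
  have h2 : mapB d (e, 0) = e := by simp [mapB_apply]
  have e1 := dir_comp_clm hG.smooth.diff (mapG d) (e, 0)
  have e2 := dir_comp_clm hb.smooth.diff (mapB d) (e, 0)
  rw [h1] at e1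
  rw [h2] at e2
  unfold ampV
  rw [dir_smul (c := fun x => G (mapG d x)) (hG.smooth.comp (mapG d).contDiff).diff
    (a := fun x => b (mapB d x)) (hb.smooth.comp (mapB d).contDiff).diff, e1, e2]

lemma dir_ampV_right {G : Space d × Space d → ℝ} (hG : IsKernel (d + 3) G) (hb : IsModerate b)
    (e : Space d) :
    MixedSymbol.dir ((0 : Space d × Space d), e) (ampV G b) = fun x =>
      ampV (MixedSymbol.dir (0, e) G) b x + ampV G (MixedSymbol.dir (e, 0) b) x := by
  have h1 : mapG d (0, e) = (0, e) := by simp [mapG_apply]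
  have h2 : mapB d (0, e) = (e, 0) := by simp [mapB_apply]
  have e1 := dir_comp_clm hG.smooth.diff (mapG d) (0, e)
  have e2 := dir_comp_clm hb.smooth.diff (mapB d) (0, e)
  rw [h1] at e1
  rw [h2] at e2
  unfold ampV
  rw [dir_smul (c := fun x => G (mapG d x)) (hG.smooth.comp (mapG d).contDiff).diff
    (a := fun x => b (mapB d x)) (hb.smooth.comp (mapB d).contDiff).diff, e1, e2]

end IsModerate

section Pair

lemma fourier_add_of_isDecay {v v' : Space d → ℂ} (hv : IsDecay v) (hv' : IsDecay v')
    (θ : Space d) : 𝓕 (fun z => v z + v' z) θ = 𝓕 v θ + 𝓕 v' θ := by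
  rw [Real.fourier_eq, Real.fourier_eq, Real.fourier_eq, ← integral_add
    ((Real.fourierIntegral_convergent_iff θ).2 hv.integrable)
    ((Real.fourierIntegral_convergent_iff θ).2 hv'.integrable)]
  simp only [smul_add]

lemma pair_add_right {u v v' : Space d → ℂ} (hu : PolyBdd u) (hc : Continuous u) (hv : IsDecay v)
    (hv' : IsDecay v') : pair u (fun z => v z + v' z) = pair u v + pair u v' := by
  unfold pair
  rw [← integral_add (hu.integrable_mul_fourier hc hv) (hu.integrable_mul_fourier hc hv')]
  refine integral_congr_ae (Filter.Eventually.of_forall fun θ => ?_)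
  simp only [fourier_add_of_isDecay hv hv' θ, mul_add]

lemma pair_add_left {u u' v : Space d → ℂ} (hu : PolyBdd u) (hc : Continuous u)
    (hu' : PolyBdd u') (hc' : Continuous u') (hv : IsDecay v) :
    pair (fun z => u z + u' z) v = pair u v + pair u' v := by
  unfold pair
  rw [← integral_add (hu.integrable_mul_fourier hc hv) (hu'.integrable_mul_fourier hc' hv)]
  simp only [add_mul]

lemma pair_const_mul_left (z : ℂ) (u v : Space d → ℂ) :
    pair (fun θ => z * u θ) v = z * pair u v := by
  unfold pair
  rw [← integral_const_mul]
  simp only [mul_assoc]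

lemma fourier_const_mul (z : ℂ) (v : Space d → ℂ) (θ : Space d) :
    𝓕 (fun x => z * v x) θ = z * 𝓕 v θ := by
  rw [Real.fourier_eq, Real.fourier_eq, ← integral_const_mul]
  refine integral_congr_ae (Filter.Eventually.of_forall fun x => ?_)
  simp only [Circle.smul_def, smul_eq_mul]
  ring

lemma pair_const_mul_right (z : ℂ) (u v : Space d → ℂ) :
    pair u (fun x => z * v x) = z * pair u v := by
  unfold pair
  rw [← integral_const_mul]
  refine integral_congr_ae (Filter.Eventually.of_forall fun θ => ?_)
  simp only [fourier_const_mul]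
  ring

lemma pair_inner_mul_left {u v : Space d → ℂ} (e : Space d) (hv : IsDecay v) :
    pair (fun θ => (inner ℝ e θ : ℝ) * u θ) v =
      (2 * Real.pi * Complex.I)⁻¹ * pair u (dir e v) := by
  unfold pair
  rw [← integral_const_mul]
  refine integral_congr_ae (Filter.Eventually.of_forall fun θ => ?_)
  simp only [hv.fourier_dir e θ]
  have : (2 * Real.pi * Complex.I : ℂ) ≠ 0 := Complex.two_pi_I_ne_zero
  field_simp

end Pair

section JCalculus

variable {a a' b b' : Space d × Space d → ℂ} {G G' : Space d × Space d → ℝ}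

lemma J_add_left (ha : IsModerate a) (ha' : IsModerate a') (hG : IsKernel (d + 3) G) (hb : IsModerate b)
    (p : Space d × Space d) : J (fun q => a q + a' q) G b p = J a G b p + J a' G b p :=
  pair_add_left (ha.locPoly_ampU.slice p)
    (ha.contDiff_ampU.continuous.comp (Continuous.prodMk_right p)) (ha'.locPoly_ampU.slice p)
    (ha'.contDiff_ampU.continuous.comp (Continuous.prodMk_right p))
    ((IsModerate.locDecay_ampV hG hb).slice p)

lemma J_congr_slice {v : Space d → ℂ} {p : Space d × Space d}
    (h : ∀ z, ampV G b (p, z) = v z) : J a G b p = pair (fun θ => ampU a (p, θ)) v := by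
  unfold J ppair
  congr 1
  exact funext h

lemma J_add_right (ha : IsModerate a) (hG : IsKernel (d + 3) G) (hb : IsModerate b) (hb' : IsModerate b')
    (p : Space d × Space d) : J a G (fun q => b q + b' q) p = J a G b p + J a G b' p := by
  rw [J_congr_slice (v := fun z => ampV G b (p, z) + ampV G b' (p, z))
    fun z => by simp [ampV]]
  exact pair_add_right (ha.locPoly_ampU.slice p)
    (ha.contDiff_ampU.continuous.comp (Continuous.prodMk_right p))
    ((IsModerate.locDecay_ampV hG hb).slice p) ((IsModerate.locDecay_ampV hG hb').slice p)

lemma J_add_mid (ha : IsModerate a) (hG : IsKernel (d + 3) G) (hG' : IsKernel (d + 3) G') (hb : IsModerate b)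
    (p : Space d × Space d) : J a (fun q => G q + G' q) b p = J a G b p + J a G' b p := by
  rw [J_congr_slice (v := fun z => ampV G b (p, z) + ampV G' b (p, z))
    fun z => by simp [ampV, add_mul]]
  exact pair_add_right (ha.locPoly_ampU.slice p)
    (ha.contDiff_ampU.continuous.comp (Continuous.prodMk_right p))
    ((IsModerate.locDecay_ampV hG hb).slice p) ((IsModerate.locDecay_ampV hG' hb).slice p)

lemma J_smul_left (c : Space d → ℝ) (p : Space d × Space d) :
    J (fun q => c q.1 • a q) G b p = c p.1 • J a G b p := by
  rw [Complex.real_smul]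
  exact pair_const_mul_left (c p.1 : ℂ) (fun θ => ampU a (p, θ)) fun z => ampV G b (p, z)

lemma J_const_mul_left (z : ℂ) (p : Space d × Space d) :
    J (fun q => z * a q) G b p = z * J a G b p := pair_const_mul_left _ _ _

lemma J_const_mul_right (z : ℂ) (p : Space d × Space d) :
    J a G (fun q => z * b q) p = z * J a G b p := by
  rw [J_congr_slice (v := fun x => z * ampV G b (p, x)) fun x => by simp [ampV]; ring]
  exact pair_const_mul_right _ _ _

lemma J_coord_right (l : Fin (d + 1)) (p : Space d × Space d) :
    J a G (fun q => ((q.2 l : ℝ) : ℂ) * b q) p = ((p.2 l : ℝ) : ℂ) * J a G b p := by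
  rw [J_congr_slice (v := fun x => ((p.2 l : ℝ) : ℂ) * ampV G b (p, x))
    fun x => by simp [ampV, mapB_apply]; ring]
  exact pair_const_mul_right _ _ _

lemma J_smul_mid_fst (c : Space d → ℝ) (p : Space d × Space d) :
    J a (fun q => c q.1 * G q) b p = c p.1 • J a G b p := by
  rw [J_congr_slice (v := fun x => (c p.1 : ℂ) * ampV G b (p, x))
    fun x => by simp [ampV, mapG_apply]; ring, Complex.real_smul]
  exact pair_const_mul_right _ _ _

/-- The second kernel variable y = x + z is the base point of b, so a function of y can be moved
freely between G and b. -/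
lemma J_smul_mid_snd (c : Space d → ℝ) :
    J a (fun q => c q.2 * G q) b = J a G (fun q => c q.1 • b q) := by
  funext p
  unfold J ppair
  congr 1
  funext z
  simp [ampV, mapG_apply, mapB_apply]
  ring

lemma PolyBdd.inner_mul {u : Space d → ℂ} (hu : PolyBdd u) (e : Space d) :
    PolyBdd fun θ => ((inner ℝ e θ : ℝ) : ℂ) * u θ := by
  obtain ⟨C, M, h0, hC⟩ := hu
  refine ⟨‖e‖ * C, M + 1, by positivity, fun θ => ?_⟩
  rw [norm_mul, Complex.norm_real, pow_succ]
  calc _ ≤ (‖e‖ * (1 + ‖θ‖)) * (C * (1 + ‖θ‖) ^ M) := by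
        refine mul_le_mul ((norm_inner_le_norm e θ).trans ?_) (hC θ) (norm_nonneg _)
          (by positivity)
        gcongr
        linarith
    _ = _ := by ring

/-- A coordinate of the covector in the left factor. -/
lemma J_coord_left (l : Fin (d + 1)) (ha : IsModerate a) (hG : IsKernel (d + 3) G) (hb : IsModerate b)
    (p : Space d × Space d) :
    J (fun q => ((q.2 l : ℝ) : ℂ) * a q) G b p = ((p.2 l : ℝ) : ℂ) * J a G b p +
      (2 * Real.pi * Complex.I)⁻¹ * (J a (dir (0, EuclideanSpace.single l 1) G) b p +
        J a G (dir (EuclideanSpace.single l 1, 0) b) p) := by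
  have hv := (IsModerate.locDecay_ampV hG hb).slice p
  have hu := ha.locPoly_ampU.slice p
  have hcu : Continuous fun θ => ampU a (p, θ) :=
    ha.contDiff_ampU.continuous.comp (Continuous.prodMk_right p)
  -- The coordinate seen by a is ξ_l + θ_l. The first summand is constant in the integration; the
  -- second multiplies the Fourier transform and is therefore a z-derivative, falling on G or on b.
  have e1 : J (fun q => ((q.2 l : ℝ) : ℂ) * a q) G b p = pair (fun θ =>
      ((p.2 l : ℝ) : ℂ) * ampU a (p, θ) +
        ((inner ℝ (EuclideanSpace.single l (1 : ℝ)) θ : ℝ) : ℂ) * ampU a (p, θ))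
      (fun z => ampV G b (p, z)) := by
    unfold J ppair
    congr 1
    funext θ
    simp [ampU, mapU_apply, EuclideanSpace.inner_single_left, add_mul]
  have hcu1 : PolyBdd fun θ => ((p.2 l : ℝ) : ℂ) * ampU a (p, θ) := by
    obtain ⟨C, M, h0, hC⟩ := hu
    refine ⟨‖((p.2 l : ℝ) : ℂ)‖ * C, M, by positivity, fun θ => ?_⟩
    rw [norm_mul, mul_assoc]
    exact mul_le_mul_of_nonneg_left (hC θ) (norm_nonneg _)
  rw [e1, pair_add_left hcu1 (continuous_const.mul hcu) (hu.inner_mul _)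
    ((Complex.continuous_ofReal.comp (continuous_const.inner continuous_id)).mul hcu) hv,
    pair_const_mul_left, pair_inner_mul_left _ hv]
  congr 2
  have e2 : dir (EuclideanSpace.single l 1) (fun z => ampV G b (p, z)) = fun z =>
      ampV (dir (0, EuclideanSpace.single l 1) G) b (p, z) +
        ampV G (dir (EuclideanSpace.single l 1, 0) b) (p, z) := by
    funext z
    rw [dir_slice_right (IsModerate.locDecay_ampV hG hb).contDiff.diff,
      IsModerate.dir_ampV_right hG hb]
  rw [e2]
  exact pair_add_right hu hcu ((IsModerate.locDecay_ampV (hG.dir _) hb).slice p)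
    ((IsModerate.locDecay_ampV hG (hb.dir _)).slice p)

/-- A factor `y_r - x_r` in the kernel. -/
lemma J_kernel_coord (r : Fin (d + 1)) (ha : IsModerate a) (hG : IsKernel (d + 4) G)
    (hb : IsModerate b) (p : Space d × Space d) :
    J a (fun q => (q.2 r - q.1 r) * G q) b p =
      (2 * Real.pi * Complex.I)⁻¹ * J (dir (0, EuclideanSpace.single r 1) a) G b p := by
  have e1 : ∀ z, ampV (fun q => (q.2 r - q.1 r) * G q) b (p, z) =
      (inner ℝ (EuclideanSpace.single r (1 : ℝ)) z : ℝ) • ampV G b (p, z) := by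
    intro z
    simp [ampV, mapG_apply, EuclideanSpace.inner_single_left, mul_assoc]
  -- The factor y_r - x_r consumes one power of kernel decay, so the assumed d + 4 leaves exactly
  -- the d + 3 needed.
  have hv' := (IsModerate.locDecay_ampV (hG.coord_mul r) hb).slice p
  simp only [e1] at hv'
  have e2 : (fun θ => ampU (dir (0, EuclideanSpace.single r 1) a) (p, θ)) =
      dir (EuclideanSpace.single r 1) fun θ => ampU a (p, θ) := by
    funext θ
    rw [dir_slice_right ha.contDiff_ampU.diff, ha.dir_ampU_right]
  rw [J_congr_slice e1, pair_inner_smul _ (ha.locPoly_ampU.slice p)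
    (ha.contDiff_ampU.comp (contDiff_prodMk_right p)) _
    ((IsModerate.locDecay_ampV (hG.weaken (by omega)) hb).slice p) hv', ← e2]
  · rfl
  · rw [← e2]
    exact (ha.dir _).locPoly_ampU.slice p

lemma J_differentiable (ha : IsModerate a) (hG : IsKernel (d + 3) G) (hb : IsModerate b) :
    Differentiable ℝ (J a G b) ∧ ∀ e p, dir e (J a G b) p =
      J (dir e a) G b p + J a (dir (e.1, e.1) G) b p + J a G (dir e b) p := by
  have h := ppair_differentiable ha.contDiff_ampU.diff ha.locPoly_ampU
    (fun e => by rw [ha.dir_ampU]; exact (ha.dir e).locPoly_ampU) (IsModerate.locDecay_ampV hG hb)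
  refine ⟨h.1, fun e p => (h.2 e p).trans ?_⟩
  rw [ha.dir_ampU, IsModerate.dir_ampV hG hb, add_assoc]
  congr 1
  exact pair_add_right (ha.locPoly_ampU.slice p)
    (ha.contDiff_ampU.continuous.comp (Continuous.prodMk_right p))
    ((IsModerate.locDecay_ampV (hG.dir _) hb).slice p)
    ((IsModerate.locDecay_ampV hG (hb.dir _)).slice p)

lemma J_zero_mid (p : Space d × Space d) : J a (fun _ => 0) b p = 0 := by
  simpa using J_smul_mid_fst (a := a) (b := b) (G := fun _ => 0) (fun _ => 0) p

lemma J_zero_left (p : Space d × Space d) : J (fun _ => 0) G b p = 0 := by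
  simpa using J_const_mul_left (a := fun _ => 0) (b := b) (G := G) 0 p

lemma J_zero_right (p : Space d × Space d) : J a G (fun _ => 0) p = 0 := by
  simpa using J_const_mul_right (a := a) (b := fun _ => 0) (G := G) 0 p

variable {ι : Type*} {s : Finset ι}

lemma J_sum_left {f : ι → Space d × Space d → ℂ} (hf : ∀ i, IsModerate (f i))
    (hG : IsKernel (d + 3) G) (hb : IsModerate b) (p : Space d × Space d) :
    J (fun q => ∑ i ∈ s, f i q) G b p = ∑ i ∈ s, J (f i) G b p := by
  classical
  induction s using Finset.induction_on with
  | empty => simpa using J_zero_left p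
  | insert i s hi ih =>
    simp only [Finset.sum_insert hi]
    rw [J_add_left (hf i) (.sum hf) hG hb, ih]

lemma J_sum_right {f : ι → Space d × Space d → ℂ} (ha : IsModerate a)
    (hG : IsKernel (d + 3) G) (hf : ∀ i, IsModerate (f i)) (p : Space d × Space d) :
    J a G (fun q => ∑ i ∈ s, f i q) p = ∑ i ∈ s, J a G (f i) p := by
  classical
  induction s using Finset.induction_on with
  | empty => simpa using J_zero_right p
  | insert i s hi ih =>
    simp only [Finset.sum_insert hi]
    rw [J_add_right ha hG (hf i) (.sum hf), ih]

lemma J_sum_mid {f : ι → Space d × Space d → ℝ} (ha : IsModerate a)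
    (hf : ∀ i, IsKernel (d + 3) (f i)) (hb : IsModerate b) (p : Space d × Space d) :
    J a (fun q => ∑ i ∈ s, f i q) b p = ∑ i ∈ s, J a (f i) b p := by
  classical
  induction s using Finset.induction_on with
  | empty => simpa using J_zero_mid p
  | insert i s hi ih =>
    simp only [Finset.sum_insert hi]
    rw [J_add_mid ha (hf i) (DerivBound.sum (fun _ _ => (decay_pos _ _).le) fun i _ => hf i) hb, ih]

/-- Commuting a function of the base point through the composition integral. -/
lemma J_base_smul (ha : IsModerate a) (hG : IsKernel (d + 4) G) (hb : IsModerate b)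
    {c : Space d → ℝ} (hc : IsCb c) {H : Fin (d + 1) → Space d × Space d → ℝ}
    (hH : ∀ r, IsCb (H r)) (hcH : ∀ x y, c y - c x = ∑ r, (y r - x r) * H r (x, y))
    (p : Space d × Space d) :
    c p.1 • J a G b p = J a G (fun q => c q.1 • b q) p + ∑ r, (-(2 * Real.pi * Complex.I)⁻¹) *
      J (dir (0, EuclideanSpace.single r 1) a) (fun q => H r q * G q) b p := by
  have hG3 : IsKernel (d + 3) G := hG.weaken (by omega)
  have hk : ∀ r, IsKernel (d + 4) (fun q => H r q * G q) := fun r => IsKernel.mul (hH r) hG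
  have hc1 : IsCb fun q : Space d × Space d => c q.1 :=
    hc.comp_clm (ContinuousLinearMap.fst ℝ (Space d) (Space d))
  -- Replace c(y) by c(x) inside the kernel at the price of Hadamard's remainder; each factor y_r -
  -- x_r in it then turns into ∂/∂ξ_r on a.
  have e1 : (fun q : Space d × Space d => c q.2 * G q) = fun q => c q.1 * G q +
      ∑ r, (q.2 r - q.1 r) * (H r q * G q) := by
    funext q
    have := hcH q.1 q.2
    simp only [← mul_assoc, ← Finset.sum_mul]
    rw [← this]
    ring
  rw [← J_smul_mid_snd, e1, J_add_mid ha (IsKernel.mul hc1 hG3) (DerivBound.sum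
    (fun _ _ => (decay_pos _ _).le) fun r _ => (hk r).coord_mul r) hb, J_smul_mid_fst,
    J_sum_mid ha (fun r => (hk r).coord_mul r) hb, add_assoc, ← Finset.sum_add_distrib,
    Finset.sum_eq_zero, add_zero]
  intro r _
  rw [J_kernel_coord r ha (hk r) hb]
  ring

end JCalculus

end MixedSymbol
end
-- Cutoffs and the size estimate for J
noncomputable section
namespace MixedSymbol

open MeasureTheory

variable {d : ℕ} {D : Space d → Submodule ℝ (Space d)}

section Cutoff

/-- A smooth bump function, equal to `1` near the origin. -/
def bump (d : ℕ) : ContDiffBump (0 : Space d) := ⟨1, 2, one_pos, one_lt_two⟩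

/-- A smooth cutoff function, equal to `1` near the origin. -/
def cutoff : Space d → ℝ := bump d

/-- The sum of the `2K`-th powers of the coordinates. -/
def powSum (K : ℕ) (z : Space d) : ℝ := ∑ j, z j ^ (2 * K)

/-- The function with `1 = cutoff z + powSum K z * tail K z`. -/
def tail (K : ℕ) (z : Space d) : ℝ := (1 - cutoff z) / powSum K z

lemma contDiff_cutoff : ContDiff ℝ ∞ (cutoff : Space d → ℝ) := (bump d).contDiff

lemma cutoff_eq_one {z : Space d} (hz : ‖z‖ ≤ 1) : cutoff z = 1 :=
  (bump d).one_of_mem_closedBall (by simpa [bump] using hz)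

lemma cutoff_eq_zero {z : Space d} (hz : 2 ≤ ‖z‖) : cutoff z = 0 :=
  (bump d).zero_of_le_dist (by simpa [bump] using hz)

lemma iteratedFDeriv_cutoff_eq_zero {z : Space d} (hz : 2 < ‖z‖) (k : ℕ) :
    iteratedFDeriv ℝ k cutoff z = 0 := by
  have h := support_iteratedFDeriv_subset (𝕜 := ℝ) (f := (cutoff : Space d → ℝ)) k
  by_contra hne
  have h2 : z ∈ Metric.closedBall (0 : Space d) 2 := by
    have h3 := h hne
    rwa [show tsupport (cutoff : Space d → ℝ) = Metric.closedBall 0 2 from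
      (bump d).tsupport_eq] at h3
  rw [mem_closedBall_zero_iff] at h2
  linarith

lemma exists_bound_closedBall {F : Type*} [NormedAddCommGroup F] [NormedSpace ℝ F]
    {f : Space d → F} (hf : ContDiff ℝ ∞ f) (k : ℕ) (R : ℝ) :
    ∃ C : ℝ, 0 ≤ C ∧ ∀ z, ‖z‖ ≤ R → ‖iteratedFDeriv ℝ k f z‖ ≤ C := by
  obtain ⟨C, hC⟩ := (isCompact_closedBall (0 : Space d) R).exists_bound_of_continuousOn
    (hf.continuous_iteratedFDeriv (m := k) (by exact_mod_cast le_top)).continuousOn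
  exact ⟨max C 0, le_max_right _ _, fun z hz =>
    (hC z (mem_closedBall_zero_iff.2 hz)).trans (le_max_left _ _)⟩

lemma decay_ball {z : Space d} {R : ℝ} (hz : ‖z‖ ≤ R) (q : ℕ) : 1 ≤ (1 + R) ^ q * decay q z := by
  unfold decay
  rw [← div_eq_mul_inv, one_le_div (by positivity)]
  gcongr

lemma derivBound_cutoff (q : ℕ) : DerivBound Set.univ (decay q) (cutoff : Space d → ℝ) := by
  refine DerivBound.of_bound (fun _ _ => (decay_pos _ _).le) contDiff_cutoff fun k => ?_
  obtain ⟨C, h0, hC⟩ := exists_bound_closedBall (d := d) contDiff_cutoff k 2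
  refine ⟨C * (1 + 2) ^ q, fun z _ => ?_⟩
  rcases le_or_gt ‖z‖ 2 with hz | hz
  · rw [mul_assoc]
    exact (hC z hz).trans (le_mul_of_one_le_right h0 (decay_ball hz q))
  · rw [iteratedFDeriv_cutoff_eq_zero hz, norm_zero]
    have := (decay_pos q z).le
    positivity

lemma powSum_pos (K : ℕ) {z : Space d} (hz : z ≠ 0) : 0 < powSum K z := by
  obtain ⟨j, hj⟩ : ∃ j, z j ≠ 0 := by
    by_contra! h
    exact hz (by ext j; simpa using h j)
  exact Finset.sum_pos' (fun i _ => (even_two_mul K).pow_nonneg _)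
    ⟨j, Finset.mem_univ _, (even_two_mul K).pow_pos hj⟩

lemma cutoff_add_tail (K : ℕ) (z : Space d) :
    cutoff z + ∑ j, z j ^ (2 * K) * tail K z = 1 := by
  rw [← Finset.sum_mul]
  change cutoff z + powSum K z * tail K z = 1
  rcases eq_or_ne z 0 with rfl | hz
  · simp [tail, cutoff_eq_one]
  · rw [tail, mul_div_cancel₀ _ (powSum_pos K hz).ne']
    ring

lemma contDiff_tail (K : ℕ) : ContDiff ℝ ∞ (tail K : Space d → ℝ) := by
  rw [contDiff_iff_contDiffAt]
  intro z
  rcases eq_or_ne z 0 with rfl | hz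
  · refine (contDiffAt_const (c := (0 : ℝ))).congr_of_eventuallyEq ?_
    filter_upwards [Metric.ball_mem_nhds (0 : Space d) one_pos] with y hy
    rw [mem_ball_zero_iff] at hy
    simp [tail, cutoff_eq_one hy.le]
  · refine ContDiffAt.div (contDiffAt_const.sub contDiff_cutoff.contDiffAt) ?_ (powSum_pos K hz).ne'
    refine (ContDiff.sum fun j _ => ContDiff.pow ?_ _).contDiffAt
    exact (EuclideanSpace.proj (𝕜 := ℝ) j : Space d →L[ℝ] ℝ).contDiff

/-- Where the cutoff vanishes, the tail is 1 / `powSum`, homogeneous of degree -2K. -/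
lemma tail_scale (K : ℕ) {t : ℝ} (ht : 1 ≤ t) {z : Space d} (hz : 2 * t ≤ ‖z‖) :
    tail K z = (t⁻¹) ^ (2 * K) * tail K (t⁻¹ • z) := by
  have ht0 : 0 < t := by linarith
  have h1 : 2 ≤ ‖t⁻¹ • z‖ := by
    rw [norm_smul, Real.norm_of_nonneg (by positivity), le_inv_mul_iff₀ ht0]
    linarith
  have hp : powSum K (t⁻¹ • z) = (t⁻¹) ^ (2 * K) * powSum K z := by
    simp [powSum, mul_pow, Finset.mul_sum]
  rw [tail, tail, cutoff_eq_zero h1, cutoff_eq_zero (by linarith), hp]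
  have : (t⁻¹) ^ (2 * K) ≠ 0 := by positivity
  rw [mul_div_assoc', mul_div_mul_left _ _ this]

lemma derivBound_tail (K : ℕ) : DerivBound Set.univ (decay (2 * K)) (tail K : Space d → ℝ) := by
  refine DerivBound.of_bound (fun _ _ => (decay_pos _ _).le) (contDiff_tail K) fun k => ?_
  obtain ⟨C, h0, hC⟩ := exists_bound_closedBall (d := d) (contDiff_tail K) k 4
  refine ⟨C * 8 ^ (2 * K), fun z _ => ?_⟩
  have hd := (decay_pos (2 * K) z).le
  rw [mul_assoc]
  rcases le_or_gt ‖z‖ 4 with hz | hz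
  · refine (hC z hz).trans (le_mul_of_one_le_right h0 ((decay_ball hz (2 * K)).trans ?_))
    gcongr
    norm_num
  -- Homogeneity brings z to the sphere of radius 4, where compactness bounds all derivatives. The
  -- value 4 leaves a neighbourhood of z inside the homogeneous region |y| > 2t, and t ≥ 1 makes the
  -- chain-rule factors harmless.
  · set t := ‖z‖ / 4 with ht
    have ht1 : 1 ≤ t := by rw [ht]; linarith
    have ht0 : 0 < t := by linarith
    have hev : tail K =ᶠ[nhds z] fun y => (t⁻¹) ^ (2 * K) • tail K (t⁻¹ • y) := by
      have : ∀ᶠ y in nhds z, 2 * t < ‖y‖ :=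
        continuous_norm.continuousAt.eventually (lt_mem_nhds (by rw [ht]; linarith))
      filter_upwards [this] with y hy
      exact tail_scale K ht1 hy.le
    rw [hev.iteratedFDeriv ℝ k |>.eq_of_nhds]
    have hs : ContDiff ℝ ∞ (fun y : Space d => tail K (t⁻¹ • y)) :=
      (contDiff_tail K).comp (contDiff_const_smul _)
    rw [iteratedFDeriv_const_smul_apply' (hs.contDiffAt.of_le (by exact_mod_cast le_top)),
      norm_smul, Real.norm_of_nonneg (by positivity)]
    let L : Space d →L[ℝ] Space d := t⁻¹ • ContinuousLinearMap.id ℝ _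
    have hL : ‖L‖ ≤ 1 := by
      refine ContinuousLinearMap.opNorm_le_bound _ zero_le_one fun y => ?_
      change ‖t⁻¹ • y‖ ≤ _
      rw [norm_smul, Real.norm_of_nonneg (by positivity)]
      exact mul_le_mul_of_nonneg_right (inv_le_one_of_one_le₀ ht1) (norm_nonneg _)
    have h3 := norm_iteratedFDeriv_comp_clm_le L (contDiff_tail K) k z
    have h4 : ‖L z‖ ≤ 4 := by
      change ‖t⁻¹ • z‖ ≤ 4
      rw [norm_smul, Real.norm_of_nonneg (by positivity), inv_mul_le_iff₀ ht0, ht]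
      linarith
    have h5 : ‖iteratedFDeriv ℝ k (fun y => tail K (t⁻¹ • y)) z‖ ≤ C :=
      h3.trans ((mul_le_mul (hC _ h4) (pow_le_one₀ (norm_nonneg _) hL) (by positivity) h0).trans
        (mul_one C).le)
    rw [mul_comm]
    refine mul_le_mul h5 ?_ (by positivity) h0
    unfold decay
    rw [← inv_pow, ← mul_pow]
    gcongr
    rw [inv_le_iff_one_le_mul₀ ht0, ht, mul_right_comm, ← div_eq_mul_inv,
      one_le_div (by positivity)]
    linarith

end Cutoff

section KernelCutoff

variable {a b : Space d × Space d → ℂ} {G : Space d × Space d → ℝ} {k : ℕ}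

lemma IsKernel.mul' {k' : ℕ} {F : Space d × Space d → ℝ} (hF : IsKernel k F) (hG : IsKernel k' G) :
    IsKernel (k + k') (fun q => F q * G q) := by
  have h := DerivBound.smul hF hG
  simp only [decay_mul] at h
  exact h

/-- The kernel `φ(s (y - x))`. -/
lemma isKernel_comp {φ : Space d → ℝ} (hφ : DerivBound Set.univ (decay k) φ) {s : ℝ} (hs : 1 ≤ s) :
    IsKernel k (fun q : Space d × Space d => φ (s • (q.2 - q.1))) := by
  let L : Space d × Space d →L[ℝ] Space d :=
    s • (ContinuousLinearMap.snd ℝ (Space d) (Space d) - ContinuousLinearMap.fst ℝ _ _)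
  refine DerivBound.mono (c := 1) (hφ.comp_clm L) zero_le_one fun q _ => ?_
  rw [one_mul]
  change decay k (s • (q.2 - q.1)) ≤ _
  unfold decay
  rw [norm_smul, Real.norm_of_nonneg (by linarith)]
  gcongr
  exact le_mul_of_one_le_left (norm_nonneg _) hs

lemma IsKernel.coord_pow_mul (r : Fin (d + 1)) (n : ℕ) (hG : IsKernel (k + n) G) :
    IsKernel k (fun q => (q.2 r - q.1 r) ^ n * G q) := by
  induction n generalizing k with
  | zero => simpa using hG
  | succ n ih =>
    have h := ih (k := k + 1) (by rwa [add_assoc, add_comm 1 n])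
    simpa only [pow_succ', mul_assoc] using h.coord_mul r

lemma J_kernel_coord_pow (r : Fin (d + 1)) (n : ℕ) (ha : IsModerate a)
    (hG : IsKernel (d + 3 + n) G) (hb : IsModerate b) (p : Space d × Space d) :
    J a (fun q => (q.2 r - q.1 r) ^ n * G q) b p =
      ((2 * Real.pi * Complex.I)⁻¹) ^ n * J ((partialXi r)^[n] a) G b p := by
  induction n generalizing a with
  | zero => simp
  | succ n ih =>
    have h1 : IsKernel (d + 4) (fun q => (q.2 r - q.1 r) ^ n * G q) :=
      IsKernel.coord_pow_mul r n (hG.weaken (by omega))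
    have e : (fun q : Space d × Space d => (q.2 r - q.1 r) ^ (n + 1) * G q) = fun q =>
        (q.2 r - q.1 r) * ((q.2 r - q.1 r) ^ n * G q) := by
      funext q; ring
    rw [e, J_kernel_coord r ha h1 hb, ih (ha.dir _) (hG.weaken (by omega)), pow_succ', ← partialXi_eq_dir,
      Function.iterate_succ_apply]
    ring

/-- Splitting of the composition integral at the scale `s⁻¹`. -/
lemma J_split (K : ℕ) {s : ℝ} (hs : 1 ≤ s) (ha : IsModerate a) (hG : IsKernel (d + 3) G)
    (hb : IsModerate b) (p : Space d × Space d) :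
    J a G b p = J a (fun q => cutoff (s • (q.2 - q.1)) * G q) b p +
      ∑ j, ((s : ℂ) * (2 * Real.pi * Complex.I)⁻¹) ^ (2 * K) *
        J ((partialXi j)^[2 * K] a) (fun q => tail K (s • (q.2 - q.1)) * G q) b p := by
  have h0 : IsKernel (d + 3) (fun q => cutoff (s • (q.2 - q.1)) * G q) :=
    (IsKernel.mul' (isKernel_comp (derivBound_cutoff 0) hs) hG).weaken (by omega)
  have h1 : IsKernel (d + 3 + 2 * K) (fun q => tail K (s • (q.2 - q.1)) * G q) :=
    (IsKernel.mul' (isKernel_comp (derivBound_tail K) hs) hG).weaken (by omega)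
  have h2 : ∀ j, IsKernel (d + 3) (fun q : Space d × Space d => s ^ (2 * K) *
      ((q.2 j - q.1 j) ^ (2 * K) * (tail K (s • (q.2 - q.1)) * G q))) := fun j =>
    DerivBound.const_smul (IsKernel.coord_pow_mul j (2 * K) h1) (s ^ (2 * K))
  -- This is the partition `cutoff_add_tail` at the point s (y - x); the powers s^{2K} are separated
  -- so that the bare coordinates can be integrated by parts.
  have e : G = fun q => cutoff (s • (q.2 - q.1)) * G q + ∑ j, s ^ (2 * K) *
      ((q.2 j - q.1 j) ^ (2 * K) * (tail K (s • (q.2 - q.1)) * G q)) := by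
    funext q
    have := cutoff_add_tail K (s • (q.2 - q.1))
    simp only [PiLp.smul_apply, PiLp.sub_apply, smul_eq_mul, mul_pow] at this
    calc G q = 1 * G q := (one_mul _).symm
      _ = _ := by
        rw [← this, add_mul, Finset.sum_mul]
        simp only [mul_assoc]
  conv_lhs => rw [e]
  rw [J_add_mid ha h0 (DerivBound.sum (fun _ _ => (decay_pos _ _).le) fun j _ => h2 j) hb,
    J_sum_mid ha h2 hb]
  congr 1
  refine Finset.sum_congr rfl fun j _ => ?_
  rw [J_smul_mid_fst (fun _ => s ^ (2 * K)), J_kernel_coord_pow j _ ha h1 hb, Complex.real_smul]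
  push_cast
  ring

end KernelCutoff

section Estimate

variable {X : AdaptedFrame D} {m n m₁ n₁ m₂ n₂ : ℝ} {a b : Space d × Space d → ℂ}
  {G : Space d × Space d → ℝ}

lemma DerivBound.bound_le {V F : Type*} [NormedAddCommGroup V] [NormedSpace ℝ V]
    [NormedAddCommGroup F] [NormedSpace ℝ F] {S : Set V} {η : V → ℝ} {f : V → F}
    (h : DerivBound S η f) (hη : ∀ x ∈ S, 0 ≤ η x) (N : ℕ) :
    ∃ C : ℝ, 0 ≤ C ∧ ∀ j ≤ N, ∀ x ∈ S, ‖iteratedFDeriv ℝ j f x‖ ≤ C * η x := by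
  choose C h0 hC using h.bound
  refine ⟨∑ j ∈ Finset.range (N + 1), C j, Finset.sum_nonneg fun j _ => h0 j, fun j hj x hx =>
    (hC j x hx).trans (mul_le_mul_of_nonneg_right ?_ (hη x hx))⟩
  exact Finset.single_le_sum (f := C) (fun j _ => h0 j) (Finset.mem_range.2 (Nat.lt_succ_of_le hj))

/-- The product rule for bounds at the scale `s`. -/
lemma norm_iteratedFDeriv_smul_scale {V F : Type*} [NormedAddCommGroup V] [NormedSpace ℝ V]
    [NormedAddCommGroup F] [NormedSpace ℝ F] {c : V → ℝ} {f : V → F} (hc : ContDiff ℝ ∞ c)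
    (hf : ContDiff ℝ ∞ f) {N : ℕ} {s A B : ℝ} {x : V}
    (hA : ∀ j ≤ N, ‖iteratedFDeriv ℝ j c x‖ ≤ A * s ^ j)
    (hB : ∀ j ≤ N, ‖iteratedFDeriv ℝ j f x‖ ≤ B * s ^ j) {j : ℕ} (hj : j ≤ N) :
    ‖iteratedFDeriv ℝ j (fun x => c x • f x) x‖ ≤ 2 ^ j * (A * B) * s ^ j := by
  refine (norm_iteratedFDeriv_smul_le hc hf x (by exact_mod_cast le_top)).trans ?_
  have e : (2 : ℝ) ^ j = ∑ i ∈ Finset.range (j + 1), (j.choose i : ℝ) := by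
    exact_mod_cast (Nat.sum_range_choose j).symm
  rw [e, Finset.sum_mul, Finset.sum_mul]
  refine Finset.sum_le_sum fun i hi => ?_
  have hi' : i ≤ j := Nat.lt_succ_iff.1 (Finset.mem_range.1 hi)
  have h1 := hA i (hi'.trans hj)
  have h2 := hB (j - i) ((Nat.sub_le _ _).trans hj)
  calc _ ≤ (j.choose i : ℝ) * (A * s ^ i) * (B * s ^ (j - i)) := by
        have := (norm_nonneg _).trans h1
        gcongr
    _ = (j.choose i : ℝ) * (A * B) * (s ^ i * s ^ (j - i)) := by ring
    _ = _ := by rw [← pow_add, Nat.add_sub_cancel' hi']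

/-- The bounds A for φ and B for the weights of b are required only at the given point z, so that
the near and the far region can use different constants. Derivatives of G are bounded and s ≥ 1, so
charging them to s loses nothing needed. -/
lemma IsSymbol.norm_iteratedFDeriv_ampV_le (hG : IsKernel (d + 3) G) (hb : IsSymbol X m n b)
    {φ : Space d → ℝ} (hφ : ContDiff ℝ ∞ φ) (N : ℕ) : ∃ C : ℝ, 0 ≤ C ∧
    ∀ (p : Space d × Space d) (z : Space d) (s A B : ℝ), 1 ≤ s →
      (∀ j ≤ N, ‖iteratedFDeriv ℝ j φ (s • z)‖ ≤ A) →
      (∀ j ≤ N, X.wt (m + j) (n - j) (p.1 + z, p.2) ≤ B * s ^ j) → ∀ j ≤ N,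
      ‖iteratedFDeriv ℝ j (fun z => ampV (fun q => φ (s • (q.2 - q.1)) * G q) b (p, z)) z‖ ≤
        C * (A * B) * s ^ j := by
  obtain ⟨CG, hG0, hCG⟩ := (hG.comp_clm (mapG d)).bound_le (fun _ _ => (decay_pos _ _).le) N
  choose Cb hb0 hCb using hb.norm_iteratedFDeriv_le
  set Cb' := ∑ j ∈ Finset.range (N + 1), Cb j with hCb'
  have hCble : ∀ j ≤ N, Cb j ≤ Cb' := fun j hj =>
    Finset.single_le_sum (f := Cb) (fun j _ => hb0 j) (Finset.mem_range.2 (Nat.lt_succ_of_le hj))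
  have hCb0 : 0 ≤ Cb' := Finset.sum_nonneg fun j _ => hb0 j
  set μ := 1 + ‖mapB d‖ with hμ
  have hμ1 : 1 ≤ μ := le_add_of_nonneg_right (norm_nonneg _)
  refine ⟨2 ^ N * (2 ^ N * (CG * (Cb' * μ ^ N))), by positivity,
    fun p z s A B hs hA hB j hj => ?_⟩
  have hs0 : 0 ≤ s := by linarith
  have hB0 : 0 ≤ B := by
    have := hB 0 (Nat.zero_le _)
    rw [pow_zero, mul_one] at this
    exact (X.wt_pos _ _ _).le.trans this
  have hA0 : 0 ≤ A := (norm_nonneg _).trans (hA 0 (Nat.zero_le _))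
  let c1 : Space d → ℝ := fun z => φ (s • z)
  let c2 : Space d → ℝ := fun z => G (mapG d (p, z))
  let f : Space d → ℂ := fun z => b (mapB d (p, z))
  have e : (fun z => ampV (fun q => φ (s • (q.2 - q.1)) * G q) b (p, z)) =
      fun z => c1 z • (c2 z • f z) := by
    funext z
    simp [ampV, c1, c2, f, mapG_apply, mul_assoc]
  have hGs : ContDiff ℝ ∞ (fun x => G (mapG d x)) := hG.smooth.comp (mapG d).contDiff
  have hbs : ContDiff ℝ ∞ (fun x => b (mapB d x)) := hb.smooth.comp (mapB d).contDiff
  have hc1 : ContDiff ℝ ∞ c1 := hφ.comp (contDiff_const_smul s)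
  have hc2 : ContDiff ℝ ∞ c2 := hGs.comp (contDiff_prodMk_right p)
  have hf : ContDiff ℝ ∞ f := hbs.comp (contDiff_prodMk_right p)
  have h1 : ∀ j ≤ N, ‖iteratedFDeriv ℝ j c1 z‖ ≤ A * s ^ j := by
    intro j hj
    let L : Space d →L[ℝ] Space d := s • ContinuousLinearMap.id ℝ _
    have hL : ‖L‖ ≤ s := by
      refine ContinuousLinearMap.opNorm_le_bound _ hs0 fun y => ?_
      change ‖s • y‖ ≤ _
      rw [norm_smul, Real.norm_of_nonneg hs0]
    refine (norm_iteratedFDeriv_comp_clm_le L hφ j z).trans ?_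
    exact mul_le_mul (hA j hj) (pow_le_pow_left₀ (norm_nonneg _) hL j) (by positivity) hA0
  have h2 : ∀ j ≤ N, ‖iteratedFDeriv ℝ j c2 z‖ ≤ CG * s ^ j := by
    intro j hj
    refine (norm_iteratedFDeriv_slice_le hGs j p z).trans ((hCG j hj (p, z) (Set.mem_univ _)).trans
      (mul_le_mul_of_nonneg_left ((decay_le_one _ _).trans (one_le_pow₀ hs)) hG0))
  have h3 : ∀ j ≤ N, ‖iteratedFDeriv ℝ j f z‖ ≤ (Cb' * μ ^ N * B) * s ^ j := by
    intro j hj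
    refine (norm_iteratedFDeriv_slice_le hbs j p z).trans
      ((norm_iteratedFDeriv_comp_clm_le (mapB d) hb.smooth j (p, z)).trans ?_)
    have h4 : ‖mapB d‖ ^ j ≤ μ ^ N :=
      (pow_le_pow_left₀ (norm_nonneg _) (le_add_of_nonneg_left zero_le_one) j).trans
        (pow_le_pow_right₀ hμ1 hj)
    calc _ ≤ Cb' * (B * s ^ j) * μ ^ N := by
          refine mul_le_mul ((hCb j _).trans ?_) h4 (by positivity) (by positivity)
          exact mul_le_mul (hCble j hj) (hB j hj) (X.wt_pos _ _ _).le hCb0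
      _ = _ := by ring
  rw [e]
  have h5 : ∀ j ≤ N, ‖iteratedFDeriv ℝ j (fun z => c2 z • f z) z‖ ≤
      (2 ^ N * (CG * (Cb' * μ ^ N * B))) * s ^ j := by
    intro j hj
    refine (norm_iteratedFDeriv_smul_scale hc2 hf h2 h3 hj).trans ?_
    gcongr
    norm_num
  refine (norm_iteratedFDeriv_smul_scale hc1 (hc2.smul hf) h1 h5 hj).trans ?_
  calc _ ≤ 2 ^ N * (A * (2 ^ N * (CG * (Cb' * μ ^ N * B)))) * s ^ j := by
        gcongr
        norm_num
    _ = _ := by ring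

/-- Comparison of the weights at two base points. -/
lemma AdaptedFrame.wt_shift_le (X : AdaptedFrame D) {x y ξ : Space d} {c c' s : ℝ} (hc : 1 ≤ c)
    (hc' : 1 ≤ c') (h1 : X.w x ξ ≤ c * X.w y ξ) (h2 : X.w y ξ ≤ c' * X.w x ξ)
    (hs : lam ξ ≤ s * X.w x ξ) {N n' j : ℕ} (hn : |n| ≤ n') (hj : j ≤ N) :
    X.wt (m + j) (n - j) (y, ξ) ≤ (c * c') ^ n' * c ^ N * X.wt m n (x, ξ) * s ^ j := by
  have hwx := X.w_pos x ξ
  have hwy := X.w_pos y ξ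
  have hl := lam_pos ξ
  have hs0 : 0 < s := pos_of_mul_pos_left (hl.trans_le hs) hwx.le
  have hcc : 1 ≤ c * c' := one_le_mul_of_one_le_of_one_le hc hc'
  have h3 : X.w y ξ ^ n ≤ (c * c') ^ n' * X.w x ξ ^ n := by
    refine (rpow_le_of_comparable hwy hwx hcc ?_ ?_ n).trans ?_
    · refine h2.trans (mul_le_mul_of_nonneg_right ?_ hwx.le)
      nlinarith
    · refine h1.trans (mul_le_mul_of_nonneg_right ?_ hwy.le)
      nlinarith
    · rw [← Real.rpow_natCast (c * c') n']
      exact mul_le_mul_of_nonneg_right (Real.rpow_le_rpow_of_exponent_le hcc hn)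
        (Real.rpow_nonneg hwx.le _)
  have h4 : lam ξ / X.w y ξ ≤ c * s := by
    rw [div_le_iff₀ hwy]
    calc lam ξ ≤ s * X.w x ξ := hs
      _ ≤ s * (c * X.w y ξ) := by gcongr
      _ = _ := by ring
  have h5 : X.wt (m + j) (n - j) (y, ξ) = lam ξ ^ m * X.w y ξ ^ n * (lam ξ / X.w y ξ) ^ j := by
    simp only [AdaptedFrame.wt]
    rw [Real.rpow_add hl, Real.rpow_sub hwy, Real.rpow_natCast, Real.rpow_natCast, div_pow]
    ring
  rw [h5]
  calc _ ≤ lam ξ ^ m * ((c * c') ^ n' * X.w x ξ ^ n) * (c ^ N * s ^ j) := by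
        have : (lam ξ / X.w y ξ) ^ j ≤ c ^ N * s ^ j := by
          refine (pow_le_pow_left₀ (by positivity) h4 j).trans ?_
          rw [mul_pow]
          gcongr
        have := Real.rpow_nonneg hl.le m
        have := Real.rpow_nonneg hwy.le n
        gcongr
    _ = _ := by simp only [AdaptedFrame.wt]; ring

/-- The growth of a symbol in the fiber at the scale `lam / w`. -/
lemma IsSymbol.norm_le_fiber (ha : IsSymbol X m n a) {κ : ℝ} (hκ : 1 ≤ κ) {M : ℕ}
    (hM : 2 * |m| + |n| ≤ M) : ∃ C : ℝ, 0 ≤ C ∧ ∀ x ξ θ : Space d,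
    ‖a (x, ξ + θ)‖ ≤ C * X.wt m n (x, ξ) * (1 + ‖(κ * (lam ξ / X.w x ξ))⁻¹ • θ‖) ^ M := by
  obtain ⟨C, h0, hC⟩ := ha.norm_le
  obtain ⟨C', h1', hC'⟩ := X.weights_fiber
  refine ⟨C * (C' ^ |m| * C' ^ |n| * κ ^ M), by positivity, fun x ξ θ => (hC _).trans ?_⟩
  obtain ⟨h1, h2, h3, h4⟩ := hC' x ξ θ
  have hwx := X.w_pos x ξ
  have hl := lam_pos ξ
  set T := 1 + ‖θ‖ * (X.w x ξ / lam ξ) with hT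
  have hT1 : 1 ≤ T := le_add_of_nonneg_right (by positivity)
  have hT0 : 0 < T := by linarith
  have e1 : T ≤ κ * (1 + ‖(κ * (lam ξ / X.w x ξ))⁻¹ • θ‖) := by
    rw [norm_smul, Real.norm_of_nonneg (by positivity), hT, mul_inv, inv_div, mul_add, mul_one]
    have : κ * (κ⁻¹ * (X.w x ξ / lam ξ) * ‖θ‖) = ‖θ‖ * (X.w x ξ / lam ξ) := by
      field_simp
    rw [this]
    linarith
  have hCT : 1 ≤ C' * T := one_le_mul_of_one_le_of_one_le h1' hT1
  have hCT2 : 1 ≤ C' * T ^ 2 := one_le_mul_of_one_le_of_one_le h1' (one_le_pow₀ hT1)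
  have h5 := rpow_le_of_comparable (lam_pos (ξ + θ)) hl hCT2 h3 h4 m
  have h6 := rpow_le_of_comparable (X.w_pos x (ξ + θ)) hwx hCT h1 h2 n
  -- Under a shift by θ, λ varies by a factor T² and w by a factor T; this is the origin of the
  -- exponent 2|m| + |n|.
  have h7 : (C' * T ^ 2) ^ |m| * (C' * T) ^ |n| ≤ C' ^ |m| * C' ^ |n| * T ^ M := by
    rw [Real.mul_rpow (by positivity) (by positivity), Real.mul_rpow (by positivity) hT0.le,
      ← Real.rpow_natCast T 2, ← Real.rpow_mul hT0.le]
    calc _ = C' ^ |m| * C' ^ |n| * (T ^ (((2 : ℕ) : ℝ) * |m|) * T ^ |n|) := by ring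
      _ ≤ _ := by
        rw [← Real.rpow_add hT0, ← Real.rpow_natCast T M]
        refine mul_le_mul_of_nonneg_left (Real.rpow_le_rpow_of_exponent_le hT1 ?_) (by positivity)
        exact_mod_cast hM
  have h8 : T ^ M ≤ κ ^ M * (1 + ‖(κ * (lam ξ / X.w x ξ))⁻¹ • θ‖) ^ M := by
    rw [← mul_pow]
    exact pow_le_pow_left₀ hT0.le e1 M
  have h9 := Real.rpow_nonneg hl.le m
  have h10 := Real.rpow_nonneg hwx.le n
  rw [mul_assoc C, mul_assoc C]
  refine mul_le_mul_of_nonneg_left ?_ h0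
  simp only [AdaptedFrame.wt]
  calc lam (ξ + θ) ^ m * X.w x (ξ + θ) ^ n
      ≤ ((C' * T ^ 2) ^ |m| * lam ξ ^ m) * ((C' * T) ^ |n| * X.w x ξ ^ n) :=
        mul_le_mul h5 h6 (Real.rpow_nonneg (X.w_pos _ _).le _) (by positivity)
    _ = ((C' * T ^ 2) ^ |m| * (C' * T) ^ |n|) * (lam ξ ^ m * X.w x ξ ^ n) := by ring
    _ ≤ (C' ^ |m| * C' ^ |n| * (κ ^ M * (1 + ‖(κ * (lam ξ / X.w x ξ))⁻¹ • θ‖) ^ M)) *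
        (lam ξ ^ m * X.w x ξ ^ n) := by
        refine mul_le_mul_of_nonneg_right (h7.trans ?_) (by positivity)
        gcongr
    _ = _ := by ring

lemma IsSymbol.partialXi_iterate (ha : IsSymbol X m n a) (r : Fin (d + 1)) (k : ℕ) :
    IsSymbol X m (n - k) ((MixedSymbol.partialXi r)^[k] a) := by
  induction k with
  | zero => simpa using ha
  | succ k ih =>
    rw [Function.iterate_succ_apply']
    convert ih.partialXi r using 1
    push_cast
    ring

/-- The composition integral has the size of the product of the symbols. -/
theorem J_norm_le (ha : IsSymbol X m₁ n₁ a) (hG : IsKernel (d + 3) G) (hb : IsSymbol X m₂ n₂ b) :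
    ∃ C : ℝ, ∀ p, ‖J a G b p‖ ≤ C * X.wt (m₁ + m₂) (n₁ + n₂) p := by
  set M₀ := ⌈2 * |m₁| + |n₁|⌉₊ with hM₀
  set n' := ⌈|n₂|⌉₊ with hn'
  -- With this K the far part loses the power n' + (M₀ + 2K + d + 2) = 3K of h, below the 4K gained
  -- by 2K integrations by parts; moreover 2K - n' ≥ d + 2 leaves integrable decay in z.
  set K := M₀ + (d + 2) + n' with hK
  have hM₀' : 2 * |m₁| + |n₁| ≤ M₀ := Nat.le_ceil _
  have hM₁' : 2 * |m₁| + |n₁ - (2 * K : ℕ)| ≤ (M₀ + 2 * K : ℕ) := by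
    have := abs_sub n₁ ((2 * K : ℕ) : ℝ)
    rw [abs_of_nonneg (Nat.cast_nonneg (α := ℝ) (2 * K))] at this
    push_cast at this ⊢
    linarith
  have hn2 : |n₂| ≤ n' := Nat.le_ceil _
  obtain ⟨κ, hκ, hs, hbase⟩ := X.weights_base
  obtain ⟨C₀, hC₀, hpair₀⟩ := norm_pair_le (d := d) (q := d + 2) (by omega) M₀
  obtain ⟨C₁, hC₁, hpair₁⟩ := norm_pair_le (d := d) (q := d + 2) (by omega) (M₀ + 2 * K)
  obtain ⟨U₀, hU₀, hfib₀⟩ := ha.norm_le_fiber hκ hM₀'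
  choose U₁ hU₁ hfib₁ using fun r => (ha.partialXi_iterate r (2 * K)).norm_le_fiber hκ hM₁'
  obtain ⟨E₀, hE₀, hamp₀⟩ := hb.norm_iteratedFDeriv_ampV_le hG contDiff_cutoff (M₀ + (d + 2))
  obtain ⟨E₁, hE₁, hamp₁⟩ := hb.norm_iteratedFDeriv_ampV_le hG (contDiff_tail K)
    (M₀ + 2 * K + (d + 2))
  obtain ⟨F₀, hF₀, hcut⟩ := (derivBound_cutoff (d := d) (d + 2)).bound_le
    (fun _ _ => (decay_pos _ _).le) (M₀ + (d + 2))
  obtain ⟨F₁, hF₁, htail⟩ := (derivBound_tail (d := d) K).bound_le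
    (fun _ _ => (decay_pos _ _).le) (M₀ + 2 * K + (d + 2))
  refine ⟨C₀ * (U₀ * (E₀ * F₀ * ((2 * 3) ^ n' * 2 ^ (M₀ + (d + 2))))) +
    ∑ r, κ ^ (2 * K) * (C₁ * (U₁ r * (E₁ * F₁))), ?_⟩
  rintro ⟨x, ξ⟩
  have hwx := X.w_pos x ξ
  have hl := lam_pos ξ
  have hs1 := hs x ξ
  set s := κ * (lam ξ / X.w x ξ) with hs_def
  have hs0 : 0 < s := by linarith
  have hsl : lam ξ ≤ s * X.w x ξ := by
    rw [hs_def, mul_assoc, div_mul_cancel₀ _ hwx.ne']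
    exact le_mul_of_one_le_left hl.le hκ
  have hW₂ := X.wt_pos m₂ n₂ (x, ξ)
  have hW₁ := X.wt_pos m₁ n₁ (x, ξ)
  -- the ratio of the scales
  set h := X.w x ξ / Real.sqrt (lam ξ) with hh
  have hsq : 0 < Real.sqrt (lam ξ) := Real.sqrt_pos.2 hl
  have hh1 : 1 ≤ h := by
    rw [hh, one_le_div hsq]
    exact X.sqrt_lam_le_w x ξ
  -- A crude comparison valid for every z: w at x + z is at least √λ, hence at least w/h, and it
  -- exceeds w at x by at most the factor 1 + |sz|.
  have hfar : ∀ (N : ℕ) (z : Space d), ∀ j ≤ N, X.wt (m₂ + j) (n₂ - j) (x + z, ξ) ≤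
      ((h * (1 + ‖s • z‖)) ^ n' * h ^ N * X.wt m₂ n₂ (x, ξ)) * s ^ j := by
    intro N z j hj
    refine X.wt_shift_le hh1 (le_add_of_nonneg_right (norm_nonneg _)) ?_ ?_ hsl hn2 hj
    · rw [hh, div_mul_eq_mul_div, le_div_iff₀ hsq]
      exact mul_le_mul_of_nonneg_left (X.sqrt_lam_le_w _ ξ) hwx.le
    · rw [norm_smul, Real.norm_of_nonneg hs0.le]
      exact (hbase x z ξ).1
  rw [J_split K hs1 ha.isModerate hG hb.isModerate, add_mul, Finset.sum_mul]
  refine norm_add_le_of_le ?_ (norm_sum_le_of_le _ fun r _ => ?_)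
  · have hk : IsKernel (d + 3) (fun q => cutoff (s • (q.2 - q.1)) * G q) :=
      (IsKernel.mul' (isKernel_comp (derivBound_cutoff 0) hs1) hG).weaken (by omega)
    refine (hpair₀ _ _ s (U₀ * X.wt m₁ n₁ (x, ξ))
      (E₀ * F₀ * ((2 * 3) ^ n' * 2 ^ (M₀ + (d + 2)) * X.wt m₂ n₂ (x, ξ))) hs1 (by positivity)
      (by positivity) ((IsModerate.locDecay_ampV hk hb.isModerate).slice (x, ξ)).smooth ?_
      (fun θ => hfib₀ x ξ θ)).trans (le_of_eq ?_)
    · intro j hj z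
      have hd := decay_pos (d + 2) (s • z)
      -- For |sz| ≤ 2 the weights at x and x + z compare with the absolute constants 2 and 3. Beyond
      -- that the cutoff and all its derivatives vanish, so the bound A = 0 applies.
      rcases le_or_gt ‖s • z‖ 2 with hz | hz
      · refine (hamp₀ (x, ξ) z s (F₀ * decay (d + 2) (s • z))
          ((2 * 3) ^ n' * 2 ^ (M₀ + (d + 2)) * X.wt m₂ n₂ (x, ξ)) hs1
          (fun j hj => hcut j hj _ (Set.mem_univ _)) (fun j hj => ?_) j hj).trans
          (le_of_eq (by ring))
        refine X.wt_shift_le one_le_two (by norm_num) ((hbase x z ξ).2 hz) ?_ hsl hn2 hj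
        refine (hbase x z ξ).1.trans (mul_le_mul_of_nonneg_right ?_ hwx.le)
        rw [norm_smul, Real.norm_of_nonneg hs0.le] at hz
        linarith
      · refine (hamp₀ (x, ξ) z s 0 _ hs1 (fun j hj => ?_) (hfar _ z) j hj).trans ?_
        · rw [iteratedFDeriv_cutoff_eq_zero hz, norm_zero]
        · rw [zero_mul, mul_zero, zero_mul]
          positivity
    · rw [← X.wt_mul]; ring
  · have hk : IsKernel (d + 3) (fun q => tail K (s • (q.2 - q.1)) * G q) :=
      (IsKernel.mul' (isKernel_comp (derivBound_tail K) hs1) hG).weaken (by omega)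
    have hcoef : ‖((s : ℂ) * (2 * Real.pi * Complex.I)⁻¹) ^ (2 * K)‖ ≤ s ^ (2 * K) := by
      rw [norm_pow]
      refine pow_le_pow_left₀ (norm_nonneg _) ?_ _
      rw [norm_mul, Complex.norm_real, Real.norm_of_nonneg hs0.le, norm_inv]
      refine mul_le_of_le_one_right hs0.le (inv_le_one_of_one_le₀ ?_)
      simp only [norm_mul, Complex.norm_ofNat, Complex.norm_real, Complex.norm_I, mul_one,
        Real.norm_of_nonneg Real.pi_pos.le]
      linarith [Real.pi_gt_three]
    have hmain := hpair₁ _ (fun z => ampV (fun q => tail K (s • (q.2 - q.1)) * G q) b ((x, ξ), z))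
      s (U₁ r * X.wt m₁ (n₁ - (2 * K : ℕ)) (x, ξ))
      (E₁ * F₁ * h ^ (n' + (M₀ + 2 * K + (d + 2))) * X.wt m₂ n₂ (x, ξ)) hs1
      (mul_nonneg (hU₁ r) (X.wt_pos _ _ _).le) (by positivity)
      ((IsModerate.locDecay_ampV hk hb.isModerate).slice (x, ξ)).smooth ?_
      (fun θ => hfib₁ r x ξ θ)
    -- The gain: s^{2K} from the splitting and w^{-2K} from the derivatives of a combine to (κ
    -- λ/w²)^{2K} = κ^{2K} h^{-4K}, which absorbs the h^{3K} lost in the crude comparison.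
    · have hw : s ^ (2 * K) * X.wt m₁ (n₁ - (2 * K : ℕ)) (x, ξ) *
          h ^ (n' + (M₀ + 2 * K + (d + 2))) ≤ κ ^ (2 * K) * X.wt m₁ n₁ (x, ξ) := by
        have e1 : h ^ (n' + (M₀ + 2 * K + (d + 2))) ≤ (X.w x ξ ^ 2 / lam ξ) ^ (2 * K) := by
          refine (pow_le_pow_right₀ hh1 (show _ ≤ 2 * (2 * K) by omega)).trans (le_of_eq ?_)
          rw [pow_mul, hh, div_pow, Real.sq_sqrt hl.le]
        have e2 : X.wt m₁ (n₁ - (2 * K : ℕ)) (x, ξ) =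
            X.wt m₁ n₁ (x, ξ) / X.w x ξ ^ (2 * K) := by
          simp only [AdaptedFrame.wt]
          rw [Real.rpow_sub hwx, Real.rpow_natCast]
          ring
        have e3 : s ^ (2 * K) * (X.w x ξ ^ 2 / lam ξ) ^ (2 * K) =
            κ ^ (2 * K) * X.w x ξ ^ (2 * K) := by
          rw [← mul_pow, ← mul_pow, hs_def]
          congr 1
          field_simp
        rw [e2]
        calc _ ≤ s ^ (2 * K) * (X.wt m₁ n₁ (x, ξ) / X.w x ξ ^ (2 * K)) *
              (X.w x ξ ^ 2 / lam ξ) ^ (2 * K) := by gcongr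
          _ = (s ^ (2 * K) * (X.w x ξ ^ 2 / lam ξ) ^ (2 * K)) *
              X.wt m₁ n₁ (x, ξ) / X.w x ξ ^ (2 * K) := by ring
          _ = _ := by
            rw [e3]
            field_simp
      rw [norm_mul]
      calc _ ≤ s ^ (2 * K) * (C₁ * (U₁ r * X.wt m₁ (n₁ - (2 * K : ℕ)) (x, ξ) *
            (E₁ * F₁ * h ^ (n' + (M₀ + 2 * K + (d + 2))) * X.wt m₂ n₂ (x, ξ)))) :=
            mul_le_mul hcoef hmain (norm_nonneg _) (by positivity)
        _ = (s ^ (2 * K) * X.wt m₁ (n₁ - (2 * K : ℕ)) (x, ξ) *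
            h ^ (n' + (M₀ + 2 * K + (d + 2)))) * (C₁ * (U₁ r * (E₁ * F₁)) * X.wt m₂ n₂ (x, ξ)) := by
            ring
        _ ≤ (κ ^ (2 * K) * X.wt m₁ n₁ (x, ξ)) *
            (C₁ * (U₁ r * (E₁ * F₁)) * X.wt m₂ n₂ (x, ξ)) := by
            have := hU₁ r
            exact mul_le_mul_of_nonneg_right hw (by positivity)
        _ = _ := by rw [← X.wt_mul]; ring
    · intro j hj z
      refine (hamp₁ (x, ξ) z s (F₁ * decay (2 * K) (s • z)) _ hs1
          (fun j hj => htail j hj _ (Set.mem_univ _)) (hfar _ z) j hj).trans ?_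
      -- The decay of the tail pays for the growth (1 + |sz|)^{n'} of the weights in the base.
      have e : (1 + ‖s • z‖) ^ n' * decay (2 * K) (s • z) ≤ decay (d + 2) (s • z) := by
        rw [show 2 * K = n' + (2 * K - n') by omega, pow_mul_decay]
        exact decay_anti (by omega) _
      calc _ = E₁ * F₁ * h ^ (n' + (M₀ + 2 * K + (d + 2))) * X.wt m₂ n₂ (x, ξ) * s ^ j *
            ((1 + ‖s • z‖) ^ n' * decay (2 * K) (s • z)) := by
            rw [mul_pow, pow_add h]; ring
        _ ≤ _ := mul_le_mul_of_nonneg_left e (by positivity)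

end Estimate

end MixedSymbol
end
-- Stability of the composition integrals under derivatives
noncomputable section
namespace MixedSymbol

open MeasureTheory

variable {d : ℕ} {D : Space d → Submodule ℝ (Space d)}

section Closure

/-- The composition integrals of two symbols. -/
inductive JGen (X : AdaptedFrame D) (m n : ℝ) : (Space d × Space d → ℂ) → Prop
  | mk {m₁ n₁ m₂ n₂ : ℝ} {a b : Space d × Space d → ℂ} {G : Space d × Space d → ℝ}
      (ha : IsSymbol X m₁ n₁ a) (hG : IsKernel (d + 4) G) (hb : IsSymbol X m₂ n₂ b)
      (hm : m = m₁ + m₂) (hn : n = n₁ + n₂) : JGen X m n (J a G b)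

/-- The composition integrals of moderate functions. -/
def ModerateGen (d : ℕ) (_ _ : ℝ) (f : Space d × Space d → ℂ) : Prop :=
  ∃ a G b, IsModerate a ∧ IsKernel (d + 3) G ∧ IsModerate b ∧ f = J a G b

variable {a b : Space d × Space d → ℂ} {G : Space d × Space d → ℝ}

lemma dir_zero {V : Type*} [NormedAddCommGroup V] [NormedSpace ℝ V] {F : Type*}
    [NormedAddCommGroup F] [NormedSpace ℝ F] (f : V → F) : dir 0 f = fun _ => 0 := by
  funext p; simp [dir]

/-- Partial derivatives of J are sums of integrals of the same form with moderate amplitudes. Orders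
play no role in smoothness, so both indices of the family are set to 0. -/
lemma J_contDiff (ha : IsModerate a) (hG : IsKernel (d + 3) G) (hb : IsModerate b) :
    ContDiff ℝ ∞ (J a G b) := by
  have hd : ∀ f, AddGen (ModerateGen d) 0 0 f → Differentiable ℝ f := by
    intro f hf
    induction hf with
    | base h =>
      obtain ⟨a, G, b, ha, hG, hb, rfl⟩ := h
      exact (J_differentiable ha hG hb).1
    | zero => exact differentiable_const _
    | add _ _ h1 h2 => exact h1.add h2
  refine contDiff_of_family (IsSymbol.pairBasis d) {f | AddGen (ModerateGen d) 0 0 f} hd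
    (fun f hf i => ?_) (.base ⟨a, G, b, ha, hG, hb, rfl⟩)
  change AddGen (ModerateGen d) 0 0 (dir _ f)
  induction hf with
  | base h =>
    obtain ⟨a, G, b, ha, hG, hb, rfl⟩ := h
    rw [funext fun p => (J_differentiable ha hG hb).2 (IsSymbol.pairBasis d i) p]
    exact ((AddGen.base ⟨_, _, _, ha.dir _, hG, hb, rfl⟩).add
      (.base ⟨_, _, _, ha, hG.dir _, hb, rfl⟩)).add (.base ⟨_, _, _, ha, hG, hb.dir _, rfl⟩)
  | zero =>
    have : dir (IsSymbol.pairBasis d i) (fun _ : Space d × Space d => (0 : ℂ)) = fun _ => 0 := by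
      funext p; simp [dir]
    rw [this]
    exact .zero
  | add h1 h2 ih1 ih2 =>
    rw [dir_add (hd _ h1) (hd _ h2)]
    exact ih1.add ih2

variable {X : AdaptedFrame D} {m n m₁ n₁ m₂ n₂ : ℝ}

lemma JGen.const_mul (z : ℂ) {f : Space d × Space d → ℂ} (h : AddGen (JGen X) m n f) :
    AddGen (JGen X) m n (fun p => z * f p) := by
  induction h with
  | base h =>
    obtain ⟨ha, hG, hb, hm, hn⟩ := h
    rw [← funext fun p => J_const_mul_left z p]
    exact .base ⟨ha.const_mul z, hG, hb, hm, hn⟩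
  | zero => simpa using AddGen.zero
  | add _ _ h1 h2 =>
    simp only [mul_add]
    exact h1.add h2

lemma partialXi_J (ha : IsModerate a) (hG : IsKernel (d + 3) G) (hb : IsModerate b)
    (k : Fin (d + 1)) (p : Space d × Space d) :
    partialXi k (J a G b) p = J (partialXi k a) G b p + J a G (partialXi k b) p := by
  have := (J_differentiable ha hG hb).2 (0, EuclideanSpace.single k 1) p
  simp only [Prod.mk_zero_zero, dir_zero, J_zero_mid, add_zero] at this
  exact this

/-- The Leibniz rule, except that the coefficient B_j^N stands at x while D_ξ b needs it at y. The
double sum is Hadamard's remainder. -/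
lemma Dxi_J (ha : IsSymbol X m₁ n₁ a) (hG : IsKernel (d + 4) G) (hb : IsSymbol X m₂ n₂ b)
    {H : Fin (d + 1) → Fin (d + 1) → Space d × Space d → ℝ} (hH : ∀ j r, IsCb (H j r))
    (hBH : ∀ j x y, X.B y j (Fin.last d) - X.B x j (Fin.last d) =
      ∑ r, (y r - x r) * H j r (x, y)) (p : Space d × Space d) :
    X.Dxi (J a G b) p = J (X.Dxi a) G b p + J a G (X.Dxi b) p +
      ∑ j, ∑ r, (-(2 * Real.pi * Complex.I)⁻¹) *
        J (partialXi r a) (fun q => H j r q * G q) (partialXi j b) p := by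
  have hG3 : IsKernel (d + 3) G := hG.weaken (by omega)
  have hB := fun j => X.isCb_B j (Fin.last d)
  have e1 : J (X.Dxi a) G b p = ∑ j, X.B p.1 j (Fin.last d) • J (partialXi j a) G b p := by
    refine (J_sum_left (f := fun j q => X.B q.1 j (Fin.last d) • partialXi j a q)
      (fun j => ((ha.partialXi j).smul_base (hB j)).isModerate) hG3 hb.isModerate p).trans ?_
    exact Finset.sum_congr rfl fun j _ => J_smul_left (fun x => X.B x j (Fin.last d)) p
  have e2 : J a G (X.Dxi b) p = ∑ j, J a G (fun q => X.B q.1 j (Fin.last d) • partialXi j b q) p :=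
    J_sum_right ha.isModerate hG3 (fun j => ((hb.partialXi j).smul_base (hB j)).isModerate) p
  rw [AdaptedFrame.Dxi, e1, e2, ← Finset.sum_add_distrib, ← Finset.sum_add_distrib]
  refine Finset.sum_congr rfl fun j _ => ?_
  rw [partialXi_J ha.isModerate hG3 hb.isModerate, smul_add, add_assoc,
    J_base_smul ha.isModerate hG (hb.partialXi j).isModerate (hB j) (hH j) (hBH j)]
  rfl

/-- The Leibniz rule fails in two ways: D_i a carries ξ_l + θ_l instead of ξ_l, which gives
z-derivatives of G and b, and D_i b needs L at y instead of x, which gives Hadamard remainders. -/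
lemma Dx_J (ha : IsSymbol X m₁ n₁ a) (hG : IsKernel (d + 4) G) (hb : IsSymbol X m₂ n₂ b)
    (i : Fin (d + 1))
    {H : Fin (d + 1) → Fin (d + 1) → Fin (d + 1) → Space d × Space d → ℝ}
    (hH : ∀ k l r, IsCb (H k l r))
    (hLH : ∀ k l x y, X.L i k l y - X.L i k l x = ∑ r, (y r - x r) * H k l r (x, y))
    (p : Space d × Space d) :
    X.Dx i (J a G b) p = J (X.Dx i a) G b p +
      J a (dir (EuclideanSpace.single i 1, EuclideanSpace.single i 1) G) b p +
      J a G (X.Dx i b) p +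
      ∑ k, ∑ l, ((-(2 * Real.pi * Complex.I)⁻¹) *
        (J (fun q => X.L i k l q.1 • partialXi k a q) (dir (0, EuclideanSpace.single l 1) G) b p +
          J (fun q => X.L i k l q.1 • partialXi k a q) G (partialX l b) p) +
        ∑ r, (-(2 * Real.pi * Complex.I)⁻¹) * J (partialXi r a) (fun q => H k l r q * G q)
          (fun q => ((q.2 l : ℝ) : ℂ) * partialXi k b q) p) := by
  have hG3 : IsKernel (d + 3) G := hG.weaken (by omega)
  have hL := X.isCb_L i
  have key : ∀ c : Space d × Space d → ℂ, X.Dx i c = fun q => partialX i c q +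
      ∑ k, ∑ l, X.L i k l q.1 • (((q.2 l : ℝ) : ℂ) * partialXi k c q) := by
    intro c; rw [X.Dx_eq]; simp
  have hma : ∀ k l, IsModerate fun q => X.L i k l q.1 • (((q.2 l : ℝ) : ℂ) * partialXi k a q) :=
    fun k l => (((ha.partialXi k).coord_mul l).smul_base (hL k l)).isModerate
  have hmb : ∀ k l, IsModerate fun q => X.L i k l q.1 • (((q.2 l : ℝ) : ℂ) * partialXi k b q) :=
    fun k l => (((hb.partialXi k).coord_mul l).smul_base (hL k l)).isModerate
  have e1 : J (X.Dx i a) G b p = J (partialX i a) G b p + ∑ k, ∑ l, X.L i k l p.1 •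
      J (fun q => ((q.2 l : ℝ) : ℂ) * partialXi k a q) G b p := by
    rw [key, J_add_left (ha.partialX i).isModerate (.sum fun k => .sum fun l => hma k l) hG3
      hb.isModerate, J_sum_left (fun k => .sum fun l => hma k l) hG3 hb.isModerate]
    simp only [J_sum_left (hma _) hG3 hb.isModerate, J_smul_left]
  have e2 : J a G (X.Dx i b) p = J a G (partialX i b) p + ∑ k, ∑ l,
      J a G (fun q => X.L i k l q.1 • (((q.2 l : ℝ) : ℂ) * partialXi k b q)) p := by
    rw [key, J_add_right ha.isModerate hG3 (hb.partialX i).isModerate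
      (.sum fun k => .sum fun l => hmb k l),
      J_sum_right ha.isModerate hG3 (fun k => .sum fun l => hmb k l)]
    simp only [J_sum_right ha.isModerate hG3 (hmb _)]
  have e3 : partialX i (J a G b) p = J (partialX i a) G b p +
      J a (dir (EuclideanSpace.single i 1, EuclideanSpace.single i 1) G) b p +
        J a G (partialX i b) p :=
    (J_differentiable ha.isModerate hG3 hb.isModerate).2 (EuclideanSpace.single i 1, 0) p
  have e4 : ∀ k l, X.L i k l p.1 • (((p.2 l : ℝ) : ℂ) * partialXi k (J a G b) p) =
      X.L i k l p.1 • J (fun q => ((q.2 l : ℝ) : ℂ) * partialXi k a q) G b p +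
      J a G (fun q => X.L i k l q.1 • (((q.2 l : ℝ) : ℂ) * partialXi k b q)) p +
      ((-(2 * Real.pi * Complex.I)⁻¹) *
        (J (fun q => X.L i k l q.1 • partialXi k a q) (dir (0, EuclideanSpace.single l 1) G) b p +
          J (fun q => X.L i k l q.1 • partialXi k a q) G (partialX l b) p) +
        ∑ r, (-(2 * Real.pi * Complex.I)⁻¹) * J (partialXi r a) (fun q => H k l r q * G q)
          (fun q => ((q.2 l : ℝ) : ℂ) * partialXi k b q) p) := by
    intro k l
    have h := J_base_smul ha.isModerate hG ((hb.partialXi k).coord_mul l).isModerate (hL k l)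
      (hH k l) (hLH k l) p
    rw [J_coord_right] at h
    rw [partialXi_J ha.isModerate hG3 hb.isModerate, mul_add, smul_add, h,
      J_coord_left l (ha.partialXi k).isModerate hG3 hb.isModerate, J_smul_left, J_smul_left]
    simp only [Complex.real_smul, partialXi_eq_dir, partialX_eq_dir]
    ring
  rw [key, e1, e2]
  simp only [e3, e4, Finset.sum_add_distrib]
  ring

/-- Composition integrals of symbols are symbols. -/
theorem J_isSymbol (ha : IsSymbol X m₁ n₁ a) (hG : IsKernel (d + 4) G) (hb : IsSymbol X m₂ n₂ b) :
    IsSymbol X (m₁ + m₂) (n₁ + n₂) (J a G b) := by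
  refine isSymbol_of_generators X (JGen X) ?_ ?_ ?_ ?_ ?_ (.base ⟨ha, hG, hb, rfl, rfl⟩)
  · rintro _ _ _ ⟨ha, hG, hb, _, _⟩
    exact J_contDiff ha.isModerate (hG.weaken (by omega)) hb.isModerate
  · rintro _ _ _ ⟨ha, hG, hb, rfl, rfl⟩
    exact J_norm_le ha (hG.weaken (by omega)) hb
  · rintro _ _ _ ⟨ha, hG, hb, rfl, rfl⟩ k
    rw [funext fun p => partialXi_J ha.isModerate (hG.weaken (by omega)) hb.isModerate k p]
    exact .add (.base ⟨ha.partialXi k, hG, hb, rfl, by ring⟩)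
      (.base ⟨ha, hG, hb.partialXi k, rfl, by ring⟩)
  · rintro _ _ _ ⟨ha, hG, hb, rfl, rfl⟩
    choose H hH hBH using fun j => exists_hadamard (X.isCb_B j (Fin.last d))
    rw [funext fun p => Dxi_J ha hG hb hH hBH p]
    refine .add (.add (.base ⟨ha.Dxi, hG, hb, by ring, rfl⟩) (.base ⟨ha, hG, hb.Dxi, by ring, rfl⟩))
      (.sum fun j _ => .sum fun r _ => JGen.const_mul _ (.base ?_))
    -- Two ξ-derivatives give order (m, n - 2), contained in the required (m - 1, n) because λ ≤ w².
    exact ⟨(ha.partialXi r).lower_lam, IsKernel.mul (hH j r) hG, hb.partialXi j, by ring, by ring⟩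
  · rintro _ _ _ ⟨ha, hG, hb, rfl, rfl⟩ i
    choose H hH hLH using fun k l => exists_hadamard (X.isCb_L i k l)
    rw [funext fun p => Dx_J ha hG hb i hH hLH p]
    refine .add (.add (.add (.base ⟨ha.Dx i, hG, hb, rfl, rfl⟩)
      (.base ⟨ha, hG.dir _, hb, rfl, rfl⟩)) (.base ⟨ha, hG, hb.Dx i, rfl, rfl⟩))
      (.sum fun k _ => .sum fun l _ => .add (JGen.const_mul _ (.add (.base ?_) (.base ?_)))
        (.sum fun r _ => JGen.const_mul _ (.base ?_)))
    · exact ⟨((ha.partialXi k).smul_base (X.isCb_L i k l)).mono le_rfl (sub_le_self _ zero_le_one),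
        hG.dir _, hb, rfl, rfl⟩
    -- The x-derivative of b costs (1, -1) and ∂_ξ a has (0, -1) to spare: in total (m + 1, n - 2),
    -- which again lies in (m, n). The last remainder, with ξ_l ∂_ξ b, has the same count.
    · exact ⟨((ha.partialXi k).smul_base (X.isCb_L i k l)).lower_lam, hG, hb.partialX l,
        by ring, by ring⟩
    · exact ⟨(ha.partialXi r).lower_lam, IsKernel.mul (hH k l r) hG,
        (hb.partialXi k).coord_mul l, by ring, by ring⟩

end Closure

end MixedSymbol
end
-- Pseudodifferential operators on Schwartz space
noncomputable section
namespace MixedSymbol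

open MeasureTheory

variable {d : ℕ} {D : Space d → Submodule ℝ (Space d)}

section Rapid

/-- Amplitudes that decrease rapidly in the covector, with all derivatives. -/
def IsRapid (c : Space d × Space d → ℂ) : Prop :=
  ∀ N : ℕ, DerivBound Set.univ (fun p => decay N p.2) c

/-- The oscillatory integral `∫ c(x, ξ) e^{2πi x·ξ} dξ`. -/
def osc (c : Space d × Space d → ℂ) (x : Space d) : ℂ := ft c (x, -x)

namespace IsRapid

variable {c c' : Space d × Space d → ℂ}

lemma contDiff (hc : IsRapid c) : ContDiff ℝ ∞ c := (hc 0).smooth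

lemma add (hc : IsRapid c) (hc' : IsRapid c') : IsRapid fun p => c p + c' p :=
  fun N => (hc N).add (hc' N)

lemma dir (hc : IsRapid c) (e : Space d × Space d) : IsRapid (dir e c) :=
  fun N => (hc N).fderiv_apply e

lemma const_mul (hc : IsRapid c) (z : ℂ) : IsRapid fun p => z * c p := by
  intro N
  refine ⟨contDiff_const.mul hc.contDiff, fun k => ?_⟩
  obtain ⟨C, h0, hC⟩ := (hc N).bound k
  refine ⟨‖z‖ * C, by positivity, fun p hp => ?_⟩
  have := iteratedFDeriv_const_smul_apply (𝕜 := ℝ) (a := z) (x := p) (f := c) (i := k)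
    (hc.contDiff.contDiffAt.of_le (by exact_mod_cast le_top))
  change ‖iteratedFDeriv ℝ k (z • c) p‖ ≤ _
  rw [this, norm_smul, mul_assoc]
  exact mul_le_mul_of_nonneg_left (hC p hp) (norm_nonneg _)

lemma inner_smul (hc : IsRapid c) (e : Space d) :
    IsRapid fun p => (inner ℝ e p.2 : ℝ) • c p := by
  intro N
  let T : Space d × Space d →L[ℝ] ℝ :=
    (innerSL ℝ e).comp (ContinuousLinearMap.snd ℝ (Space d) (Space d))
  have hT : DerivBound Set.univ (fun p : Space d × Space d => 1 + ‖p.2‖) T := by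
    refine DerivBound.clm (fun _ _ => le_add_of_nonneg_right (norm_nonneg _)) T (C := ‖e‖)
      fun p _ => ?_
    refine (norm_inner_le_norm e p.2).trans ?_
    gcongr
    exact le_add_of_nonneg_left zero_le_one
  refine DerivBound.mono (c := 1) (DerivBound.smul hT (hc (1 + N))) zero_le_one fun p _ => ?_
  have := pow_mul_decay 1 N p.2
  rw [pow_one] at this
  rw [this, one_mul]

lemma locDecay (hc : IsRapid c) : LocDecay c := fun _ =>
  (hc (d + 3)).mono_set (Set.subset_univ _)

lemma isDecay (hc : IsRapid c) (x : Space d) : IsDecay fun ξ => c (x, ξ) := hc.locDecay.slice x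

lemma osc_add (hc : IsRapid c) (hc' : IsRapid c') (x : Space d) :
    osc (fun p => c p + c' p) x = osc c x + osc c' x :=
  fourier_add_of_isDecay (hc.isDecay x) (hc'.isDecay x) _

lemma osc_const_mul (z : ℂ) (x : Space d) : osc (fun p => z * c p) x = z * osc c x :=
  fourier_const_mul z _ _

/-- Since `osc c x` is the partial Fourier transform at (x, -x), the chain rule gives an
x-derivative of c and a factor 2πi e·ξ from the phase; both amplitudes are again rapid. -/
lemma differentiable_osc (hc : IsRapid c) : Differentiable ℝ (osc c) ∧
    ∀ e, MixedSymbol.dir e (osc c) = osc fun p => MixedSymbol.dir (e, 0) c p +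
      (2 * Real.pi * Complex.I) * ((inner ℝ e p.2 : ℝ) • c p) := by
  obtain ⟨h1, h2⟩ := hc.locDecay.ft_differentiable
  let L : Space d →L[ℝ] Space d × Space d := (ContinuousLinearMap.id ℝ _).prod
    (-ContinuousLinearMap.id ℝ _)
  have hL : osc c = fun x => ft c (L x) := rfl
  refine ⟨hL ▸ h1.comp L.differentiable, fun e => ?_⟩
  rw [hL, dir_comp_clm h1 L]
  funext x
  have e1 : L e = (e, 0) + (0, -e) := by
    change (e, -e) = _
    simp
  have e2 : MixedSymbol.dir (L e) (ft c) (L x) =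
      MixedSymbol.dir (e, 0) (ft c) (L x) + MixedSymbol.dir (0, -e) (ft c) (x, -x) := by
    rw [e1]
    exact map_add (fderiv ℝ (ft c) (L x)) _ _
  rw [osc_add (hc.dir _) ((hc.inner_smul e).const_mul _), e2, h2 e (L x),
    ← dir_slice_right h1 x (-e) (-x)]
  congr 1
  refine ((hc.isDecay x).fderiv_fourier (-e) (-x)).trans ?_
  rw [osc_const_mul]
  change _ = (2 * Real.pi * Complex.I) * 𝓕 (fun z => (inner ℝ e z : ℝ) • c (x, z)) (-x)
  have e3 : (fun z : Space d => (inner ℝ (-e) z : ℝ) • c (x, z)) =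
      fun z => (-1 : ℂ) * ((inner ℝ e z : ℝ) • c (x, z)) := by
    funext z
    rw [inner_neg_left, neg_smul, neg_one_mul]
  rw [e3, fourier_const_mul]
  simp only [neg_mul, one_mul, mul_neg, neg_neg]

lemma contDiff_osc (hc : IsRapid c) : ContDiff ℝ ∞ (osc c) := by
  refine contDiff_of_family (EuclideanSpace.basisFun (Fin (d + 1)) ℝ).toBasis
    {f | ∃ c, IsRapid c ∧ f = osc c} ?_ ?_ ⟨c, hc, rfl⟩
  · rintro _ ⟨c, hc, rfl⟩
    exact hc.differentiable_osc.1
  · rintro _ ⟨c, hc, rfl⟩ i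
    exact ⟨_, (hc.dir _).add ((hc.inner_smul _).const_mul _), hc.differentiable_osc.2 _⟩

lemma norm_osc_le (hc : IsRapid c) : ∃ C : ℝ, ∀ x, ‖osc c x‖ ≤ C := by
  obtain ⟨C, h0, hC⟩ := (hc (d + 3)).norm_le
  refine ⟨∫ ξ : Space d, C * decay (d + 3) ξ, fun x => ?_⟩
  rw [osc, ft, fourier_eq_phase]
  refine norm_integral_le_of_norm_le ((integrable_decay lt_decay_exp).const_mul C)
    (Filter.Eventually.of_forall fun ξ => ?_)
  rw [norm_mul, norm_phase, one_mul]
  exact hC (x, ξ) (Set.mem_univ _)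

/-- Integration by parts in ξ. Iterated, it converts the rapid decay of all ξ-derivatives of the
amplitude into decay in x. -/
lemma coord_mul_osc (hc : IsRapid c) (i : Fin (d + 1)) (x : Space d) :
    ((x i : ℝ) : ℂ) * osc c x = osc (fun p => (-(2 * Real.pi * Complex.I)⁻¹) *
      MixedSymbol.dir (0, EuclideanSpace.single i 1) c p) x := by
  rw [osc_const_mul]
  have h := (hc.isDecay x).fourier_dir (EuclideanSpace.single i 1) (-x)
  have e : osc (MixedSymbol.dir (0, EuclideanSpace.single i 1) c) x =
      𝓕 (MixedSymbol.dir (EuclideanSpace.single i 1) fun ξ => c (x, ξ)) (-x) := by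
    exact congrArg (fun v : Space d → ℂ => 𝓕 v (-x))
      (funext fun ξ => (dir_slice_right hc.contDiff.diff x _ ξ).symm)
  rw [e, h, EuclideanSpace.inner_single_left]
  have : (2 * Real.pi * Complex.I : ℂ) ≠ 0 := Complex.two_pi_I_ne_zero
  simp only [map_one, one_mul, PiLp.neg_apply, Complex.ofReal_neg]
  field_simp
  rfl

lemma norm_osc_le_decay (hc : IsRapid c) (K : ℕ) : ∃ C : ℝ, ∀ x, ‖osc c x‖ ≤ C * decay K x := by
  suffices h : ∃ C : ℝ, ∀ x : Space d, (1 + ‖x‖) ^ K * ‖osc c x‖ ≤ C by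
    obtain ⟨C, hC⟩ := h
    refine ⟨C, fun x => ?_⟩
    rw [decay, ← div_eq_mul_inv, le_div_iff₀ (by positivity), mul_comm]
    exact hC x
  induction K generalizing c with
  | zero => simpa using hc.norm_osc_le
  | succ K ih =>
    obtain ⟨C, hC⟩ := ih hc
    choose C' hC' using fun i : Fin (d + 1) =>
      ih ((hc.dir (0, EuclideanSpace.single i 1)).const_mul (-(2 * Real.pi * Complex.I)⁻¹))
    refine ⟨C + ∑ i, C' i, fun x => ?_⟩
    rw [pow_succ, mul_assoc, add_mul, one_mul, mul_add]
    refine add_le_add (hC x) ?_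
    calc (1 + ‖x‖) ^ K * (‖x‖ * ‖osc c x‖)
        ≤ (1 + ‖x‖) ^ K * ((∑ i, |x i|) * ‖osc c x‖) := by
          gcongr
          exact AdaptedFrame.euclidean_norm_le_sum x
      _ = ∑ i, (1 + ‖x‖) ^ K * ‖((x i : ℝ) : ℂ) * osc c x‖ := by
          rw [Finset.sum_mul, Finset.mul_sum]
          simp only [norm_mul, Complex.norm_real, Real.norm_eq_abs]
      _ ≤ _ := Finset.sum_le_sum fun i _ => by
          rw [hc.coord_mul_osc]
          exact hC' i x

/-- The oscillatory integral of a rapidly decreasing amplitude is a Schwartz function. -/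
def oscSchwartz (hc : IsRapid c) : 𝓢(Space d, ℂ) where
  toFun := osc c
  smooth' := hc.contDiff_osc
  decay' k n := by
    obtain ⟨C, hC⟩ := iteratedFDeriv_bound_of_family
      (EuclideanSpace.basisFun (Fin (d + 1)) ℝ).toBasis (fun _ => {f | ∃ c, IsRapid c ∧ f = osc c})
      (fun _ => decay k) (fun _ => by rintro _ ⟨c, hc, rfl⟩; exact hc.contDiff_osc)
      (fun _ => by
        rintro _ ⟨c, hc, rfl⟩ i
        exact ⟨_, (hc.dir _).add ((hc.inner_smul _).const_mul _), hc.differentiable_osc.2 _⟩)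
      (fun _ => by rintro _ ⟨c, hc, rfl⟩; exact hc.norm_osc_le_decay k) n 0 _ ⟨c, hc, rfl⟩
    refine ⟨C, fun x => ?_⟩
    have h := hC x
    rw [decay, ← div_eq_mul_inv, le_div_iff₀ (by positivity), mul_comm] at h
    refine le_trans ?_ h
    gcongr
    exact le_add_of_nonneg_left zero_le_one

lemma oscSchwartz_apply (hc : IsRapid c) (x : Space d) : hc.oscSchwartz x = osc c x := rfl

end IsRapid

end Rapid

section Pseudo

variable {a a' : Space d × Space d → ℂ}

lemma norm_iteratedFDeriv_schwartz_le (g : 𝓢(Space d, ℂ)) (k N : ℕ) : ∃ C : ℝ, 0 ≤ C ∧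
    ∀ x, ‖iteratedFDeriv ℝ k g x‖ ≤ C * decay N x := by
  refine ⟨2 ^ N * (Finset.Iic (N, k)).sup (fun m => SchwartzMap.seminorm ℝ m.1 m.2) g,
    by positivity, fun x => ?_⟩
  rw [decay, ← div_eq_mul_inv, le_div_iff₀ (by positivity), mul_comm]
  exact SchwartzMap.one_add_le_sup_seminorm_apply (𝕜 := ℝ) (m := (N, k)) le_rfl le_rfl g x

lemma IsModerate.isRapid_mul (ha : IsModerate a) (g : 𝓢(Space d, ℂ)) :
    IsRapid fun p => a p * g p.2 := by
  intro N
  have hg : ContDiff ℝ ∞ fun p : Space d × Space d => g p.2 := g.smooth'.comp contDiff_snd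
  refine ⟨ha.smooth.mul hg, fun k => ?_⟩
  choose C M h0 hC using ha.bound
  choose C' h0' hC' using norm_iteratedFDeriv_schwartz_le g
  refine ⟨∑ i ∈ Finset.range (k + 1), (k.choose i : ℝ) * (C i *
    (C' (k - i) (M i + N) * ‖ContinuousLinearMap.snd ℝ (Space d) (Space d)‖ ^ (k - i))),
    Finset.sum_nonneg fun i _ => by
      have := h0 i; have := h0' (k - i) (M i + N); positivity, fun p _ => ?_⟩
  refine (norm_iteratedFDeriv_mul_le ha.smooth hg p (by exact_mod_cast le_top)).trans ?_
  rw [Finset.sum_mul]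
  refine Finset.sum_le_sum fun i _ => ?_
  have h1 := hC i p
  have h2 := norm_iteratedFDeriv_comp_clm_le (ContinuousLinearMap.snd ℝ (Space d) (Space d))
    g.smooth' (k - i) p
  have h3 := hC' (k - i) (M i + N) p.2
  have h4 := h0 i
  have h5 := h0' (k - i) (M i + N)
  have h6 := decay_pos (M i + N) p.2
  set η := ‖ContinuousLinearMap.snd ℝ (Space d) (Space d)‖ ^ (k - i) with hη
  have hη0 : 0 ≤ η := by positivity
  calc _ ≤ (k.choose i : ℝ) * (C i * (1 + ‖p.2‖) ^ M i) *
        (C' (k - i) (M i + N) * decay (M i + N) p.2 * η) := by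
        refine mul_le_mul (mul_le_mul_of_nonneg_left h1 (Nat.cast_nonneg _))
          (h2.trans (mul_le_mul_of_nonneg_right h3 hη0)) (norm_nonneg _) (by positivity)
    _ = (k.choose i : ℝ) * (C i * (C' (k - i) (M i + N) * η)) *
        ((1 + ‖p.2‖) ^ M i * decay (M i + N) p.2) := by ring
    _ = _ := by rw [pow_mul_decay]

lemma IsModerate.isRapid (ha : IsModerate a) (f : 𝓢(Space d, ℂ)) :
    IsRapid fun p => a p * 𝓕 (f : Space d → ℂ) p.2 := by
  simpa only [SchwartzMap.fourier_coe] using ha.isRapid_mul (𝓕 f)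

lemma pseudo_eq_osc (a : Space d × Space d → ℂ) (f : 𝓢(Space d, ℂ)) (x : Space d) :
    pseudo a f x = osc (fun p => a p * 𝓕 (f : Space d → ℂ) p.2) x := by
  rw [osc, ft, fourier_eq_phase, pseudo]
  refine integral_congr_ae (Filter.Eventually.of_forall fun ξ => ?_)
  simp only [phase]
  rw [mul_comm, inner_neg_right, real_inner_comm]
  congr 2
  push_cast
  ring

/-- The operator `T_a` on the Schwartz space. -/
def IsModerate.op (ha : IsModerate a) : Module.End ℂ 𝓢(Space d, ℂ) where
  toFun f := (ha.isRapid f).oscSchwartz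
  map_add' f g := by
    ext x
    rw [_root_.add_apply]
    simp only [IsRapid.oscSchwartz_apply]
    rw [← IsRapid.osc_add (ha.isRapid f) (ha.isRapid g)]
    congr 1
    funext p
    have h : 𝓕 ((f + g : 𝓢(Space d, ℂ)) : Space d → ℂ) p.2 =
        𝓕 (f : Space d → ℂ) p.2 + 𝓕 (g : Space d → ℂ) p.2 := by
      simp only [← SchwartzMap.fourier_coe, FourierTransform.fourier_add, _root_.add_apply]
    rw [h, mul_add]
  map_smul' z f := by
    ext x
    rw [RingHom.id_apply, _root_.smul_apply, smul_eq_mul]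
    simp only [IsRapid.oscSchwartz_apply]
    rw [← IsRapid.osc_const_mul]
    congr 1
    funext p
    have h : 𝓕 ((z • f : 𝓢(Space d, ℂ)) : Space d → ℂ) p.2 = z * 𝓕 (f : Space d → ℂ) p.2 :=
      fourier_const_mul z f p.2
    rw [h]
    ring

lemma IsModerate.represents (ha : IsModerate a) : Represents a ha.op := fun f x =>
  (pseudo_eq_osc a f x).symm

lemma IsModerate.pseudo_add (ha : IsModerate a) (ha' : IsModerate a') (f : 𝓢(Space d, ℂ))
    (x : Space d) : pseudo (fun p => a p + a' p) f x = pseudo a f x + pseudo a' f x := by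
  simp only [pseudo_eq_osc, add_mul]
  exact IsRapid.osc_add (ha.isRapid f) (ha'.isRapid f) x

lemma pseudo_const_mul (z : ℂ) (f : 𝓢(Space d, ℂ)) (x : Space d) :
    pseudo (fun p => z * a p) f x = z * pseudo a f x := by
  simp only [pseudo_eq_osc, mul_assoc]
  exact IsRapid.osc_const_mul z x

lemma pseudo_sum {ι : Type*} {s : Finset ι} {a : ι → Space d × Space d → ℂ}
    (ha : ∀ i, IsModerate (a i)) (f : 𝓢(Space d, ℂ)) (x : Space d) :
    pseudo (fun p => ∑ i ∈ s, a i p) f x = ∑ i ∈ s, pseudo (a i) f x := by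
  classical
  induction s using Finset.induction_on with
  | empty => simp [pseudo]
  | insert i s hi ih =>
    simp only [Finset.sum_insert hi]
    rw [(ha i).pseudo_add (.sum ha), ih]

end Pseudo

end MixedSymbol
end
-- The symbol of a composite operator
noncomputable section
namespace MixedSymbol

open MeasureTheory

variable {d : ℕ} {D : Space d → Submodule ℝ (Space d)}

section Composition

lemma phase_add (s t : ℝ) : phase (s + t) = phase s * phase t := by
  rw [phase, phase, phase, ← Complex.exp_add]
  congr 1
  push_cast
  ring

lemma fourier_translate (g : Space d → ℂ) (x η : Space d) :
    𝓕 (fun z => g (x + z)) η = phase (-inner ℝ x η) * 𝓕 g η := by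
  rw [fourier_eq_phase, fourier_eq_phase, ← integral_const_mul,
    ← integral_add_left_eq_self (fun y => phase (-inner ℝ x η) * (phase (inner ℝ y η) * g y)) x]
  refine integral_congr_ae (Filter.Eventually.of_forall fun z => ?_)
  simp only
  rw [← mul_assoc, ← phase_add, inner_add_left, neg_add_cancel_left]

lemma pseudo_eq_phase (a : Space d × Space d → ℂ) (f : 𝓢(Space d, ℂ)) (x : Space d) :
    pseudo a f x = ∫ ξ, phase (-inner ℝ x ξ) * (a (x, ξ) * 𝓕 (f : Space d → ℂ) ξ) := by
  rw [pseudo_eq_osc, osc, ft, fourier_eq_phase]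
  simp only [inner_neg_right, real_inner_comm]

/-- Centring g at x absorbs the phase e^{2πi x·η}, so that T_a becomes a pairing in which cutoffs in
z = y - x can be inserted. -/
lemma pseudo_eq_pair (a : Space d × Space d → ℂ) (g : 𝓢(Space d, ℂ)) (x : Space d) :
    pseudo a g x = pair (fun η => a (x, η)) (fun z => g (x + z)) := by
  rw [pseudo_eq_phase, pair]
  refine integral_congr_ae (Filter.Eventually.of_forall fun ξ => ?_)
  simp only
  rw [fourier_translate]
  ring

variable {a b : Space d × Space d → ℂ}

lemma IsModerate.polyBdd (ha : IsModerate a) (x : Space d) : PolyBdd fun η => a (x, η) := by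
  obtain ⟨C, M, h0, hC⟩ := ha.norm_le
  exact ⟨C, M, h0, fun η => hC (x, η)⟩

lemma IsModerate.continuous_slice (ha : IsModerate a) (x : Space d) :
    Continuous fun η => a (x, η) := ha.smooth.continuous.comp (Continuous.prodMk_right x)

lemma IsRapid.isModerate (hb : IsRapid b) : IsModerate b := by
  refine ⟨hb.contDiff, fun k => ?_⟩
  obtain ⟨C, h0, hC⟩ := (hb 0).bound k
  exact ⟨C, 0, h0, fun p => by simpa [decay] using hC p (Set.mem_univ _)⟩

/-- Peetre's inequality. -/
lemma decay_sub_le (N : ℕ) (ξ η : Space d) :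
    decay N (η - ξ) ≤ (1 + ‖ξ‖) ^ N * decay N η := by
  have h : 1 + ‖η‖ ≤ (1 + ‖ξ‖) * (1 + ‖η - ξ‖) := by
    have := norm_le_norm_add_norm_sub' η ξ
    nlinarith [mul_nonneg (norm_nonneg ξ) (norm_nonneg (η - ξ))]
  unfold decay
  rw [← div_eq_mul_inv, le_div_iff₀ (by positivity), inv_mul_le_iff₀ (by positivity), ← mul_pow,
    mul_comm (1 + ‖η - ξ‖)]
  exact pow_le_pow_left₀ (by positivity) h N

/-- The Fourier transform of the composition amplitude is of rapid decay in all covectors. -/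
lemma norm_ft_ampV_le {G : Space d × Space d → ℝ} (hG : IsKernel (d + 3) G) (hb : IsRapid b)
    (N k : ℕ) : ∃ C : ℝ, 0 ≤ C ∧ ∀ (p : Space d × Space d) (θ : Space d),
    ‖ft (ampV G b) (p, θ)‖ ≤ C * decay N p.2 * decay k θ := by
  have h := DerivBound.smul (hG.comp_clm (mapG d)) ((hb N).comp_clm (mapB d))
  obtain ⟨V, hV0, hV⟩ := h.bound_le
    (fun x _ => mul_nonneg (decay_pos _ _).le (decay_pos _ _).le) k
  obtain ⟨C, h0, hC⟩ := norm_fourier_le (d := d) lt_decay_exp k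
  refine ⟨C * V, by positivity, fun p θ => ?_⟩
  have hd := (decay_pos N p.2).le
  have := hC (fun z => ampV G b (p, z)) 1 (V * decay N p.2) le_rfl (by positivity)
    (h.smooth.comp (contDiff_prodMk_right p)) (fun j hj z => ?_) θ
  · simpa [ft, mul_assoc] using this
  · rw [one_pow, mul_one, one_smul]
    refine (norm_iteratedFDeriv_slice_le h.smooth j p z).trans
      ((hV j hj (p, z) (Set.mem_univ _)).trans (le_of_eq ?_))
    simp only [mapG_apply, mapB_apply, add_sub_cancel_left]
    ring

lemma kernel_of_diff {k : ℕ} {φ : Space d → ℝ} (hφ : DerivBound Set.univ (decay k) φ) :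
    IsKernel k (fun q : Space d × Space d => φ (q.2 - q.1)) := by
  simpa using isKernel_comp hφ le_rfl

/-- The Fourier transform of a localized oscillatory integral. -/
lemma fourier_smul_pseudo {φ : Space d → ℝ} (hφ : DerivBound Set.univ (decay (d + 3)) φ)
    (hb : IsModerate b) (f : 𝓢(Space d, ℂ)) (x η : Space d) :
    𝓕 (fun z => φ z • pseudo b f (x + z)) η = ∫ ξ, phase (-inner ℝ x ξ) *
      ft (ampV (fun q => φ (q.2 - q.1)) fun p => b p * 𝓕 (f : Space d → ℂ) p.2)
        ((x, ξ), η - ξ) := by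
  have hr := hb.isRapid f
  set β : Space d × Space d → ℂ := fun p => b p * 𝓕 (f : Space d → ℂ) p.2 with hβ
  obtain ⟨C, h0, hC⟩ := hφ.norm_le
  obtain ⟨C', h0', hC'⟩ := (hr (d + 3)).norm_le
  have hph : Continuous phase := contDiff_phase.continuous
  have hφc := hφ.smooth.continuous
  have hβc := hr.contDiff.continuous
  -- The decay of φ in z and of b f^ in ξ makes the double integral absolutely convergent, so Fubini
  -- applies; without φ there is no decay in z.
  have hint : Integrable (Function.uncurry fun z ξ : Space d =>
      phase (inner ℝ z η) * φ z * (phase (-inner ℝ (x + z) ξ) * β (x + z, ξ)))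
      (volume.prod volume) := by
    refine Integrable.mono' (((integrable_decay lt_decay_exp).const_mul C).mul_prod
      ((integrable_decay lt_decay_exp).const_mul C')) (Continuous.aestronglyMeasurable ?_)
      (Filter.Eventually.of_forall fun ⟨z, ξ⟩ => ?_)
    · have c1 : Continuous fun p : Space d × Space d => phase (inner ℝ p.1 η) :=
        hph.comp (continuous_fst.inner continuous_const)
      have c2 : Continuous fun p : Space d × Space d => (φ p.1 : ℂ) :=
        Complex.continuous_ofReal.comp (hφc.comp continuous_fst)
      have c3 : Continuous fun p : Space d × Space d => phase (-inner ℝ (x + p.1) p.2) :=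
        hph.comp ((continuous_const.add continuous_fst).inner continuous_snd).neg
      have c4 : Continuous fun p : Space d × Space d => β (x + p.1, p.2) :=
        hβc.comp ((continuous_const.add continuous_fst).prodMk continuous_snd)
      exact (c1.mul c2).mul (c3.mul c4)
    · simp only [Function.uncurry, norm_mul, norm_phase, one_mul, Complex.norm_real]
      have := decay_pos (d + 3) z
      exact mul_le_mul (hC z (Set.mem_univ _)) (hC' (x + z, ξ) (Set.mem_univ _)) (norm_nonneg _)
        (by positivity)
  calc _ = ∫ z, ∫ ξ, phase (inner ℝ z η) * φ z * (phase (-inner ℝ (x + z) ξ) * β (x + z, ξ)) := by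
        rw [fourier_eq_phase]
        refine integral_congr_ae (Filter.Eventually.of_forall fun z => ?_)
        simp only
        rw [integral_const_mul, pseudo_eq_phase, Complex.real_smul, mul_assoc]
    _ = ∫ ξ, ∫ z, phase (inner ℝ z η) * φ z * (phase (-inner ℝ (x + z) ξ) * β (x + z, ξ)) :=
        integral_integral_swap hint
    _ = _ := by
        refine integral_congr_ae (Filter.Eventually.of_forall fun ξ => ?_)
        simp only
        rw [ft, fourier_eq_phase, ← integral_const_mul]
        refine integral_congr_ae (Filter.Eventually.of_forall fun z => ?_)
        simp only [ampV, mapG_apply, mapB_apply, add_sub_cancel_left, Complex.real_smul]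
        have e : phase (inner ℝ z η) * phase (-inner ℝ (x + z) ξ) =
            phase (-inner ℝ x ξ) * phase (inner ℝ z (η - ξ)) := by
          rw [← phase_add, ← phase_add]
          congr 1
          rw [inner_add_left, inner_sub_right]
          ring
        linear_combination (φ z * β (x + z, ξ)) * e

/-- The composition with a localized kernel. -/
lemma pair_smul_pseudo {φ : Space d → ℝ} (hφ : DerivBound Set.univ (decay (d + 3)) φ)
    (ha : IsModerate a) (hb : IsModerate b) (f : 𝓢(Space d, ℂ)) (x : Space d) :
    pair (fun η => a (x, η)) (fun z => φ z • pseudo b f (x + z)) =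
      pseudo (J a (fun q => φ (q.2 - q.1)) b) f x := by
  have hr := hb.isRapid f
  have hG := kernel_of_diff hφ
  set β : Space d × Space d → ℂ := fun p => b p * 𝓕 (f : Space d → ℂ) p.2 with hβ
  set G : Space d × Space d → ℝ := fun q => φ (q.2 - q.1) with hGdef
  obtain ⟨C, M, h0, hC⟩ := ha.norm_le
  -- In η - ξ, M powers pay for the growth of a and d + 3 give integrability in η. Peetre's
  -- inequality moves this decay to η at the cost of M + d + 3 powers in ξ, and the last d + 3
  -- powers make the ξ-integral converge.
  obtain ⟨C', h0', hC'⟩ := norm_ft_ampV_le hG hr (M + (d + 3) + (d + 3)) (M + (d + 3))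
  have hcont : Continuous (ft (ampV G β)) :=
    (IsModerate.locDecay_ampV hG hr.isModerate).ft_differentiable.1.continuous
  have hint : Integrable (Function.uncurry fun η ξ : Space d =>
      a (x, η) * (phase (-inner ℝ x ξ) * ft (ampV G β) ((x, ξ), η - ξ)))
      (volume.prod volume) := by
    refine Integrable.mono' (((integrable_decay lt_decay_exp).const_mul C).mul_prod
      ((integrable_decay lt_decay_exp).const_mul C')) (Continuous.aestronglyMeasurable ?_)
      (Filter.Eventually.of_forall fun ⟨η, ξ⟩ => ?_)
    · have c1 : Continuous fun p : Space d × Space d => a (x, p.1) :=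
        (ha.continuous_slice x).comp continuous_fst
      have c2 : Continuous fun p : Space d × Space d => phase (-inner ℝ x p.2) :=
        contDiff_phase.continuous.comp (continuous_const.inner continuous_snd).neg
      have c3 : Continuous fun p : Space d × Space d =>
          ft (ampV G β) ((x, p.2), p.1 - p.2) :=
        hcont.comp ((continuous_const.prodMk continuous_snd).prodMk
          (continuous_fst.sub continuous_snd))
      exact c1.mul (c2.mul c3)
    · simp only [Function.uncurry, norm_mul, norm_phase, one_mul]
      have d1 := decay_pos (M + (d + 3) + (d + 3)) ξ
      have d2 := decay_pos (M + (d + 3)) (η - ξ)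
      have d3 := pow_mul_decay (M + (d + 3)) (d + 3) ξ
      have d4 := pow_mul_decay M (d + 3) η
      have d5 := decay_sub_le (M + (d + 3)) ξ η
      calc _ ≤ C * (1 + ‖η‖) ^ M * (C' * decay (M + (d + 3) + (d + 3)) ξ *
            decay (M + (d + 3)) (η - ξ)) :=
            mul_le_mul (hC (x, η)) (hC' (x, ξ) (η - ξ)) (norm_nonneg _) (by positivity)
        _ ≤ C * (1 + ‖η‖) ^ M * (C' * decay (M + (d + 3) + (d + 3)) ξ *
            ((1 + ‖ξ‖) ^ (M + (d + 3)) * decay (M + (d + 3)) η)) := by gcongr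
        _ = C * ((1 + ‖η‖) ^ M * decay (M + (d + 3)) η) *
            (C' * ((1 + ‖ξ‖) ^ (M + (d + 3)) * decay (M + (d + 3) + (d + 3)) ξ)) := by ring
        _ = _ := by rw [d3, d4]
  calc _ = ∫ η, ∫ ξ, a (x, η) * (phase (-inner ℝ x ξ) * ft (ampV G β) ((x, ξ), η - ξ)) := by
        rw [pair]
        refine integral_congr_ae (Filter.Eventually.of_forall fun η => ?_)
        simp only
        rw [fourier_smul_pseudo hφ hb, integral_const_mul]
    _ = ∫ ξ, ∫ η, a (x, η) * (phase (-inner ℝ x ξ) * ft (ampV G β) ((x, ξ), η - ξ)) :=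
        integral_integral_swap hint
    _ = _ := by
        rw [pseudo_eq_phase]
        refine integral_congr_ae (Filter.Eventually.of_forall fun ξ => ?_)
        simp only
        -- The substitution η = ξ + θ produces the amplitude a(x, ξ + θ) of the composition
        -- integral.
        rw [← integral_add_left_eq_self _ ξ, J, ppair, pair, ← integral_mul_const,
          ← integral_const_mul]
        refine integral_congr_ae (Filter.Eventually.of_forall fun θ => ?_)
        have e : ft (ampV G β) ((x, ξ), θ) = 𝓕 (f : Space d → ℂ) ξ *
            𝓕 (fun z => ampV G b ((x, ξ), z)) θ := by
          rw [← fourier_const_mul, ft]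
          refine congrArg (fun v : Space d → ℂ => 𝓕 v θ) (funext fun z => ?_)
          simp only [ampV, hβ, mapB_apply, Complex.real_smul]
          ring
        simp only [add_sub_cancel_left, ampU, mapU_apply]
        rw [e]
        ring

lemma DerivBound.coord_smul {k : ℕ} {v : Space d → ℂ} (hv : DerivBound Set.univ (decay (k + 1)) v)
    (r : Fin (d + 1)) : DerivBound Set.univ (decay k) (fun z => z r • v z) := by
  have hT : DerivBound Set.univ (fun z : Space d => 1 + ‖z‖)
      (EuclideanSpace.proj (𝕜 := ℝ) r : Space d →L[ℝ] ℝ) := by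
    refine DerivBound.clm (fun _ _ => le_add_of_nonneg_right (norm_nonneg _)) _ (C := 1)
      fun z _ => ?_
    have : ‖(EuclideanSpace.proj (𝕜 := ℝ) r : Space d →L[ℝ] ℝ) z‖ ≤ ‖z‖ :=
      AdaptedFrame.abs_coord_le z r
    linarith
  refine DerivBound.mono (c := 1) (DerivBound.smul hT hv) zero_le_one fun z _ => ?_
  have := pow_mul_decay 1 k z
  rw [pow_one, add_comm 1 k] at this
  rw [this, one_mul]

lemma DerivBound.coord_pow_smul {k : ℕ} {v : Space d → ℂ} (r : Fin (d + 1)) (n : ℕ)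
    (hv : DerivBound Set.univ (decay (k + n)) v) :
    DerivBound Set.univ (decay k) (fun z => z r ^ n • v z) := by
  induction n generalizing k with
  | zero => simpa using hv
  | succ n ih =>
    have h := ih (k := k + 1) (by rwa [add_assoc, add_comm 1 n])
    simpa only [pow_succ', mul_smul] using h.coord_smul r

/-- Iterated integration by parts. -/
lemma pair_coord_pow (ha : IsModerate a) (x : Space d) (r : Fin (d + 1)) (n : ℕ) {v : Space d → ℂ}
    (hv : DerivBound Set.univ (decay (d + 3 + n)) v) :
    pair (fun η => a (x, η)) (fun z => z r ^ n • v z) =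
      ((2 * Real.pi * Complex.I)⁻¹) ^ n * pair (fun η => (partialXi r)^[n] a (x, η)) v := by
  induction n generalizing a with
  | zero => simp
  | succ n ih =>
    have hv1 : DerivBound Set.univ (decay (d + 3 + n)) v :=
      hv.mono zero_le_one fun z _ => by rw [one_mul]; exact decay_anti (by omega) z
    have e : (fun z : Space d => z r ^ (n + 1) • v z) = fun z =>
        (inner ℝ (EuclideanSpace.single r (1 : ℝ)) z : ℝ) • (z r ^ n • v z) := by
      funext z
      simp [EuclideanSpace.inner_single_left, pow_succ', mul_assoc]
    have e2 : dir (EuclideanSpace.single r 1) (fun η => a (x, η)) =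
        fun η => partialXi r a (x, η) := by
      funext η
      exact dir_slice_right ha.smooth.diff x _ η
    rw [e, pair_inner_smul _ (ha.polyBdd x) (ha.smooth.comp (contDiff_prodMk_right x)) _
      (hv1.coord_pow_smul r n) _, e2, ih (a := partialXi r a) (ha.dir _) hv1, pow_succ', Function.iterate_succ_apply]
    · ring
    · rw [e2]
      exact (ha.dir _).polyBdd x
    · rw [← e]
      exact hv.coord_pow_smul r (n + 1)

lemma pair_sum_right {ι : Type*} {s : Finset ι} {u : Space d → ℂ} {v : ι → Space d → ℂ}
    (hu : PolyBdd u) (hc : Continuous u) (hv : ∀ i, IsDecay (v i)) :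
    pair u (fun z => ∑ i ∈ s, v i z) = ∑ i ∈ s, pair u (v i) := by
  classical
  induction s using Finset.induction_on with
  | empty =>
    simpa using pair_const_mul_right 0 u (fun _ => 0)
  | insert i s hi ih =>
    simp only [Finset.sum_insert hi]
    rw [pair_add_right hu hc (hv i) (DerivBound.sum (fun _ _ => (decay_pos _ _).le) fun i _ => hv i),
      ih]

lemma derivBound_translate (g : 𝓢(Space d, ℂ)) (x : Space d) (N : ℕ) :
    DerivBound Set.univ (decay N) (fun z => g (x + z)) := by
  refine ⟨g.smooth'.comp (contDiff_const.add contDiff_id), fun k => ?_⟩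
  obtain ⟨C, h0, hC⟩ := norm_iteratedFDeriv_schwartz_le g k N
  refine ⟨C * (1 + ‖x‖) ^ N, by positivity, fun z _ => ?_⟩
  rw [iteratedFDeriv_comp_add_left]
  refine (hC _).trans ?_
  rw [mul_assoc]
  refine mul_le_mul_of_nonneg_left ?_ h0
  have := decay_sub_le N (-x) z
  rwa [sub_neg_eq_add, norm_neg, add_comm z x] at this

/-- The composition of two operators is an operator with symbol of the expected order. -/
theorem exists_comp_symbol {X : AdaptedFrame D} {m₁ n₁ m₂ n₂ : ℝ}
    (ha : IsSymbol X m₁ n₁ a) (hb : IsSymbol X m₂ n₂ b) :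
    ∃ c, IsSymbol X (m₁ + m₂) (n₁ + n₂) c ∧ ∀ f g : 𝓢(Space d, ℂ),
      (∀ y, g y = pseudo b f y) → ∀ x, pseudo a g x = pseudo c f x := by
  -- Large enough that the tail, decaying to order 2K, is a kernel of the order d + 4 demanded by
  -- `J_isSymbol`.
  set K := d + 4 with hK
  have hcut := derivBound_cutoff (d := d) (d + 4)
  have htail : DerivBound Set.univ (decay (d + 4)) (tail K : Space d → ℝ) :=
    (derivBound_tail K).mono zero_le_one fun z _ => by
      rw [one_mul]; exact decay_anti (by omega) z
  have weaken : ∀ {φ : Space d → ℝ}, DerivBound Set.univ (decay (d + 4)) φ →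
      DerivBound Set.univ (decay (d + 3)) φ := fun h => h.mono zero_le_one fun z _ => by
    rw [one_mul]; exact decay_anti (by omega) z
  have hs0 := J_isSymbol ha (kernel_of_diff hcut) hb
  have hs1 : ∀ r, IsSymbol X (m₁ + m₂) (n₁ + n₂) fun p => ((2 * Real.pi * Complex.I)⁻¹) ^ (2 * K) *
      -- The 2K derivatives serve only convergence here: they lower the order of a in w, and that
      -- gain is discarded by monotonicity.
      J ((partialXi r)^[2 * K] a) (fun q => tail K (q.2 - q.1)) b p := fun r =>
    (J_isSymbol ((ha.partialXi_iterate r (2 * K)).mono le_rfl (sub_le_self _ (Nat.cast_nonneg _)))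
      (kernel_of_diff htail) hb).const_mul _
  refine ⟨_, hs0.add (IsSymbol.sum (s := Finset.univ) fun r _ => hs1 r), fun f g hg x => ?_⟩
  have hd : ∀ (φ : Space d → ℝ) (N : ℕ), DerivBound Set.univ (decay (d + 4)) φ →
      DerivBound Set.univ (decay N) (fun z => φ z • g (x + z)) := by
    intro φ N hφ
    refine (DerivBound.smul hφ (derivBound_translate g x N)).mono zero_le_one fun z _ => ?_
    exact mul_le_mul_of_nonneg_right (decay_le_one _ _) (decay_pos _ _).le
  -- The constant 1 is not an admissible kernel, so it is replaced by the cutoff plus coordinate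
  -- powers times the tail. The expansion is made while g is still a Schwartz function, so every
  -- summand may be paired and integrated by parts.
  have e : (fun z => g (x + z)) = fun z => cutoff z • g (x + z) +
      ∑ r, z r ^ (2 * K) • (tail K z • g (x + z)) := by
    funext z
    simp only [smul_smul, ← Finset.sum_smul, ← add_smul]
    rw [cutoff_add_tail, one_smul]
  rw [pseudo_eq_pair, e, pair_add_right (ha.isModerate.polyBdd x)
    (ha.isModerate.continuous_slice x) (hd _ _ hcut)
    (DerivBound.sum (fun _ _ => (decay_pos _ _).le) fun r _ => (hd _ _ htail).coord_pow_smul r _),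
    pair_sum_right (ha.isModerate.polyBdd x) (ha.isModerate.continuous_slice x)
      (fun r => (hd _ _ htail).coord_pow_smul r _),
    hs0.isModerate.pseudo_add (.sum fun r => (hs1 r).isModerate),
    pseudo_sum fun r => (hs1 r).isModerate]
  simp only [hg]
  rw [pair_smul_pseudo (weaken hcut) ha.isModerate hb.isModerate]
  congr 1
  refine Finset.sum_congr rfl fun r _ => ?_
  rw [pseudo_const_mul, ← pair_smul_pseudo (weaken htail)
    (ha.partialXi_iterate r (2 * K)).isModerate hb.isModerate]
  simp only [← hg]
  exact pair_coord_pow ha.isModerate x r (2 * K) (hd _ _ htail)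

end Composition

end MixedSymbol
end
-- The operator algebras
noncomputable section
namespace MixedSymbol

open MeasureTheory

variable {d : ℕ} {D : Space d → Submodule ℝ (Space d)}

section Algebra

variable {X : AdaptedFrame D} {m n m' n' : ℝ} {T T' : Module.End ℂ 𝓢(Space d, ℂ)}

/-- Both weights are at least 1. Operators of different orders can thus be added in the class with
the larger orders, which makes the union closed under sums. -/
lemma Psi_mono (hm : m ≤ m') (hn : n ≤ n') (h : T ∈ Psi X m n) : T ∈ Psi X m' n' :=
  let ⟨a, ha, hT⟩ := h
  ⟨a, ha.mono hm hn, hT⟩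

lemma Psi_add (h : T ∈ Psi X m n) (h' : T' ∈ Psi X m n) : T + T' ∈ Psi X m n := by
  obtain ⟨a, ha, hT⟩ := h
  obtain ⟨a', ha', hT'⟩ := h'
  refine ⟨_, ha.add ha', fun f x => ?_⟩
  rw [ha.isModerate.pseudo_add ha'.isModerate, ← hT f x, ← hT' f x]
  rfl

lemma Psi_mul (h : T ∈ Psi X m n) (h' : T' ∈ Psi X m' n') :
    T * T' ∈ Psi X (m + m') (n + n') := by
  obtain ⟨a, ha, hT⟩ := h
  obtain ⟨b, hb, hT'⟩ := h'
  obtain ⟨c, hc, hcomp⟩ := exists_comp_symbol ha hb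
  exact ⟨c, hc, fun f x => (hT (T' f) x).trans (hcomp f (T' f) (hT' f) x)⟩

/-- Fourier inversion; it puts the identity, hence all scalars, into order (0, 0). -/
lemma pseudo_one (f : 𝓢(Space d, ℂ)) (x : Space d) : pseudo (fun _ => 1) f x = f x := by
  have h := congrArg (fun g : 𝓢(Space d, ℂ) => g x)
    (FourierTransform.fourierInv_fourier_eq (F := 𝓢(Space d, ℂ)) f)
  simp only [SchwartzMap.fourierInv_coe, SchwartzMap.fourier_coe] at h
  rw [← h, Real.fourierInv_eq', pseudo]
  refine integral_congr_ae (Filter.Eventually.of_forall fun ξ => ?_)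
  simp only [one_mul, smul_eq_mul]
  rw [mul_comm, real_inner_comm]
  congr 2
  push_cast
  ring

lemma algebraMap_mem_Psi (X : AdaptedFrame D) (z : ℂ) :
    algebraMap ℂ (Module.End ℂ 𝓢(Space d, ℂ)) z ∈ Psi X 0 0 := by
  refine ⟨fun _ => z, IsSymbol.const X z, fun f x => ?_⟩
  have := pseudo_const_mul (a := fun _ => 1) z f x
  simp only [mul_one, pseudo_one] at this
  rw [this]
  rfl

/-- The algebra of operators of all orders. -/
def psiAlgebra (X : AdaptedFrame D) : Subalgebra ℂ (Module.End ℂ 𝓢(Space d, ℂ)) where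
  carrier := ⋃ (m : ℝ) (n : ℝ), Psi X m n
  mul_mem' h h' := by
    simp only [Set.mem_iUnion] at h h' ⊢
    obtain ⟨m, n, h⟩ := h
    obtain ⟨m', n', h'⟩ := h'
    exact ⟨_, _, Psi_mul h h'⟩
  add_mem' h h' := by
    simp only [Set.mem_iUnion] at h h' ⊢
    obtain ⟨m, n, h⟩ := h
    obtain ⟨m', n', h'⟩ := h'
    exact ⟨max m m', max n n', Psi_add (Psi_mono (le_max_left _ _) (le_max_left _ _) h)
      (Psi_mono (le_max_right _ _) (le_max_right _ _) h')⟩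
  algebraMap_mem' z := by
    simp only [Set.mem_iUnion]
    exact ⟨0, 0, algebraMap_mem_Psi X z⟩

/-- The algebra of operators of order zero. -/
def psiZeroAlgebra (X : AdaptedFrame D) : Subalgebra ℂ (Module.End ℂ 𝓢(Space d, ℂ)) where
  carrier := Psi X 0 0
  mul_mem' h h' := by simpa using Psi_mul h h'
  add_mem' h h' := Psi_add h h'
  algebraMap_mem' z := algebraMap_mem_Psi X z

end Algebra

end MixedSymbol
end

theorem mainTheorem1 {d : ℕ} (D : MixedSymbol.Space d → Submodule ℝ (MixedSymbol.Space d))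
    (X : MixedSymbol.AdaptedFrame D) :
    (∀ (m₁ n₁ m₂ n₂ : ℝ) (a₁ a₂ : MixedSymbol.Space d × MixedSymbol.Space d → ℂ),
      MixedSymbol.IsSymbol X m₁ n₁ a₁ → MixedSymbol.IsSymbol X m₂ n₂ a₂ →
      ∃ (T₁ T₂ : Module.End ℂ 𝓢(MixedSymbol.Space d, ℂ))
        (a : MixedSymbol.Space d × MixedSymbol.Space d → ℂ),
        MixedSymbol.Represents a₁ T₁ ∧ MixedSymbol.Represents a₂ T₂ ∧
        MixedSymbol.IsSymbol X (m₁ + m₂) (n₁ + n₂) a ∧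
        MixedSymbol.Represents a (T₁ ∘ₗ T₂)) ∧
    (∃ 𝒜 : Subalgebra ℂ (Module.End ℂ 𝓢(MixedSymbol.Space d, ℂ)),
      (𝒜 : Set (Module.End ℂ 𝓢(MixedSymbol.Space d, ℂ))) =
        ⋃ (m : ℝ) (n : ℝ), MixedSymbol.Psi X m n) ∧
    (∃ 𝒜₀ : Subalgebra ℂ (Module.End ℂ 𝓢(MixedSymbol.Space d, ℂ)),
      (𝒜₀ : Set (Module.End ℂ 𝓢(MixedSymbol.Space d, ℂ))) = MixedSymbol.Psi X 0 0) := by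
  refine ⟨fun m₁ n₁ m₂ n₂ a₁ a₂ h₁ h₂ => ?_, ⟨MixedSymbol.psiAlgebra X, rfl⟩,
    ⟨MixedSymbol.psiZeroAlgebra X, rfl⟩⟩
  obtain ⟨c, hc, hcomp⟩ := MixedSymbol.exists_comp_symbol h₁ h₂
  exact ⟨h₁.isModerate.op, h₂.isModerate.op, c, h₁.isModerate.represents,
    h₂.isModerate.represents, hc, fun f x => (h₁.isModerate.represents (h₂.isModerate.op f) x).trans
      (hcomp f _ (h₂.isModerate.represents f) x)⟩
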